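/- Let $d\ge 2$ and let $\|u\|=\sum_i|u_i|$ on $\mathbb R^d$, $\mathbb C^d$ and $\mathbb Z^d$; $\|M\|$ is the induced operator norm of a real $d\times d$ matrix $M$. Continued fraction data. Let $F$ be a fundamental domain for the left action of $SL(d,\mathbb Z)$ on $SL(d,\mathbb R)$, $M=\begin{pmatrix}1&\alpha\\0&1\end{pmatrix}\begin{pmatrix}A&0\\ {}^t\beta&\gamma\end{pmatrix}\in SL(d,\mathbb R)$ with $\alpha,\beta\in\mathbb R^{d-1}$, $\gamma>0$, and $E^t=\mathrm{diag}(e^{-t},\dots,e^{-t},e^{(d-1)t})$. For each real $t$ let $P(t)\in SL(d,\mathbb Z)$ be the unique matrix with $P(t)ME^{t}\in F$. Let $0=t_0<t_1<\dots\to\infty$ with $P(t_{j+1})\ne P(t_j)$ for all $j$. Put $M^{(n)}=P(t_n)ME^{t_n}$, let $\gamma^{(n)}=M^{(n)}_{dd}$, fix $n\ge 0$ with $\gamma^{(n)}\neq0$, and set $$\omega^{(n)}=\frac1{\gamma^{(n)}}M^{(n)}(0,\dots,0,1)^{T},\qquad X_n^0(y)=\omega^{(n)}+\frac1{\gamma^{(n)}}M^{(n)}y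 .$$ Function spaces. For $\rho>0$ and $r=(a,b)$ with $a,b>0$ let $D_\rho=\{x\in\mathbb C^d:\|\mathrm{Im}\,x\|<\rho/2\pi\}$ and $B_r=\{y\in\mathbb C^d:\sum_{i<d}|y_i|<a,\ |y_d|<b\}$. Let $\mathcal A_{\rho,r}$ and $\mathcal A'_{\rho,r}$ be the Banach spaces of functions $f(x,y)=\sum_{k\in\mathbb Z^d}f_k(y)e^{2\pi i k\cdot x}$ from $D_\rho\times B_r$ to $\mathbb C^d$, with $f_k:B_r\to\mathbb C^d$ analytic and continuous up to $\overline{B_r}$, for which, with $\|f_k\|_r=\sup_{B_r}\|f_k\|$, respectively $$\|f\|_{\rho,r}=\sum_k\|f_k\|_r e^{\rho\|k\|}<\infty,\qquad \|f\|'_{\rho,r}=\sum_k(1+2\pi\|k\|)\|f_k\|_r e^{\rho\|k\|}<\infty .$$ Functions $X:D_\rho\times B_r\to\mathbb C^d$ are regarded as vector fields $(X,0)$ on $D_\rho\times B_r$, and $U^*X$ denotes the first component of the pull-back $(DU)^{-1}\,(X,0)\circ U$. For $\sigma>0$ let $I_n^-=\{k\in\mathbb Z^d:|k\cdot\omega^{(n)}|>\sigma\|k\|\}$,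 and let $\mathbb I_n^-$ and $\mathbb I_n^+=\mathbb I-\mathbb I_n^-$ be the projections onto the Fourier modes with index in $I_n^-$ and in its complement. Maps between open subsets of complex Banach spaces are analytic if they are complex differentiable. Theorem. Let $\rho,\nu,\sigma,a,b>0$, $r=(a,b)$, with $$b<\tfrac12,\qquad a\le\sigma\left(\tfrac12-b\right)|\gamma^{(n)}|\,\|M^{(n)}\|^{-1},\qquad \sigma<\|\omega^{(n)}\|,\qquad \varepsilon_n=\frac{\sigma}{42}\min\left\{\frac{\nu}{4\pi},\frac{\sigma}{72\|\omega^{(n)}\|}\right\},$$ and let $\mathcal V$ be the open ball of radius $\varepsilon_n$ around $X_n^0$ in $\mathcal A'_{\rho+\nu,r}$. For every $X=X_n^0+f\in\mathcal V$ and $t\in[0,1]$ there are $u_t=u_t(X)\in\mathcal A'_{\rho,r}$ and $U_t(x,y)=(x+u_t(x,y),y)$ such that: 1. $U_0=\mathrm{id}$; $t\mapsto u_t\in\mathcal A'_{\rho,r}$ is real-analytic on $[0,1]$; each $U_t$ maps $D_\rho\times B_r$ into $D_{\rho+\nu}\times B_r$ and is an analytic diffeomorphism onto its open image. 2. $U_t^*X\in\mathcal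 A_{\rho,r}$ and $\mathbb I_n^-U_t^*X=(1-t)\,\mathbb I_n^-X$. (In particular $\mathbb I_n^-U_1^*X=0$.) 3. $\|u_t\|'_{\rho,r}\le\dfrac{42t}{\sigma}\|\mathbb I_n^-f\|_{\rho,r}$ and $\|U_t^*X-X_n^0\|_{\rho,r}\le(3-t)\|f\|'_{\rho+\nu,r}$. 4. If $X$ takes real values at the real points of $D_{\rho+\nu}\times B_r$, then $U_t$ maps the real points of $D_\rho\times B_r$ into $\mathbb R^{2d}$. Moreover, for each $t\in[0,1]$ the maps $X\mapsto u_t(X)\in\mathcal A'_{\rho,r}$ and $X\mapsto U_t^*X$ are analytic on $\mathcal V$, the latter both into $\mathcal A_{\rho,r}$ and into $\mathbb I_n^+\mathcal A_{\rho,r}\oplus(1-t)\,\mathbb I_n^-\mathcal A'_{\rho+\nu,r}$, i.e. with $X\mapsto(\mathbb I_n^+U_t^*X,\,(1-t)\mathbb I_n^-X)$ analytic. -/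

import Mathlib

open Set Filter Topology

namespace TorusVF

/-! ### Continued fraction data: the matrices `M⁽ⁿ⁾` and the frequency vectors `ω⁽ⁿ⁾`

Throughout the dimension of the torus is `d = m + 1`; the last coordinate has index `Fin.last m`. -/

/-- `SL(d, ℝ)` with `d = m + 1`. -/
abbrev SLR (m : ℕ) := Matrix.SpecialLinearGroup (Fin (m + 1)) ℝ

/-- `SL(d, ℤ)` with `d = m + 1`. -/
abbrev SLZ (m : ℕ) := Matrix.SpecialLinearGroup (Fin (m + 1)) ℤ

/-- The inclusion of `SL(d, ℤ)` into `SL(d, ℝ)`. -/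
noncomputable abbrev toSLR {m : ℕ} (P : SLZ m) : SLR m :=
  Matrix.SpecialLinearGroup.map (Int.castRingHom ℝ) P

/-- The diagonal flow `E^t = diag(e^{-t}, …, e^{-t}, e^{(d-1)t})`. -/
noncomputable def flowE (m : ℕ) (t : ℝ) : SLR m :=
  ⟨Matrix.diagonal (Fin.snoc (fun _ : Fin m => Real.exp (-t)) (Real.exp (m * t))), by
    rw [Matrix.det_diagonal, Fin.prod_univ_castSucc]
    simp only [Fin.snoc_castSucc, Fin.snoc_last, Finset.prod_const, Finset.card_univ,
      Fintype.card_fin]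
    rw [← Real.exp_nat_mul, ← Real.exp_add]
    simp⟩

/-- `F` is a fundamental domain of the left action of `SL(d, ℤ)` on `SL(d, ℝ)`: its translates
cover the group, and `F ∩ P F = ∅` for `P ≠ 1`. -/
def IsFundamentalDomain {m : ℕ} (F : Set (SLR m)) : Prop :=
  (∀ M : SLR m, ∃ P : SLZ m, ∃ N ∈ F, M = toSLR P * N) ∧
    ∀ P : SLZ m, P ≠ 1 → ∀ N ∈ F, toSLR P * N ∉ F

/-- The matrix `P(t) ∈ SL(d, ℤ)` with `P(t) M E^t ∈ F` (it exists and is unique when `F` is a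
fundamental domain). -/
noncomputable def returnMatrix {m : ℕ} (F : Set (SLR m)) (M : SLR m) (t : ℝ) : SLZ m :=
  Classical.epsilon fun P : SLZ m => toSLR P * M * flowE m t ∈ F

/-- The data of the multidimensional continued fraction algorithm: a fundamental domain, a starting
matrix `M = (1 α; 0 1) (A 0; ᵗβ γ)` with `γ > 0` (these are the `M ∈ SL(d, ℝ)` whose last diagonal
entry, which is `γ`, is positive; then `(α, 1) = γ⁻¹ M e_d`), and a sequence of times. -/
structure CFData (m : ℕ) where
  F : Set (SLR m)
  isFundamentalDomain : IsFundamentalDomain F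
  M : SLR m
  M_pos : 0 < M (Fin.last m) (Fin.last m)
  t : ℕ → ℝ
  t_zero : t 0 = 0
  t_strictMono : StrictMono t
  t_tendsto : Tendsto t atTop atTop
  P_ne : ∀ n, returnMatrix F M (t (n + 1)) ≠ returnMatrix F M (t n)

namespace CFData

variable {m : ℕ} (c : CFData m) (n : ℕ)

/-- `P⁽ⁿ⁾ = P(t_n)`. -/
noncomputable def P : SLZ m := returnMatrix c.F c.M (c.t n)

/-- `M⁽ⁿ⁾ = P⁽ⁿ⁾ M E^{t_n}`. -/
noncomputable def Mn : Matrix (Fin (m + 1)) (Fin (m + 1)) ℝ :=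
  (toSLR (c.P n) * c.M * flowE m (c.t n) : SLR m).1

/-- `γ⁽ⁿ⁾`, the last diagonal entry of `M⁽ⁿ⁾`. -/
noncomputable def γ : ℝ := c.Mn n (Fin.last m) (Fin.last m)

/-- `ω⁽ⁿ⁾ = (γ⁽ⁿ⁾)⁻¹ M⁽ⁿ⁾ (0, …, 0, 1)`, in `ℝ^d` with the norm `‖u‖ = ∑ |u_i|`. -/
noncomputable def ω : PiLp 1 (fun _ : Fin (m + 1) => ℝ) :=
  WithLp.toLp 1 ((c.γ n)⁻¹ • (c.Mn n).mulVec (Pi.single (Fin.last m) 1))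

end CFData

/-- The operator norm of a real matrix with respect to the norm `‖x‖ = ∑ |x_i|`:
`sup_{x ≠ 0} ‖M x‖ / ‖x‖`. -/
noncomputable def matNorm {m : ℕ} (M : Matrix (Fin (m + 1)) (Fin (m + 1)) ℝ) : ℝ :=
  ⨆ x : {x : Fin (m + 1) → ℝ // x ≠ 0}, (∑ i, |M.mulVec x.1 i|) / ∑ i, |x.1 i|

/-! ### Domains and function spaces -/

/-- `ℂ^d` with the norm `‖u‖ = ∑ |u_i|`. -/
abbrev CVec (m : ℕ) := PiLp 1 (fun _ : Fin (m + 1) => ℂ)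

/-- `D_ρ = {x ∈ ℂ^d : ‖Im x‖ < ρ / 2π}`. -/
def strip (m : ℕ) (ρ : ℝ) : Set (CVec m) := {x | ∑ i, |(x i).im| < ρ / (2 * Real.pi)}

/-- `B_r = {y ∈ ℂ^d : ∑_{i<d} |y_i| < a, |y_d| < b}` for `r = (a, b)`. -/
def polyball (m : ℕ) (a b : ℝ) : Set (CVec m) :=
  {y | ∑ i : Fin m, ‖y i.castSucc‖ < a ∧ ‖y (Fin.last m)‖ < b}

lemma isBounded_polyball (m : ℕ) (a b : ℝ) : Bornology.IsBounded (polyball m a b) := by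
  refine (Metric.isBounded_iff_subset_closedBall (0 : CVec m)).2 ⟨a + b, fun y hy => ?_⟩
  rw [mem_closedBall_zero_iff, PiLp.norm_eq_of_L1, Fin.sum_univ_castSucc]
  exact add_le_add hy.1.le hy.2.le

instance instCompactClosurePolyball (m : ℕ) (a b : ℝ) :
    CompactSpace (closure (polyball m a b)) := by
  have : ProperSpace (CVec m) := FiniteDimensional.proper ℂ _
  exact isCompact_iff_compactSpace.1 (isBounded_polyball m a b).isCompact_closure

set_option linter.unusedSectionVars false

section Holomorphic

variable {E V : Type*} [NormedAddCommGroup E] [NormedSpace ℂ E] [NormedAddCommGroup V]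
  [NormedSpace ℂ V]

/-- A function on the closure of `Ω`, extended by zero. -/
noncomputable def extend {Ω : Set E} (g : C(closure Ω, V)) : E → V := by
  classical exact fun y => if h : y ∈ closure Ω then g ⟨y, h⟩ else 0

lemma extend_zero {Ω : Set E} : extend (0 : C(closure Ω, V)) = fun _ => 0 := by
  funext y; unfold extend; split_ifs <;> rfl

lemma extend_add {Ω : Set E} (g h : C(closure Ω, V)) :
    extend (g + h) = fun y => extend g y + extend h y := by
  funext y; unfold extend; split_ifs <;> simp

lemma extend_smul {Ω : Set E} (z : ℂ) (g : C(closure Ω, V)) :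
    extend (z • g) = fun y => z • extend g y := by
  funext y; unfold extend; split_ifs <;> simp

/-- Continuous functions on the closure of `Ω` which are analytic in `Ω`. (Complex
differentiability on an open set is analyticity.) -/
def holSubmodule (V : Type*) [NormedAddCommGroup V] [NormedSpace ℂ V] (Ω : Set E) :
    Submodule ℂ C(closure Ω, V) where
  carrier := {g | DifferentiableOn ℂ (extend g) Ω}
  zero_mem' := by
    change DifferentiableOn ℂ (extend 0) Ω
    rw [extend_zero]
    exact differentiableOn_const _
  add_mem' := fun {g h} hg hh => by
    change DifferentiableOn ℂ (extend (g + h)) Ω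
    rw [extend_add]
    exact DifferentiableOn.add hg hh
  smul_mem' := fun z g hg => by
    change DifferentiableOn ℂ (extend (z • g)) Ω
    rw [extend_smul]
    exact DifferentiableOn.const_smul hg z

/-- The space of analytic functions `Ω → V` with a continuous extension to the (compact) closure of
`Ω`, with the sup-norm. -/
def Hol (V : Type*) [NormedAddCommGroup V] [NormedSpace ℂ V] (Ω : Set E) : Type _ :=
  holSubmodule V Ω

noncomputable instance (Ω : Set E) [CompactSpace (closure Ω)] : NormedAddCommGroup (Hol V Ω) :=
  inferInstanceAs (NormedAddCommGroup (holSubmodule V Ω))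

noncomputable instance (Ω : Set E) [CompactSpace (closure Ω)] : NormedSpace ℂ (Hol V Ω) :=
  inferInstanceAs (NormedSpace ℂ (holSubmodule V Ω))

/-- The value of an element of `Hol V Ω` at a point of the closure of `Ω` (zero elsewhere). -/
noncomputable def Hol.val {Ω : Set E} (g : Hol V Ω) : E → V := extend g.1

end Holomorphic

/-- The space of analytic functions `B_r → ℂ^d`, `r = (a, b)`, with a continuous extension to the
closure of `B_r`, with the sup-norm. -/
abbrev Coef (m : ℕ) (a b : ℝ) : Type := Hol (CVec m) (polyball m a b)

/-- `‖k‖ = ∑ |k_i|` for `k ∈ ℤ^d`. -/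
def idxNorm {m : ℕ} (k : Fin (m + 1) → ℤ) : ℝ := ∑ i, |(k i : ℝ)|

lemma idxNorm_nonneg {m : ℕ} (k : Fin (m + 1) → ℤ) : 0 ≤ idxNorm k :=
  Finset.sum_nonneg fun _ _ => abs_nonneg _

/-- The weights `(1 + 2π‖k‖)^s e^{ρ‖k‖}`. -/
noncomputable def weight {m : ℕ} (s : ℕ) (ρ : ℝ) (k : Fin (m + 1) → ℤ) : ℝ :=
  (1 + 2 * Real.pi * idxNorm k) ^ s * Real.exp (ρ * idxNorm k)

lemma one_le_base {m : ℕ} (k : Fin (m + 1) → ℤ) : 1 ≤ 1 + 2 * Real.pi * idxNorm k := by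
  have := idxNorm_nonneg k
  have := Real.pi_pos
  nlinarith [mul_nonneg Real.pi_pos.le (idxNorm_nonneg k)]

lemma weight_pos {m : ℕ} (s : ℕ) (ρ : ℝ) (k : Fin (m + 1) → ℤ) : 0 < weight s ρ k :=
  mul_pos (pow_pos (zero_lt_one.trans_le (one_le_base k)) _) (Real.exp_pos _)

lemma weight_mono {m : ℕ} {s s' : ℕ} {ρ ρ' : ℝ} (hs : s' ≤ s) (hρ : ρ' ≤ ρ)
    (k : Fin (m + 1) → ℤ) : weight s' ρ' k ≤ weight s ρ k :=
  mul_le_mul (pow_le_pow_right₀ (one_le_base k) hs)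
    (Real.exp_le_exp.2 (mul_le_mul_of_nonneg_right hρ (idxNorm_nonneg k))) (Real.exp_pos _).le
    (pow_nonneg (zero_le_one.trans (one_le_base k)) _)

section Fourier

variable {m s s' : ℕ} {ρ ρ' : ℝ} {H : Type*} [NormedAddCommGroup H] [NormedSpace ℂ H]

/-- Families `(f_k)` of Fourier coefficients in `H` with `∑_k (1 + 2π‖k‖)^s ‖f_k‖ e^{ρ‖k‖}`
finite. -/
def fourierSubmodule (H : Type*) [NormedAddCommGroup H] [NormedSpace ℂ H] (m s : ℕ) (ρ : ℝ) :
    Submodule ℂ ((Fin (m + 1) → ℤ) → H) where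
  carrier := {f | Summable fun k => weight s ρ k * ‖f k‖}
  zero_mem' := by
    change Summable fun k => weight s ρ k * ‖(0 : H)‖
    simp only [norm_zero, mul_zero]
    exact summable_zero
  add_mem' := fun {f g} hf hg => by
    refine Summable.of_nonneg_of_le (fun k => mul_nonneg (weight_pos s ρ k).le (norm_nonneg _))
      (fun k => ?_) (Summable.add hf hg)
    rw [← mul_add]
    exact mul_le_mul_of_nonneg_left (norm_add_le _ _) (weight_pos s ρ k).le
  smul_mem' := fun z f hf => by
    have h : (fun k => weight s ρ k * ‖(z • f) k‖) = fun k => ‖z‖ * (weight s ρ k * ‖f k‖) := by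
      funext k; rw [Pi.smul_apply, norm_smul]; ring
    change Summable fun k => weight s ρ k * ‖(z • f) k‖
    rw [h]
    exact Summable.mul_left _ hf

/-- The space of such families. -/
def Fourier (H : Type*) [NormedAddCommGroup H] [NormedSpace ℂ H] (m s : ℕ) (ρ : ℝ) : Type _ :=
  fourierSubmodule H m s ρ

namespace Fourier

noncomputable instance : AddCommGroup (Fourier H m s ρ) :=
  inferInstanceAs (AddCommGroup (fourierSubmodule H m s ρ))

noncomputable instance : Module ℂ (Fourier H m s ρ) :=
  inferInstanceAs (Module ℂ (fourierSubmodule H m s ρ))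

/-- The Fourier coefficients `f_k`. -/
def coeff (f : Fourier H m s ρ) (k : Fin (m + 1) → ℤ) : H := f.1 k

lemma summable (f : Fourier H m s ρ) : Summable fun k => weight s ρ k * ‖f.coeff k‖ := f.2

/-- The norm `∑_k (1 + 2π‖k‖)^s ‖f_k‖ e^{ρ‖k‖}`. -/
noncomputable instance : Norm (Fourier H m s ρ) := ⟨fun f => ∑' k, weight s ρ k * ‖f.coeff k‖⟩

lemma norm_def (f : Fourier H m s ρ) : ‖f‖ = ∑' k, weight s ρ k * ‖f.coeff k‖ := rfl

lemma normedSpaceCore : NormedSpace.Core ℂ (Fourier H m s ρ) where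
  norm_nonneg f := tsum_nonneg fun k => mul_nonneg (weight_pos s ρ k).le (norm_nonneg _)
  norm_smul z f := by
    rw [norm_def, norm_def, ← tsum_mul_left]
    refine tsum_congr fun k => ?_
    have : (z • f).coeff k = z • f.coeff k := rfl
    rw [this, norm_smul]; ring
  norm_triangle f g := by
    rw [norm_def, norm_def, norm_def, ← f.summable.tsum_add g.summable]
    refine Summable.tsum_le_tsum (fun k => ?_) (f + g).summable (f.summable.add g.summable)
    rw [← mul_add]
    exact mul_le_mul_of_nonneg_left (norm_add_le _ _) (weight_pos s ρ k).le
  norm_eq_zero_iff f := by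
    constructor
    · intro h
      have h0 := (hasSum_zero_iff_of_nonneg
        (fun k => mul_nonneg (weight_pos s ρ k).le (norm_nonneg (f.coeff k)))).1
        (by rw [← h]; exact f.summable.hasSum)
      refine Subtype.ext (funext fun k => ?_)
      have hk := congrFun h0 k
      exact norm_eq_zero.1 ((mul_eq_zero.1 hk).resolve_left (weight_pos s ρ k).ne')
    · rintro rfl
      rw [norm_def]
      have : ∀ k, weight s ρ k * ‖(0 : Fourier H m s ρ).coeff k‖ = 0 := fun k => by
        have : (0 : Fourier H m s ρ).coeff k = 0 := rfl
        rw [this, norm_zero, mul_zero]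
      simp [this]

noncomputable instance : NormedAddCommGroup (Fourier H m s ρ) :=
  NormedAddCommGroup.ofCore normedSpaceCore

noncomputable instance : NormedSpace ℂ (Fourier H m s ρ) := NormedSpace.ofCore normedSpaceCore

open Classical in
/-- The projection that keeps the Fourier modes with index in `I`. -/
noncomputable def proj (I : Set (Fin (m + 1) → ℤ)) (f : Fourier H m s ρ) : Fourier H m s ρ :=
  ⟨fun k => if k ∈ I then f.coeff k else 0, by
    refine Summable.of_nonneg_of_le (fun k => mul_nonneg (weight_pos s ρ k).le (norm_nonneg _))
      (fun k => ?_) f.summable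
    refine mul_le_mul_of_nonneg_left ?_ (weight_pos s ρ k).le
    change ‖(if k ∈ I then f.coeff k else 0)‖ ≤ ‖f.coeff k‖
    split_ifs <;> simp⟩

/-- The inclusion between these spaces (restriction of functions to a smaller strip). -/
def incl (hs : s' ≤ s) (hρ : ρ' ≤ ρ) (f : Fourier H m s ρ) : Fourier H m s' ρ' :=
  ⟨f.1, Summable.of_nonneg_of_le (fun k => mul_nonneg (weight_pos s' ρ' k).le (norm_nonneg _))
    (fun k => mul_le_mul_of_nonneg_right (weight_mono hs hρ k) (norm_nonneg _)) f.summable⟩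

/-- The family with the single nonzero coefficient `h` at `k = 0`. -/
noncomputable def const (h : H) : Fourier H m s ρ :=
  ⟨Pi.single 0 h, by
    refine summable_of_ne_finset_zero (s := {0}) fun k hk => ?_
    rw [Finset.mem_singleton] at hk
    rw [Pi.single_eq_of_ne hk, norm_zero, mul_zero]⟩

end Fourier

end Fourier

/-- The Banach space of functions `f(x, y) = ∑_k f_k(y) e^{2πi k·x}` on `D_ρ × B_r`, `r = (a, b)`,
with finite norm `∑_k (1 + 2π‖k‖)^s ‖f_k‖_r e^{ρ‖k‖}`. An element is given by its Fourier
coefficients; the function is `VF.eval`. -/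
abbrev VF (m s : ℕ) (ρ a b : ℝ) : Type := Fourier (Coef m a b) m s ρ

/-- The space `𝒜_{ρ,r}`, `r = (a, b)`. -/
abbrev 𝒜 (m : ℕ) (ρ a b : ℝ) : Type := VF m 0 ρ a b

/-- The space `𝒜'_{ρ,r}`, `r = (a, b)`. -/
abbrev 𝒜' (m : ℕ) (ρ a b : ℝ) : Type := VF m 1 ρ a b

/-- The function `f(x, y) = ∑_k f_k(y) e^{2πi k·x}`. -/
noncomputable def VF.eval {m s : ℕ} {ρ a b : ℝ} (f : VF m s ρ a b) (p : CVec m × CVec m) : CVec m :=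
  ∑' k : Fin (m + 1) → ℤ,
    Complex.exp (2 * Real.pi * Complex.I * ∑ i, (k i : ℂ) * p.1 i) • (f.coeff k).val p.2

/-- The map `y ↦ ω⁽ⁿ⁾ + (γ⁽ⁿ⁾)⁻¹ M⁽ⁿ⁾ y` on `ℂ^d`. -/
noncomputable def affineField {m : ℕ} (c : CFData m) (n : ℕ) (y : CVec m) : CVec m :=
  WithLp.toLp 1 (fun i => (c.ω n i : ℂ) + (c.γ n : ℂ)⁻¹ * ∑ j, (c.Mn n i j : ℂ) * y j)

lemma differentiable_affineField {m : ℕ} (c : CFData m) (n : ℕ) :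
    Differentiable ℂ (affineField c n) := by
  have h : Differentiable ℂ fun y : CVec m => fun i =>
      (c.ω n i : ℂ) + (c.γ n : ℂ)⁻¹ * ∑ j, (c.Mn n i j : ℂ) * y j := by
    fun_prop
  exact (PiLp.continuousLinearEquiv 1 ℂ (fun _ : Fin (m + 1) => ℂ)).symm.differentiable.comp h

/-- The same map as an element of the coefficient space. -/
noncomputable def affineCoef {m : ℕ} (c : CFData m) (n : ℕ) (a b : ℝ) : Coef m a b :=
  ⟨⟨fun y => affineField c n y.1,
      (differentiable_affineField c n).continuous.comp continuous_subtype_val⟩, by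
    refine (differentiable_affineField c n).differentiableOn.congr fun y hy => ?_
    simp [extend, subset_closure hy]⟩

/-- The vector field `X_n^0(x, y) = ω⁽ⁿ⁾ + (γ⁽ⁿ⁾)⁻¹ M⁽ⁿ⁾ y`, which has only a constant Fourier
mode. -/
noncomputable def X0 {m : ℕ} (c : CFData m) (n s : ℕ) (ρ a b : ℝ) : VF m s ρ a b :=
  Fourier.const (affineCoef c n a b)

/-- The far from resonance indices `I_n^- = {k ∈ ℤ^d : |k·ω⁽ⁿ⁾| > σ ‖k‖}`. -/
def farModes {m : ℕ} (c : CFData m) (n : ℕ) (σ : ℝ) : Set (Fin (m + 1) → ℤ) :=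
  {k | σ * idxNorm k < |∑ i, (k i : ℝ) * c.ω n i|}

/-- `ε_n = (σ_n / 42) min {ν / 4π, σ_n / (72 ‖ω⁽ⁿ⁾‖)}`. -/
noncomputable def epsRadius {m : ℕ} (c : CFData m) (n : ℕ) (σ ν : ℝ) : ℝ :=
  σ / 42 * min (ν / (4 * Real.pi)) (σ / (72 * ‖c.ω n‖))

/-- The open ball of radius `ε` in `𝒜'_{ρ+ν,r}` centred at `X_n^0`. -/
def ballV {m : ℕ} (c : CFData m) (n : ℕ) (ρ ν a b ε : ℝ) : Set (𝒜' m (ρ + ν) a b) :=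
  Metric.ball (X0 c n 1 (ρ + ν) a b) ε

/-- The coordinate change `(x, y) ↦ (x + u(x, y), y)`. -/
noncomputable def shift {m s : ℕ} {ρ a b : ℝ} (u : VF m s ρ a b) (p : CVec m × CVec m) :
    CVec m × CVec m :=
  (p.1 + u.eval p, p.2)

/-- `X` seen as a vector field on a domain of `ℂ^d × ℂ^d`, with zero component along the parameter
direction. -/
noncomputable def fullField {m s : ℕ} {ρ a b : ℝ} (X : VF m s ρ a b) (p : CVec m × CVec m) :
    CVec m × CVec m :=
  (X.eval p, 0)

/-- `U` is an analytic diffeomorphism of the open set `Ω` onto an open set. (Over `ℂ`,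
differentiability on an open set is analyticity.) -/
def IsAnalyticDiffeoOn {m : ℕ} (U : CVec m × CVec m → CVec m × CVec m)
    (Ω : Set (CVec m × CVec m)) : Prop :=
  DifferentiableOn ℂ U Ω ∧ IsOpen (U '' Ω) ∧
    ∃ V : CVec m × CVec m → CVec m × CVec m,
      DifferentiableOn ℂ V (U '' Ω) ∧ ∀ p ∈ Ω, V (U p) = p

/-- The real points `ℝ^{2d}` of `ℂ^{2d}`. -/
def realPoints (m : ℕ) : Set (CVec m × CVec m) :=
  {p | ∀ i, (p.1 i).im = 0 ∧ (p.2 i).im = 0}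

/-- `X` takes real values at the real points of its domain. -/
def IsRealVF {m s : ℕ} {ρ a b : ℝ} (X : VF m s ρ a b) : Prop :=
  ∀ p ∈ strip m ρ ×ˢ polyball m a b, p ∈ realPoints m → ∀ i, (X.eval p i).im = 0

/-- Analyticity on an open set of a map between complex Banach spaces: it is (Fréchet) complex
differentiable at each point of the set. This is equivalent to being locally bounded and Gâteaux
differentiable there, and to being locally the sum of its Taylor series. -/
def IsAnalyticMapOn {E G : Type*} [NormedAddCommGroup E] [NormedSpace ℂ E]
    [NormedAddCommGroup G] [NormedSpace ℂ G] (Φ : E → G) (V : Set E) : Prop :=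
  ∀ X ∈ V, DifferentiableAt ℂ Φ X

end TorusVF

open TorusVF

/-! Write N for X_n^0 and Y for the pull-back of X under U(x, y) = (x + u(x, y), y). The fields have
no y-component, so no y-derivative enters and the conjugacy relation reads (1 + D_x u) Y = X ∘ U.
The task is to choose u so that the far modes of Y are (1 - t) times those of X.

Since N depends on y only, u ↦ D_x u N is diagonal in the Fourier modes: mode k is multiplied by 2πi
k·N(y). Here N(y) is (1 + y_d)ω plus a transverse term of norm at most σ(1/2 - b), so for far modes
this divisor has modulus at least πσ‖k‖ on the closure of B_r (`le_norm_dotL_affineCoef`,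
`le_norm_freq`). The bound grows like ‖k‖, hence division by it regains the derivative lost in D_x:
the inverse L = `linv` maps `𝒜` to `𝒜'` with norm at most 3/σ (`norm_linv_le`). A single contraction
on a fixed strip therefore suffices.

The equation becomes u = L(Y + D_x u N - (1 - t)X). The added term D_x u N cancels the leading
linear dependence of Y on u, so for X in the ε-ball the right side contracts the δ-ball by the
factor 1/4 (`norm_step_sub_step_le`). Applying D_x(·)N to the fixed point equation gives back the
homotopy equation (`proj_pull_sol`).

For analyticity, t is replaced by a complex z with |z| < 2. Composition is jointly complex
differentiable (`differentiableAt_comp`), and the fixed point of a uniform contraction inherits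
differentiability in its parameters (`differentiableAt_fixedPoint`). For real data the Picard
iterates from 0 are real, hence so is their limit (`IsReal.sol`). Finally the formal series are
matched with functions: ‖D_x u‖ ≤ ‖u‖ < 1 makes U injective with invertible derivative
(`isAnalyticDiffeoOn_shift`), and Y is the geometric pull-back (`fullField_eq_pullback`). -/

namespace TorusVF

/-! ### Complex differentiable maps between Banach spaces -/

section General

variable {E F : Type*} [NormedAddCommGroup E] [NormedSpace ℂ E] [NormedAddCommGroup F]
  [NormedSpace ℂ F]

/-- Cauchy's estimate for the Fréchet derivative. -/
lemma norm_fderiv_le_of_forall_mem_ball {f : E → F} {x : E} {r M : ℝ} (hr : 0 < r)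
    (hf : DifferentiableOn ℂ f (Metric.ball x r)) (hM : ∀ y ∈ Metric.ball x r, ‖f y‖ ≤ M) :
    ‖fderiv ℂ f x‖ ≤ M / (r / 2) := by
  have hx : x ∈ Metric.ball x r := Metric.mem_ball_self hr
  have hM0 : 0 ≤ M := (norm_nonneg _).trans (hM x hx)
  refine ContinuousLinearMap.opNorm_le_bound _ (by positivity) fun v => ?_
  rcases eq_or_ne v 0 with rfl | hv
  · simp
  have hv' : 0 < ‖v‖ := norm_pos_iff.2 hv
  -- The one-variable Cauchy estimate is applied along the complex line through `x` in direction
  -- `v`; this radius keeps the closed disc at distance at most `r / 2` from `x`.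
  set R : ℝ := r / 2 / ‖v‖ with hR
  have hR0 : 0 < R := by positivity
  have hmem : ∀ z ∈ Metric.closedBall (0 : ℂ) R, x + z • v ∈ Metric.ball x r := fun z hz => by
    rw [mem_closedBall_zero_iff] at hz
    rw [Metric.mem_ball, dist_eq_norm, add_sub_cancel_left, norm_smul]
    calc ‖z‖ * ‖v‖ ≤ R * ‖v‖ := by gcongr
      _ = r / 2 := by rw [hR]; field_simp
      _ < r := by linarith
  have hd : DifferentiableOn ℂ (fun z : ℂ => f (x + z • v)) (Metric.closedBall 0 R) :=
    hf.comp (by fun_prop) hmem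
  have hD : HasDerivAt (fun z : ℂ => f (x + z • v)) (fderiv ℂ f x v) 0 := by
    have h1 : HasFDerivAt f (fderiv ℂ f x) (x + (0 : ℂ) • v) := by
      simpa using ((hf x hx).differentiableAt (Metric.isOpen_ball.mem_nhds hx)).hasFDerivAt
    have h2 : HasDerivAt (fun z : ℂ => x + z • v) v 0 := by
      simpa using ((hasDerivAt_id (0 : ℂ)).smul_const v).const_add x
    exact h1.comp_hasDerivAt 0 h2
  have := Complex.norm_deriv_le_of_forall_mem_sphere_norm_le hR0
    (DifferentiableOn.diffContOnCl_ball (U := Metric.closedBall 0 R) hd subset_rfl) (C := M)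
    fun z hz => hM _ (hmem z (Metric.sphere_subset_closedBall hz))
  rw [hD.deriv] at this
  refine this.trans_eq ?_
  rw [hR]; field_simp

/-- A uniform limit of complex differentiable maps on an open set is complex differentiable. -/
lemma differentiableOn_of_tendstoUniformlyOn [CompleteSpace F] {ι : Type*} {l : Filter ι} [l.NeBot]
    {f : ι → E → F} {g : E → F} {Ω : Set E} (hΩ : IsOpen Ω) (h : TendstoUniformlyOn f g l Ω)
    (hf : ∀ n, DifferentiableOn ℂ (f n) Ω) : DifferentiableOn ℂ g Ω := by
  intro x hx
  obtain ⟨r, hr, hball⟩ := Metric.isOpen_iff.1 hΩ x hx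
  have hsub : ∀ y ∈ Metric.ball x (r / 2), Metric.ball y (r / 2) ⊆ Ω := fun y hy z hz =>
    hball (Metric.mem_ball.2 ((dist_triangle z y x).trans_lt
      (by have := Metric.mem_ball.1 hy; have := Metric.mem_ball.1 hz; linarith)))
  have hcau : UniformCauchySeqOn (fun n => fderiv ℂ (f n)) l (Metric.ball x (r / 2)) := by
    intro V hV
    obtain ⟨e, he, heV⟩ := Metric.mem_uniformity_dist.1 hV
    -- Cauchy's estimate on balls of radius `r / 2` divides by `r / 4`, so `e * r / 8` becomes `e /
    -- 2 < e` for the derivatives.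
    have hu := h.uniformCauchySeqOn _ (Metric.dist_mem_uniformity (by positivity : 0 < e * r / 8))
    filter_upwards [hu] with n hn y hy
    refine heV ?_
    have hd : ∀ i, DifferentiableAt ℂ (f i) y := fun i =>
      (hf i).differentiableAt (hΩ.mem_nhds (hsub y hy (Metric.mem_ball_self (by linarith))))
    rw [dist_eq_norm, ← fderiv_sub (hd _) (hd _)]
    have := norm_fderiv_le_of_forall_mem_ball (f := f n.1 - f n.2) (M := e * r / 8)
      (by linarith : 0 < r / 2) (((hf n.1).sub (hf n.2)).mono (hsub y hy)) fun z hz => by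
        have := hn z (hsub y hy hz)
        simp only [dist_eq_norm] at this
        exact this.le
    refine this.trans_lt ?_
    field_simp
    linarith
  choose! g' hg' using fun y (hy : y ∈ Metric.ball x (r / 2)) =>
    cauchy_map_iff_exists_tendsto.1 (hcau.cauchy_map hy)
  exact (hasFDerivAt_of_tendstoUniformlyOn Metric.isOpen_ball
    (hcau.tendstoUniformlyOn_of_tendsto hg')
    (fun n y hy => ((hf n y (hsub y hy (Metric.mem_ball_self (by linarith)))).differentiableAt
      (hΩ.mem_nhds (hsub y hy (Metric.mem_ball_self (by linarith))))).hasFDerivAt)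
    (fun y hy => h.tendsto_at (hsub y hy (Metric.mem_ball_self (by linarith))))
    (Metric.mem_ball_self (by linarith))).differentiableAt.differentiableWithinAt

/-- A complex differentiable map on an open set is strictly differentiable. -/
lemma hasStrictFDerivAt_of_differentiableOn {f : E → F} {Ω : Set E} (hΩ : IsOpen Ω)
    (hf : DifferentiableOn ℂ f Ω) {x : E} (hx : x ∈ Ω) :
    HasStrictFDerivAt f (fderiv ℂ f x) x := by
  obtain ⟨r, hr, M, hball, hM⟩ : ∃ r > 0, ∃ M : ℝ, Metric.ball x (4 * r) ⊆ Ω ∧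
      ∀ y ∈ Metric.ball x (4 * r), ‖f y‖ ≤ M := by
    have hc := ((hf x hx).differentiableAt (hΩ.mem_nhds hx)).continuousAt.norm
    have := (hc.eventually (gt_mem_nhds (lt_add_one ‖f x‖))).and (hΩ.mem_nhds hx)
    obtain ⟨R, hR, h⟩ := Metric.eventually_nhds_iff_ball.1 this
    refine ⟨R / 4, by linarith, ‖f x‖ + 1, fun y hy => (h y ?_).2, fun y hy => (h y ?_).1.le⟩ <;>
    · rwa [mul_div_cancel₀ _ (by norm_num)] at hy
  have hM0 : 0 ≤ M := (norm_nonneg _).trans (hM x (Metric.mem_ball_self (by linarith)))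
  have hmem : ∀ {s t : ℝ} {y z : E}, y ∈ Metric.ball x s → z ∈ Metric.ball y t →
      z ∈ Metric.ball x (s + t) := fun hy hz => Metric.mem_ball.2
    ((dist_triangle _ _ _).trans_lt (by
      have := Metric.mem_ball.1 hy; have := Metric.mem_ball.1 hz; linarith))
  have hdiff : ∀ y ∈ Metric.ball x (4 * r), DifferentiableAt ℂ f y := fun y hy =>
    (hf y (hball hy)).differentiableAt (hΩ.mem_nhds (hball hy))
  -- A bound on the ball of radius `4 * r` bounds the derivative on that of radius `3 * r`, hence
  -- gives a Lipschitz constant there.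
  have hlip : ∀ y ∈ Metric.ball x (3 * r), ∀ z ∈ Metric.ball x (3 * r),
      ‖f y - f z‖ ≤ M / (r / 2) * ‖y - z‖ := fun y hy z hz => by
    refine (convex_ball x (3 * r)).norm_image_sub_le_of_norm_fderiv_le (𝕜 := ℂ)
      (fun w hw => hdiff w ?_) (fun w hw => ?_) hz hy
    · exact Metric.ball_subset_ball (by linarith) hw
    · have hs : Metric.ball w r ⊆ Metric.ball x (4 * r) := fun v hv => by
        have := hmem hw hv
        rwa [show 3 * r + r = 4 * r by ring] at this
      exact norm_fderiv_le_of_forall_mem_ball hr (hf.mono (hs.trans hball)) fun v hv => hM v (hs hv)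
  refine hasStrictFDerivAt_of_hasFDerivAt_of_continuousAt (𝕜 := ℂ) (f' := fderiv ℂ f)
    (eventually_of_mem (Metric.ball_mem_nhds x (by linarith : 0 < 4 * r))
      fun y hy => (hdiff y hy).hasFDerivAt) ?_
  rw [ContinuousAt, tendsto_iff_norm_sub_tendsto_zero]
  refine squeeze_zero' (Eventually.of_forall fun _ => norm_nonneg _)
    (g := fun y => M / (r / 2) * ‖y - x‖ / (r / 2)) ?_ ?_
  · filter_upwards [Metric.ball_mem_nhds x hr] with y hy
    have hy' : ‖y - x‖ < r := by rwa [← dist_eq_norm]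
    have hadd : ∀ z ∈ Metric.ball x r, y - x + z ∈ Metric.ball x (2 * r) := fun z hz => by
      rw [Metric.mem_ball, dist_eq_norm] at hz ⊢
      calc ‖y - x + z - x‖ = ‖(y - x) + (z - x)‖ := by congr 1; abel
        _ ≤ ‖y - x‖ + ‖z - x‖ := norm_add_le _ _
        _ < 2 * r := by linarith
    have hA : ∀ z ∈ Metric.ball x r, DifferentiableAt ℂ (fun z => f (y - x + z) - f z) z :=
      fun z hz => DifferentiableAt.sub
        (DifferentiableAt.comp z
          (hdiff _ (Metric.ball_subset_ball (by linarith) (hadd z hz))) (by fun_prop))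
        (hdiff z (Metric.ball_subset_ball (by linarith) hz))
    -- The difference of the two derivatives is the derivative at `x` of one function, the
    -- difference between a translate of `f` and `f`. It is O(‖y - x‖) by `hlip`, so Cauchy's
    -- estimate shows that the derivative is continuous at `x`.
    have hE : fderiv ℂ f y - fderiv ℂ f x = fderiv ℂ (fun z => f (y - x + z) - f z) x := by
      have hx0 : x ∈ Metric.ball x r := Metric.mem_ball_self hr
      have h1 : DifferentiableAt ℂ f (y - x + x) :=
        hdiff _ (Metric.ball_subset_ball (by linarith) (hadd x hx0))
      have h2 : HasFDerivAt (fun z => f (y - x + z)) (fderiv ℂ f (y - x + x)) x :=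
        h1.hasFDerivAt.comp x ((hasFDerivAt_id x).const_add (y - x))
      have h3 := h2.sub (hdiff x (Metric.mem_ball_self (by linarith))).hasFDerivAt
      rw [sub_add_cancel] at h3
      exact h3.fderiv.symm
    rw [hE]
    refine norm_fderiv_le_of_forall_mem_ball hr
      (fun z hz => (hA z hz).differentiableWithinAt) fun z hz => ?_
    have := hlip (y - x + z) (Metric.ball_subset_ball (by linarith) (hadd z hz)) z
      (Metric.ball_subset_ball (by linarith) hz)
    simpa using this
  · have : Tendsto (fun y => M / (r / 2) * ‖y - x‖ / (r / 2)) (𝓝 x)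
        (𝓝 (M / (r / 2) * ‖x - x‖ / (r / 2))) := Continuous.tendsto (by fun_prop) x
    simpa using this

/-- An injective complex differentiable map on an open set whose derivatives are invertible has
open image, and its inverse is complex differentiable. -/
lemma isOpen_image_and_exists_inverse [CompleteSpace E] {U : E → E} {Ω : Set E} (hΩ : IsOpen Ω)
    (hU : DifferentiableOn ℂ U Ω) (hinj : InjOn U Ω)
    (hinv : ∀ x ∈ Ω, ∃ A : E ≃L[ℂ] E, fderiv ℂ U x = A) :
    IsOpen (U '' Ω) ∧ ∃ V : E → E, DifferentiableOn ℂ V (U '' Ω) ∧ ∀ p ∈ Ω, V (U p) = p := by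
  choose! A hA using hinv
  have hs : ∀ x ∈ Ω, HasStrictFDerivAt U (A x : E →L[ℂ] E) x := fun x hx =>
    hA x hx ▸ hasStrictFDerivAt_of_differentiableOn hΩ hU hx
  refine ⟨isOpen_iff_mem_nhds.2 ?_, Function.invFunOn U Ω, ?_, fun p hp => ?_⟩
  · rintro _ ⟨x, hx, rfl⟩
    rw [← (hs x hx).map_nhds_eq_of_equiv]
    exact image_mem_map (hΩ.mem_nhds hx)
  · rintro _ ⟨x, hx, rfl⟩
    have hL := (hs x hx).to_localInverse
    have h1 : ∀ᶠ q in 𝓝 (U x), (hs x hx).localInverse U (A x) x q ∈ Ω :=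
      hL.hasFDerivAt.continuousAt.eventually
        (by rw [(hs x hx).localInverse_apply_image]; exact hΩ.mem_nhds hx)
    have h2 := (hs x hx).eventually_right_inverse
    -- Injectivity on `Ω` forces the global inverse to agree with the local one of the inverse
    -- function theorem wherever the latter lands in `Ω`.
    have h3 : Function.invFunOn U Ω =ᶠ[𝓝 (U x)] (hs x hx).localInverse U (A x) x := by
      filter_upwards [h1, h2] with q hq hq'
      have hex : ∃ y ∈ Ω, U y = q := ⟨_, hq, hq'⟩
      exact hinj (Function.invFunOn_mem hex) hq ((Function.invFunOn_eq hex).trans hq'.symm)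
    exact (hL.hasFDerivAt.congr_of_eventuallyEq h3).differentiableAt.differentiableWithinAt
  · exact hinj (Function.invFunOn_mem ⟨p, hp, rfl⟩) hp (Function.invFunOn_eq ⟨p, hp, rfl⟩)

/-- Differentiable dependence of a fixed point on a parameter. -/
lemma differentiableAt_fixedPoint [CompleteSpace F] {T : E × F → F} {g : E → F} {p₀ : E} {S : Set F}
    {K : ℝ} (hK : K < 1) (hT : DifferentiableAt ℂ T (p₀, g p₀)) (hS : S ∈ 𝓝 (g p₀))
    (hgS : ∀ᶠ p in 𝓝 p₀, g p ∈ S) (hfix : ∀ᶠ p in 𝓝 p₀, T (p, g p) = g p)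
    (hlip : ∀ᶠ p in 𝓝 p₀, ∀ v ∈ S, ∀ w ∈ S, ‖T (p, v) - T (p, w)‖ ≤ K * ‖v - w‖)
    (hK0 : 0 ≤ K) : DifferentiableAt ℂ g p₀ := by
  obtain ⟨A, hA⟩ := hT
  have h0 : T (p₀, g p₀) = g p₀ := hfix.self_of_nhds
  have hA1 : HasFDerivAt (fun p => T (p, g p₀)) (A.comp (ContinuousLinearMap.inl ℂ E F)) p₀ :=
    hA.comp p₀ (f := fun p => (p, g p₀)) (hasFDerivAt_prodMk_left p₀ (g p₀))
  have hA2 : HasFDerivAt (fun v => T (p₀, v)) (A.comp (ContinuousLinearMap.inr ℂ E F)) (g p₀) :=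
    hA.comp (g p₀) (f := fun v => (p₀, v)) (hasFDerivAt_prodMk_right p₀ (g p₀))
  set B := A.comp (ContinuousLinearMap.inr ℂ E F) with hB
  -- The contraction constant bounds the partial derivative in the fixed point variable, so `1 - B`
  -- is invertible by a Neumann series.
  have hBn : ‖B‖ ≤ K := hA2.le_of_lip' hK0 (by
    filter_upwards [hS] with v hv
    exact hlip.self_of_nhds v hv _ (mem_of_mem_nhds hS))
  -- Continuity of `g` is not assumed: the contraction property bounds `g p - g p₀` by `(1 - K)⁻¹`
  -- times the displacement of `g p₀` under the map with parameter `p`.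
  have hO : (fun p => g p - g p₀) =O[𝓝 p₀] fun p => p - p₀ := by
    refine Asymptotics.IsBigO.trans ?_ hA1.isBigO_sub
    refine Asymptotics.IsBigO.of_bound (1 - K)⁻¹ ?_
    filter_upwards [hgS, hfix, hlip] with p h1 h2 h3
    have h4 := h3 _ h1 _ (mem_of_mem_nhds hS)
    rw [h2] at h4
    rw [h0, inv_mul_eq_div, le_div_iff₀ (by linarith)]
    have h5 : ‖g p - g p₀‖ ≤ ‖g p - T (p, g p₀)‖ + ‖T (p, g p₀) - g p₀‖ :=
      norm_sub_le_norm_sub_add_norm_sub ..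
    nlinarith
  have hcont : Tendsto (fun p => (p, g p)) (𝓝 p₀) (𝓝 (p₀, g p₀)) := by
    refine tendsto_id.prodMk_nhds (tendsto_sub_nhds_zero_iff.1 (hO.trans_tendsto ?_))
    exact tendsto_sub_nhds_zero_iff.2 tendsto_id
  have ho := hA.isLittleO.comp_tendsto hcont
  have hO' : ((fun q : E × F => q - (p₀, g p₀)) ∘ fun p => (p, g p)) =O[𝓝 p₀] fun p => p - p₀ :=
    Asymptotics.IsBigO.prod_left (Asymptotics.isBigO_refl _ _) hO
  have ho' := ho.trans_isBigO hO'
  obtain ⟨W, hW⟩ : IsUnit (1 - B) :=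
    (Units.oneSub B (hBn.trans_lt hK)).isUnit
  -- The candidate derivative is the one from implicit differentiation: (1 - ∂_v T)⁻¹ ∂_p T.
  refine ⟨((↑W⁻¹ : F →L[ℂ] F)).comp (A.comp (ContinuousLinearMap.inl ℂ E F)), .of_isLittleO ?_⟩
  have hW' : ∀ v : F, (↑W⁻¹ : F →L[ℂ] F) (v - B v) = v := fun v => by
    have : ((↑W⁻¹ : F →L[ℂ] F) * (1 - B)) v = v := by rw [← hW, W.inv_mul]; rfl
    simpa using this
  have hL := (ContinuousLinearMap.isBigO_comp (↑W⁻¹ : F →L[ℂ] F) _ _).trans_isLittleO ho'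
  refine hL.congr' ?_ EventuallyEq.rfl
  filter_upwards [hfix] with p hp
  have hsplit : A ((p, g p) - (p₀, g p₀)) = A.comp (ContinuousLinearMap.inl ℂ E F) (p - p₀)
      + B (g p - g p₀) := by
    rw [hB, ContinuousLinearMap.comp_apply, ContinuousLinearMap.comp_apply, ← map_add]
    simp
  simp only [Function.comp_apply, hp, h0, hsplit]
  conv_rhs => rw [← hW' (g p - g p₀)]
  simp only [ContinuousLinearMap.comp_apply, map_sub, map_add]
  abel

end General

/-! ### Lipschitz estimate for the exponential in a Banach algebra. -/

section Exp

lemma norm_pow_sub_pow_le {R : Type*} [NormedRing R] {x y : R} {r : ℝ} (hx : ‖x‖ ≤ r) (hy : ‖y‖ ≤ r) :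
    ∀ n : ℕ, ‖x ^ (n + 1) - y ^ (n + 1)‖ ≤ (n + 1) * r ^ n * ‖x - y‖
  | 0 => by simp
  | n + 1 => by
    have hr : 0 ≤ r := (norm_nonneg x).trans hx
    have h1 : x ^ (n + 2) - y ^ (n + 2) = x ^ (n + 1) * (x - y) + (x ^ (n + 1) - y ^ (n + 1)) * y := by
      rw [pow_succ x (n + 1), pow_succ y (n + 1)]; noncomm_ring
    have h2 : ‖x ^ (n + 1)‖ ≤ r ^ (n + 1) :=
      (norm_pow_le' x n.succ_pos).trans (pow_le_pow_left₀ (norm_nonneg _) hx _)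
    calc ‖x ^ (n + 2) - y ^ (n + 2)‖
        ≤ ‖x ^ (n + 1)‖ * ‖x - y‖ + ‖x ^ (n + 1) - y ^ (n + 1)‖ * ‖y‖ := by
          rw [h1]; exact (norm_add_le _ _).trans (add_le_add (norm_mul_le _ _) (norm_mul_le _ _))
      _ ≤ r ^ (n + 1) * ‖x - y‖ + ((n + 1) * r ^ n * ‖x - y‖) * r := by
          gcongr
          exact norm_pow_sub_pow_le hx hy n
      _ = _ := by push_cast; ring

variable {R : Type*} [NormedRing R] [NormedAlgebra ℂ R]

/-- The constant terms of the two series cancel, and the factor n + 1 from the difference of (n +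
1)-st powers turns (n + 1)! into n!, leaving the exponential series of `r`. -/
lemma norm_exp_sub_exp_le [CompleteSpace R] {x y : R} {r : ℝ} (hx : ‖x‖ ≤ r) (hy : ‖y‖ ≤ r) :
    ‖NormedSpace.exp x - NormedSpace.exp y‖ ≤ Real.exp r * ‖x - y‖ := by
  have h1 := (NormedSpace.exp_series_hasSum_exp' (𝕂 := ℂ) x).sub
    (NormedSpace.exp_series_hasSum_exp' (𝕂 := ℂ) y)
  rw [← hasSum_nat_add_iff' 1] at h1
  have h2 : HasSum (fun n : ℕ => r ^ n / n.factorial * ‖x - y‖) (Real.exp r * ‖x - y‖) := by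
    rw [Real.exp_eq_exp_ℝ]
    exact (NormedSpace.expSeries_div_hasSum_exp (𝔸 := ℝ) r).mul_right _
  have h3 := h1.norm_le_of_bounded h2 fun n => by
    rw [← smul_sub, norm_smul, norm_inv, Complex.norm_natCast, Nat.factorial_succ]
    have := norm_pow_sub_pow_le hx hy n
    have hf : (0 : ℝ) < n.factorial := by exact_mod_cast n.factorial_pos
    push_cast
    calc ((n + 1 : ℝ) * n.factorial)⁻¹ * ‖x ^ (n + 1) - y ^ (n + 1)‖
        ≤ ((n + 1 : ℝ) * n.factorial)⁻¹ * ((n + 1) * r ^ n * ‖x - y‖) := by gcongr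
      _ = _ := by field_simp
  simpa using h3

end Exp

end TorusVF

namespace TorusVF

/-! ### Operators on spaces of Fourier series -/

namespace Fourier

variable {m s s' : ℕ} {ρ ρ' : ℝ} {H H' H'' : Type*} [NormedAddCommGroup H] [NormedSpace ℂ H]
  [NormedAddCommGroup H'] [NormedSpace ℂ H'] [NormedAddCommGroup H''] [NormedSpace ℂ H'']
  {Z : Type*} [NormedAddCommGroup Z] [NormedSpace ℂ Z]

@[ext] lemma ext {f g : Fourier H m s ρ} (h : ∀ k, f.coeff k = g.coeff k) : f = g :=
  Subtype.ext (funext h)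

@[simp] lemma coeff_add (f g : Fourier H m s ρ) (k) : (f + g).coeff k = f.coeff k + g.coeff k := rfl

@[simp] lemma coeff_sub (f g : Fourier H m s ρ) (k) : (f - g).coeff k = f.coeff k - g.coeff k := rfl

@[simp] lemma coeff_smul (z : ℂ) (f : Fourier H m s ρ) (k) : (z • f).coeff k = z • f.coeff k := rfl

@[simp] lemma coeff_zero (k) : (0 : Fourier H m s ρ).coeff k = 0 := rfl

/-- Rescaling the coefficients identifies the space with an `ℓ¹` space. -/
noncomputable def toLp (f : Fourier H m s ρ) : lp (fun _ : Fin (m + 1) → ℤ => H) 1 :=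
  ⟨fun k => ((weight s ρ k : ℝ) : ℂ) • f.coeff k, by
    refine memℓp_gen ?_
    simpa [norm_smul, abs_of_pos (weight_pos s ρ _)] using f.summable⟩

lemma toLp_isometry : Isometry (toLp : Fourier H m s ρ → _) := by
  refine Isometry.of_dist_eq fun f g => ?_
  have h : toLp f - toLp g = toLp (f - g) := by
    ext k
    rw [lp.coeFn_sub]
    exact (smul_sub _ _ _).symm
  rw [dist_eq_norm, dist_eq_norm, h, lp.norm_eq_tsum_rpow (by norm_num), norm_def]
  simp [toLp, norm_smul, abs_of_pos (weight_pos s ρ _)]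

lemma toLp_surjective : Function.Surjective (toLp : Fourier H m s ρ → _) := fun g => by
  have hw : ∀ k : Fin (m + 1) → ℤ, ((weight s ρ k : ℝ) : ℂ) ≠ 0 := fun k => by
    exact_mod_cast (weight_pos s ρ k).ne'
  refine ⟨⟨fun k => ((weight s ρ k : ℝ) : ℂ)⁻¹ • g k, ?_⟩, ?_⟩
  · have := (lp.memℓp g).summable (by norm_num)
    simp only [ENNReal.toReal_one, Real.rpow_one] at this
    refine this.congr fun k => ?_
    rw [norm_smul, norm_inv, Complex.norm_real, Real.norm_of_nonneg (weight_pos s ρ k).le,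
      mul_inv_cancel_left₀ (weight_pos s ρ k).ne']
  · ext k
    exact smul_inv_smul₀ (hw k) _

instance instCompleteSpace [CompleteSpace H] : CompleteSpace (Fourier H m s ρ) :=
  (completeSpace_congr (e := Equiv.ofBijective _ ⟨toLp_isometry.injective, toLp_surjective⟩)
    toLp_isometry.isUniformEmbedding).2 inferInstance

/-- The family with the single nonzero coefficient `h` at `k`. -/
noncomputable def single (k : Fin (m + 1) → ℤ) (h : H) : Fourier H m s ρ :=
  ⟨Pi.single k h, by
    refine summable_of_ne_finset_zero (s := {k}) fun j hj => ?_
    rw [Finset.mem_singleton] at hj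
    rw [Pi.single_eq_of_ne hj, norm_zero, mul_zero]⟩

lemma const_eq_single (h : H) : (const h : Fourier H m s ρ) = single 0 h := rfl

lemma coeff_single (k j : Fin (m + 1) → ℤ) (h : H) :
    (single k h : Fourier H m s ρ).coeff j = if j = k then h else 0 := by
  change (Pi.single k h : (Fin (m + 1) → ℤ) → H) j = _
  rw [Pi.single_apply]

lemma norm_single (k : Fin (m + 1) → ℤ) (h : H) :
    ‖(single k h : Fourier H m s ρ)‖ = weight s ρ k * ‖h‖ := by
  rw [norm_def, tsum_eq_single k fun j hj => by simp [coeff_single, hj]]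
  simp [coeff_single]

/-- `single` as a continuous linear map. -/
noncomputable def singleL (k : Fin (m + 1) → ℤ) : H →L[ℂ] Fourier H m s ρ :=
  LinearMap.mkContinuous
    { toFun := single k
      map_add' := fun f g => by ext j; simp only [coeff_single, coeff_add]; split_ifs <;> simp
      map_smul' := fun z f => by ext j; simp only [coeff_single, coeff_smul]; split_ifs <;> simp }
    (weight s ρ k) fun h => (norm_single k h).le

@[simp] lemma singleL_apply (k : Fin (m + 1) → ℤ) (h : H) :
    (singleL k : H →L[ℂ] Fourier H m s ρ) h = single k h := rfl

lemma weight_mul_norm_coeff_le (f : Fourier H m s ρ) (k) : weight s ρ k * ‖f.coeff k‖ ≤ ‖f‖ :=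
  f.summable.le_tsum k fun j _ => mul_nonneg (weight_pos s ρ j).le (norm_nonneg _)

/-- `coeff` as a continuous linear map. -/
noncomputable def coeffL (k : Fin (m + 1) → ℤ) : Fourier H m s ρ →L[ℂ] H :=
  LinearMap.mkContinuous
    { toFun := fun f => f.coeff k
      map_add' := fun _ _ => rfl
      map_smul' := fun _ _ => rfl }
    (weight s ρ k)⁻¹ fun f => by
      rw [inv_mul_eq_div, le_div_iff₀' (weight_pos s ρ k)]
      exact weight_mul_norm_coeff_le f k

@[simp] lemma coeffL_apply (k : Fin (m + 1) → ℤ) (f : Fourier H m s ρ) :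
    coeffL k f = f.coeff k := rfl

lemma hasSum_single (f : Fourier H m s ρ) : HasSum (fun k => single k (f.coeff k)) f := by
  rw [HasSum, tendsto_iff_norm_sub_tendsto_zero]
  have h : ∀ S : Finset (Fin (m + 1) → ℤ), ‖(∑ k ∈ S, single k (f.coeff k)) - f‖ =
      ∑' k, (if k ∈ S then 0 else weight s ρ k * ‖f.coeff k‖) := fun S => by
    rw [norm_def]
    refine tsum_congr fun j => ?_
    have : ((∑ k ∈ S, single k (f.coeff k) : Fourier H m s ρ) - f).coeff j =
        (if j ∈ S then f.coeff j else 0) - f.coeff j := by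
      rw [coeff_sub, ← coeffL_apply, map_sum]
      simp [coeff_single, Finset.sum_ite_eq]
    rw [this]
    split_ifs <;> simp
  have h2 := tendsto_tsum_compl_atTop_zero fun k => weight s ρ k * ‖f.coeff k‖
  refine h2.congr fun S => ?_
  rw [h S]
  refine (tsum_subtype {k | k ∉ S} fun k => weight s ρ k * ‖f.coeff k‖).trans
    (tsum_congr fun k => ?_)
  simp [indicator_apply, ite_not]

/-- Finite sums of single modes are dense, so operator identities need only be tested on one mode.
The algebraic identities for convolution, advection and evaluation are obtained this way. -/
lemma clm_ext {f g : Fourier H m s ρ →L[ℂ] Z} (h : ∀ k v, f (single k v) = g (single k v)) :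
    f = g := by
  ext v
  have h1 := (hasSum_single v).mapL f
  have h2 := (hasSum_single v).mapL g
  simp only [h] at h1
  exact h1.unique h2

/-- The continuous linear map determined by its values on single modes. -/
noncomputable def lift [CompleteSpace Z] (φ : (Fin (m + 1) → ℤ) → H →L[ℂ] Z) (C : ℝ)
    (hC : ∀ k h, ‖φ k h‖ ≤ C * weight s ρ k * ‖h‖) : Fourier H m s ρ →L[ℂ] Z :=
  have hb : ∀ (f : Fourier H m s ρ) k, ‖φ k (f.coeff k)‖ ≤ C * (weight s ρ k * ‖f.coeff k‖) :=
    fun f k => (hC k _).trans_eq (mul_assoc _ _ _)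
  have hs : ∀ f : Fourier H m s ρ, Summable fun k => φ k (f.coeff k) := fun f =>
    .of_norm_bounded (f.summable.mul_left C) (hb f)
  LinearMap.mkContinuous
    { toFun := fun f => ∑' k, φ k (f.coeff k)
      map_add' := fun f g => by
        rw [← (hs f).tsum_add (hs g)]; simp
      map_smul' := fun z f => by
        rw [RingHom.id_apply, ← (hs f).tsum_const_smul]; simp }
    C fun f => tsum_of_norm_bounded (f.summable.hasSum.mul_left C) (hb f)

section lift

variable [CompleteSpace Z] {φ : (Fin (m + 1) → ℤ) → H →L[ℂ] Z} {C : ℝ}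
    {hC : ∀ k h, ‖φ k h‖ ≤ C * weight s ρ k * ‖h‖}

lemma lift_apply (f : Fourier H m s ρ) : lift φ C hC f = ∑' k, φ k (f.coeff k) := rfl

@[simp] lemma lift_single (k : Fin (m + 1) → ℤ) (h : H) : lift φ C hC (single k h) = φ k h := by
  rw [lift_apply, tsum_eq_single k fun j hj => by simp [coeff_single, hj]]
  simp [coeff_single]

lemma norm_lift_apply_le (f : Fourier H m s ρ) : ‖lift φ C hC f‖ ≤ C * ‖f‖ :=
  tsum_of_norm_bounded (f.summable.hasSum.mul_left C) fun k =>
    (hC k _).trans_eq (mul_assoc _ _ _)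

end lift

lemma coeff_proj (I : Set (Fin (m + 1) → ℤ)) [DecidablePred (· ∈ I)] (f : Fourier H m s ρ) (k) :
    (proj I f).coeff k = if k ∈ I then f.coeff k else 0 := by
  change @ite _ (k ∈ I) (Classical.propDecidable _) (f.coeff k) 0 = _
  congr

lemma norm_proj_le (I : Set (Fin (m + 1) → ℤ)) (f : Fourier H m s ρ) : ‖proj I f‖ ≤ ‖f‖ := by
  classical
  refine Summable.tsum_le_tsum (fun k => ?_) (proj I f).summable f.summable
  refine mul_le_mul_of_nonneg_left ?_ (weight_pos s ρ k).le
  rw [coeff_proj]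
  split_ifs <;> simp

/-- `proj` as a continuous linear map. -/
noncomputable def projL (I : Set (Fin (m + 1) → ℤ)) : Fourier H m s ρ →L[ℂ] Fourier H m s ρ :=
  LinearMap.mkContinuous
    { toFun := proj I
      map_add' := fun f g => by
        classical
        ext k; simp only [coeff_proj, coeff_add]; split_ifs <;> simp
      map_smul' := fun z f => by
        classical
        ext k; simp only [coeff_proj, coeff_smul, RingHom.id_apply]; split_ifs <;> simp }
    1 fun f => by simpa using norm_proj_le I f

@[simp] lemma projL_apply (I : Set (Fin (m + 1) → ℤ)) (f : Fourier H m s ρ) :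
    projL I f = proj I f := rfl

@[simp] lemma coeff_incl (hs : s' ≤ s) (hρ : ρ' ≤ ρ) (f : Fourier H m s ρ) (k) :
    (incl hs hρ f).coeff k = f.coeff k := rfl

lemma norm_incl_le (hs : s' ≤ s) (hρ : ρ' ≤ ρ) (f : Fourier H m s ρ) :
    ‖incl hs hρ f‖ ≤ ‖f‖ :=
  Summable.tsum_le_tsum (fun k => mul_le_mul_of_nonneg_right (weight_mono hs hρ k) (norm_nonneg _))
    (incl hs hρ f).summable f.summable

/-- `incl` as a continuous linear map. -/
noncomputable def inclL (hs : s' ≤ s) (hρ : ρ' ≤ ρ) : Fourier H m s ρ →L[ℂ] Fourier H m s' ρ' :=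
  LinearMap.mkContinuous
    { toFun := incl hs hρ
      map_add' := fun _ _ => rfl
      map_smul' := fun _ _ => rfl }
    1 fun f => (norm_incl_le hs hρ f).trans_eq (one_mul _).symm

@[simp] lemma inclL_apply (hs : s' ≤ s) (hρ : ρ' ≤ ρ) (f : Fourier H m s ρ) :
    (inclL hs hρ f : Fourier H m s' ρ') = incl hs hρ f := rfl

lemma incl_proj (hs : s' ≤ s) (hρ : ρ' ≤ ρ) (I : Set (Fin (m + 1) → ℤ)) (f : Fourier H m s ρ) :
    incl hs hρ (proj I f) = proj I (incl hs hρ f) := rfl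

lemma proj_single (I : Set (Fin (m + 1) → ℤ)) [DecidablePred (· ∈ I)] (k : Fin (m + 1) → ℤ)
    (h : H) : proj I (single k h : Fourier H m s ρ) = if k ∈ I then single k h else 0 := by
  ext j
  rw [coeff_proj, coeff_single]
  by_cases hj : j = k
  · subst hj
    by_cases hI : j ∈ I <;> simp [coeff_single, hI]
  · split_ifs <;> simp [coeff_single, hj]

lemma proj_add_proj_compl (I : Set (Fin (m + 1) → ℤ)) (f : Fourier H m s ρ) :
    proj I f + proj Iᶜ f = f := by
  classical
  ext k
  rw [coeff_add, coeff_proj, coeff_proj]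
  by_cases h : k ∈ I <;> simp [h]

lemma idxNorm_add_le (j l : Fin (m + 1) → ℤ) : idxNorm (j + l) ≤ idxNorm j + idxNorm l := by
  rw [idxNorm, idxNorm, idxNorm, ← Finset.sum_add_distrib]
  refine Finset.sum_le_sum fun i _ => ?_
  rw [Pi.add_apply]
  push_cast
  exact abs_add_le _ _

/-- Submultiplicativity of the exponential weights, which makes convolution products bounded. -/
lemma weight_zero_add_le (hρ : 0 ≤ ρ) (j l : Fin (m + 1) → ℤ) :
    weight 0 ρ (j + l) ≤ Real.exp (ρ * idxNorm j) * weight 0 ρ l := by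
  simp only [weight, pow_zero, one_mul]
  rw [← Real.exp_add, ← mul_add]
  exact Real.exp_le_exp.2 (mul_le_mul_of_nonneg_left (idxNorm_add_le j l) hρ)

/-! ### Convolution products whose growth in the first index is absorbed by the weight of the first
factor. -/

section conv

lemma norm_single_add_le {B : H →L[ℂ] H' →L[ℂ] H''} {K : ℝ} (hρ : 0 ≤ ρ)
    (hB : ∀ h g, ‖B h g‖ ≤ K * ‖h‖ * ‖g‖) (j : Fin (m + 1) → ℤ) (h : H) (l : Fin (m + 1) → ℤ)
    (g : H') : ‖((singleL (j + l) : H'' →L[ℂ] Fourier H'' m 0 ρ).comp (B h)) g‖ ≤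
      K * Real.exp (ρ * idxNorm j) * ‖h‖ * weight 0 ρ l * ‖g‖ := by
  rw [ContinuousLinearMap.comp_apply, singleL_apply, norm_single]
  calc weight 0 ρ (j + l) * ‖B h g‖
      ≤ (Real.exp (ρ * idxNorm j) * weight 0 ρ l) * (K * ‖h‖ * ‖g‖) :=
        mul_le_mul (weight_zero_add_le hρ j l) (hB h g) (norm_nonneg _)
          (mul_nonneg (Real.exp_pos _).le (weight_pos 0 ρ l).le)
    _ = _ := by ring

variable [CompleteSpace H'']

/-- The bilinear map `(h, v) ↦ ∑ l, B h v_l` placed at index `j + l`. -/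
noncomputable def convSingle (B : H →L[ℂ] H' →L[ℂ] H'') (K : ℝ) (hρ : 0 ≤ ρ)
    (hB : ∀ h g, ‖B h g‖ ≤ K * ‖h‖ * ‖g‖) (j : Fin (m + 1) → ℤ) :
    H →L[ℂ] Fourier H' m 0 ρ →L[ℂ] Fourier H'' m 0 ρ :=
  LinearMap.mkContinuous₂
    (LinearMap.mk₂ ℂ
      (fun h v => lift (fun l => (singleL (j + l)).comp (B h))
        (K * Real.exp (ρ * idxNorm j) * ‖h‖) (norm_single_add_le hρ hB j h) v)
      (fun h h' v => by
        rw [← _root_.add_apply]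
        congr 1
        refine clm_ext fun l g => ?_
        rw [_root_.add_apply, lift_single, lift_single, lift_single]
        simp only [ContinuousLinearMap.comp_apply, map_add, _root_.add_apply])
      (fun z h v => by
        rw [← _root_.smul_apply]
        congr 1
        refine clm_ext fun l g => ?_
        rw [_root_.smul_apply, lift_single, lift_single]
        simp only [ContinuousLinearMap.comp_apply, map_smul, _root_.smul_apply])
      (fun _ _ _ => map_add _ _ _) (fun _ _ _ => map_smul _ _ _))
    (K * Real.exp (ρ * idxNorm j)) fun h v =>
      norm_lift_apply_le (hC := norm_single_add_le hρ hB j h) v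

@[simp] lemma convSingle_single (B : H →L[ℂ] H' →L[ℂ] H'') (K : ℝ) (hρ : 0 ≤ ρ)
    (hB : ∀ h g, ‖B h g‖ ≤ K * ‖h‖ * ‖g‖) (j : Fin (m + 1) → ℤ) (h : H) (l : Fin (m + 1) → ℤ)
    (g : H') : convSingle B K hρ hB j h (single l g) = single (j + l) (B h g) :=
  lift_single (hC := norm_single_add_le hρ hB j h) l g

lemma norm_convSingle_le (B : H →L[ℂ] H' →L[ℂ] H'') (K : ℝ) (hρ : 0 ≤ ρ)
    (hB : ∀ h g, ‖B h g‖ ≤ K * ‖h‖ * ‖g‖) (hK : 0 ≤ K) (j : Fin (m + 1) → ℤ) (h : H) :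
    ‖convSingle B K hρ hB j h‖ ≤ K * Real.exp (ρ * idxNorm j) * ‖h‖ :=
  ContinuousLinearMap.opNorm_le_bound _ (by positivity) fun v =>
    norm_lift_apply_le (hC := norm_single_add_le hρ hB j h) v

/-- The bilinear map `(u, v) ↦ ∑ j, l, B_j u_j v_l` placed at index `j + l`. -/
noncomputable def conv (B : (Fin (m + 1) → ℤ) → H →L[ℂ] H' →L[ℂ] H'')
    (K : (Fin (m + 1) → ℤ) → ℝ) (C : ℝ) (hρ : 0 ≤ ρ) (hK : ∀ j, 0 ≤ K j)
    (hB : ∀ j h g, ‖B j h g‖ ≤ K j * ‖h‖ * ‖g‖)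
    (hC : ∀ j, K j * Real.exp (ρ * idxNorm j) ≤ C * weight s ρ j) :
    Fourier H m s ρ →L[ℂ] Fourier H' m 0 ρ →L[ℂ] Fourier H'' m 0 ρ :=
  lift (fun j => convSingle (B j) (K j) hρ (hB j) j) C fun j h =>
    (norm_convSingle_le _ _ _ _ (hK j) j h).trans
      (mul_le_mul_of_nonneg_right (hC j) (norm_nonneg _))

variable {B : (Fin (m + 1) → ℤ) → H →L[ℂ] H' →L[ℂ] H''} {K : (Fin (m + 1) → ℤ) → ℝ} {C : ℝ}
    {hρ : 0 ≤ ρ} {hK : ∀ j, 0 ≤ K j} {hB : ∀ j h g, ‖B j h g‖ ≤ K j * ‖h‖ * ‖g‖}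
    {hC : ∀ j, K j * Real.exp (ρ * idxNorm j) ≤ C * weight s ρ j}

@[simp] lemma conv_single_single (j l : Fin (m + 1) → ℤ) (h : H) (g : H') :
    conv B K C hρ hK hB hC (single j h) (single l g) = single (j + l) (B j h g) := by
  rw [conv, lift_single, convSingle_single]

lemma norm_conv_le (u : Fourier H m s ρ) : ‖conv B K C hρ hK hB hC u‖ ≤ C * ‖u‖ :=
  norm_lift_apply_le u

end conv

end Fourier

end TorusVF

namespace TorusVF

/-! ### Spaces of analytic coefficients -/

namespace Hol

variable {E V W V' : Type*} [NormedAddCommGroup E] [NormedSpace ℂ E] [NormedAddCommGroup V]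
  [NormedSpace ℂ V] [NormedAddCommGroup W] [NormedSpace ℂ W] [NormedAddCommGroup V']
  [NormedSpace ℂ V'] {Ω : Set E}

lemma val_of_mem (g : Hol V Ω) {y : E} (hy : y ∈ closure Ω) : g.val y = g.1 ⟨y, hy⟩ := by
  unfold val extend
  exact dif_pos hy

lemma val_of_notMem (g : Hol V Ω) {y : E} (hy : y ∉ closure Ω) : g.val y = 0 := by
  unfold val extend
  exact dif_neg hy

@[ext] lemma ext {g h : Hol V Ω} (H : ∀ y ∈ closure Ω, g.val y = h.val y) : g = h := by
  refine Subtype.ext (ContinuousMap.ext fun y => ?_)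
  have := H y.1 y.2
  rwa [val_of_mem _ y.2, val_of_mem _ y.2] at this

lemma continuousOn_val (g : Hol V Ω) : ContinuousOn g.val (closure Ω) := by
  rw [continuousOn_iff_continuous_domRestrict]
  have : (closure Ω).domRestrict g.val = g.1 := funext fun y => val_of_mem g y.2
  rw [this]
  exact g.1.continuous

lemma differentiableOn_val (g : Hol V Ω) : DifferentiableOn ℂ g.val Ω := g.2

/-- An element of `Hol V Ω` from a function on `E`. -/
def ofFun (φ : E → V) (hc : ContinuousOn φ (closure Ω)) (hd : DifferentiableOn ℂ φ Ω) : Hol V Ω :=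
  ⟨⟨fun y => φ y.1, hc.domRestrict⟩, by
    refine hd.congr fun y hy => ?_
    unfold extend
    exact dif_pos (subset_closure hy)⟩

lemma val_ofFun {φ : E → V} (hc : ContinuousOn φ (closure Ω)) (hd : DifferentiableOn ℂ φ Ω) {y : E}
    (hy : y ∈ closure Ω) : (ofFun φ hc hd).val y = φ y := val_of_mem _ hy

variable [CompactSpace (closure Ω)]

lemma norm_val_le (g : Hol V Ω) (y : E) : ‖g.val y‖ ≤ ‖g‖ := by
  by_cases hy : y ∈ closure Ω
  · rw [val_of_mem g hy]
    exact g.1.norm_coe_le_norm ⟨y, hy⟩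
  · rw [val_of_notMem g hy, norm_zero]
    exact norm_nonneg _

lemma norm_le_of_forall {g : Hol V Ω} {C : ℝ} (hC : 0 ≤ C) (h : ∀ y ∈ closure Ω, ‖g.val y‖ ≤ C) :
    ‖g‖ ≤ C :=
  (ContinuousMap.norm_le g.1 hC).2 fun y => by
    have := h y.1 y.2
    rwa [val_of_mem g y.2] at this

@[simp] lemma val_add (g h : Hol V Ω) (y : E) : (g + h).val y = g.val y + h.val y :=
  congrFun (extend_add g.1 h.1) y

@[simp] lemma val_smul (z : ℂ) (g : Hol V Ω) (y : E) : (z • g).val y = z • g.val y :=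
  congrFun (extend_smul z g.1) y

/-- Evaluation at a point. -/
noncomputable def valL (y : E) : Hol V Ω →L[ℂ] V :=
  LinearMap.mkContinuous
    { toFun := fun g => g.val y
      map_add' := fun g h => val_add g h y
      map_smul' := fun z g => val_smul z g y }
    1 fun g => by simpa using norm_val_le g y

@[simp] lemma valL_apply (y : E) (g : Hol V Ω) : valL y g = g.val y := rfl

/-- Sup-norm convergence is uniform on `Ω`, so analyticity passes to the limit; completeness of the
coefficient spaces follows. -/
lemma isClosed_holSubmodule [CompleteSpace V] (hΩ : IsOpen Ω) :
    IsClosed (holSubmodule V Ω : Set C(closure Ω, V)) := by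
  refine isClosed_of_closure_subset fun g hg => ?_
  obtain ⟨u, hu, hug⟩ := mem_closure_iff_seq_limit.1 hg
  refine differentiableOn_of_tendstoUniformlyOn hΩ (f := fun n => extend (u n)) (l := atTop) ?_ hu
  have h := (ContinuousMap.tendsto_iff_tendstoUniformly.1 hug)
  rw [Metric.tendstoUniformly_iff] at h
  rw [Metric.tendstoUniformlyOn_iff]
  intro e he
  filter_upwards [h e he] with n hn y hy
  have := hn ⟨y, subset_closure hy⟩
  simpa [extend, subset_closure hy] using this

lemma completeSpace [CompleteSpace V] (hΩ : IsOpen Ω) : CompleteSpace (Hol V Ω) :=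
  (isClosed_holSubmodule hΩ).completeSpace_coe

/-- Pointwise application of a bilinear map. -/
noncomputable def bilin (B : V →L[ℂ] W →L[ℂ] V') : Hol V Ω →L[ℂ] Hol W Ω →L[ℂ] Hol V' Ω :=
  LinearMap.mkContinuous₂
    (LinearMap.mk₂ ℂ
      (fun g h => ofFun (fun y => B (g.val y) (h.val y))
        ((B.continuous.comp_continuousOn g.continuousOn_val).clm_apply h.continuousOn_val)
        ((B.differentiable.comp_differentiableOn g.differentiableOn_val).clm_apply
          h.differentiableOn_val))
      (fun g g' h => by ext y hy; simp [val_ofFun, hy])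
      (fun z g h => by ext y hy; simp [val_ofFun, hy])
      (fun g h h' => by ext y hy; simp [val_ofFun, hy])
      (fun z g h => by ext y hy; simp [val_ofFun, hy]))
    ‖B‖ fun g h => norm_le_of_forall (by positivity) fun y hy => by
      rw [LinearMap.mk₂_apply, val_ofFun _ _ hy]
      refine (B.le_opNorm₂ _ _).trans ?_
      gcongr <;> exact norm_val_le _ y

lemma val_bilin (B : V →L[ℂ] W →L[ℂ] V') (g : Hol V Ω) (h : Hol W Ω) {y : E} (hy : y ∈ closure Ω) :
    (bilin B g h).val y = B (g.val y) (h.val y) :=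
  val_ofFun (φ := fun y => B (g.val y) (h.val y))
    ((B.continuous.comp_continuousOn g.continuousOn_val).clm_apply h.continuousOn_val)
    ((B.differentiable.comp_differentiableOn g.differentiableOn_val).clm_apply
      h.differentiableOn_val) hy

lemma norm_bilin_le (B : V →L[ℂ] W →L[ℂ] V') (g : Hol V Ω) (h : Hol W Ω) :
    ‖bilin B g h‖ ≤ ‖B‖ * ‖g‖ * ‖h‖ :=
  norm_le_of_forall (by positivity) fun y hy => by
    rw [val_bilin _ _ _ hy]
    refine (B.le_opNorm₂ _ _).trans ?_
    gcongr <;> exact norm_val_le _ y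

/-- Multiplication by a bounded scalar function. -/
noncomputable def mulBy (φ : E → ℂ) (hc : ContinuousOn φ (closure Ω)) (hd : DifferentiableOn ℂ φ Ω)
    (C : ℝ) (hC : ∀ y ∈ closure Ω, ‖φ y‖ ≤ C) (hC0 : 0 ≤ C) : Hol V Ω →L[ℂ] Hol V Ω :=
  LinearMap.mkContinuous
    { toFun := fun g => ofFun (fun y => φ y • g.val y) (hc.smul g.continuousOn_val)
        (hd.smul g.differentiableOn_val)
      map_add' := fun g h => by ext y hy; simp [val_ofFun, hy]
      map_smul' := fun z g => by
        ext y hy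
        rw [RingHom.id_apply, val_smul, val_ofFun _ _ hy, val_ofFun _ _ hy, val_smul, smul_comm] }
    C fun g => norm_le_of_forall (by positivity) fun y hy => by
      rw [LinearMap.coe_mk, AddHom.coe_mk, val_ofFun _ _ hy, norm_smul]
      exact mul_le_mul (hC y hy) (norm_val_le g y) (norm_nonneg _) hC0

lemma val_mulBy {φ : E → ℂ} {hc : ContinuousOn φ (closure Ω)} {hd : DifferentiableOn ℂ φ Ω}
    {C : ℝ} {hC : ∀ y ∈ closure Ω, ‖φ y‖ ≤ C} {hC0 : 0 ≤ C} (g : Hol V Ω) {y : E}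
    (hy : y ∈ closure Ω) : (mulBy φ hc hd C hC hC0 g).val y = φ y • g.val y :=
  val_ofFun (φ := fun y => φ y • g.val y) (hc.smul g.continuousOn_val)
    (hd.smul g.differentiableOn_val) hy

lemma norm_mulBy_le {φ : E → ℂ} {hc : ContinuousOn φ (closure Ω)} {hd : DifferentiableOn ℂ φ Ω}
    {C : ℝ} {hC : ∀ y ∈ closure Ω, ‖φ y‖ ≤ C} {hC0 : 0 ≤ C} (g : Hol V Ω) :
    ‖mulBy φ hc hd C hC hC0 g‖ ≤ C * ‖g‖ :=
  norm_le_of_forall (by positivity) fun y hy => by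
    rw [val_mulBy _ hy, norm_smul]
    exact mul_le_mul (hC y hy) (norm_val_le g y) (norm_nonneg _) hC0

end Hol

/-! ### The strip and the polyball: openness, convexity, and completeness of the coefficient space.
-/

section Domains

variable (m : ℕ) (ρ a b : ℝ)

lemma isOpen_polyball : IsOpen (polyball m a b) := by
  have h1 : IsOpen {y : CVec m | ∑ i : Fin m, ‖y i.castSucc‖ < a} :=
    isOpen_lt (by fun_prop) continuous_const
  have h2 : IsOpen {y : CVec m | ‖y (Fin.last m)‖ < b} :=
    isOpen_lt (by fun_prop) continuous_const
  exact h1.inter h2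

lemma isOpen_strip : IsOpen (strip m ρ) :=
  isOpen_lt (by fun_prop) continuous_const

lemma convex_strip : Convex ℝ (strip m ρ) := by
  intro x hx y hy s t hs ht hst
  change ∑ i, |((s • x + t • y) i).im| < ρ / (2 * Real.pi)
  have hx' : ∑ i, |(x i).im| < ρ / (2 * Real.pi) := hx
  have hy' : ∑ i, |(y i).im| < ρ / (2 * Real.pi) := hy
  have h1 : ∑ i, |((s • x + t • y) i).im| ≤ s * ∑ i, |(x i).im| + t * ∑ i, |(y i).im| := by
    rw [Finset.mul_sum, Finset.mul_sum, ← Finset.sum_add_distrib]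
    refine Finset.sum_le_sum fun i _ => ?_
    have : ((s • x + t • y) i).im = s * (x i).im + t * (y i).im := by simp
    rw [this]
    refine (abs_add_le _ _).trans_eq ?_
    rw [abs_mul, abs_mul, abs_of_nonneg hs, abs_of_nonneg ht]
  refine h1.trans_lt ?_
  -- Strictness is obtained from the first summand, which needs `s > 0`.
  rcases hs.eq_or_lt with rfl | hs
  · have : t = 1 := by linarith
    subst this
    simpa using hy'
  · calc _ < s * (ρ / (2 * Real.pi)) + t * (ρ / (2 * Real.pi)) :=
        add_lt_add_of_lt_of_le (mul_lt_mul_of_pos_left hx' hs) (mul_le_mul_of_nonneg_left hy'.le ht)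
      _ = _ := by rw [← add_mul, hst, one_mul]

instance instCompleteSpaceCoef : CompleteSpace (Coef m a b) :=
  Hol.completeSpace (isOpen_polyball m a b)

end Domains

lemma norm_sum_intCast_mul_le {m : ℕ} (k : Fin (m + 1) → ℤ) (v : CVec m) :
    ‖∑ i, (k i : ℂ) * v i‖ ≤ idxNorm k * ‖v‖ := by
  rw [PiLp.norm_eq_of_L1, idxNorm, Finset.sum_mul]
  refine (norm_sum_le _ _).trans (Finset.sum_le_sum fun i _ => ?_)
  rw [norm_mul, Complex.norm_intCast]
  exact mul_le_mul_of_nonneg_left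
    (Finset.single_le_sum (f := fun i => ‖v i‖) (fun _ _ => norm_nonneg _) (Finset.mem_univ i))
    (abs_nonneg _)

/-- The pairing `k · v` as a continuous linear functional. -/
noncomputable def dotL {m : ℕ} (k : Fin (m + 1) → ℤ) : CVec m →L[ℂ] ℂ :=
  LinearMap.mkContinuous
    { toFun := fun v => ∑ i, (k i : ℂ) * v i
      map_add' := fun v w => by simp [mul_add, Finset.sum_add_distrib]
      map_smul' := fun z v => by
        rw [RingHom.id_apply, smul_eq_mul, Finset.mul_sum]
        exact Finset.sum_congr rfl fun i _ => by rw [PiLp.smul_apply, smul_eq_mul]; ring }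
    (idxNorm k) (norm_sum_intCast_mul_le k)

lemma dotL_apply {m : ℕ} (k : Fin (m + 1) → ℤ) (v : CVec m) :
    dotL k v = ∑ i, (k i : ℂ) * v i := rfl

lemma norm_dotL_apply_le {m : ℕ} (k : Fin (m + 1) → ℤ) (v : CVec m) :
    ‖dotL k v‖ ≤ idxNorm k * ‖v‖ := norm_sum_intCast_mul_le k v

end TorusVF

namespace TorusVF

/-! ### Derivatives along and composition with a shift -/

/-! ### Norm of the exponential. -/

section Exp

variable {R : Type*} [NormedRing R] [NormedAlgebra ℂ R]

/-- The assumption `‖1‖ ≤ 1`, rather than equality, covers operators on a space that may be trivial,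
as happens when the polyball is empty. -/
lemma norm_exp_le_exp_norm [CompleteSpace R] (h1 : ‖(1 : R)‖ ≤ 1) (x : R) :
    ‖NormedSpace.exp x‖ ≤ Real.exp ‖x‖ := by
  have h : HasSum (fun n : ℕ => ‖x‖ ^ n / n.factorial) (Real.exp ‖x‖) := by
    rw [Real.exp_eq_exp_ℝ]
    exact NormedSpace.expSeries_div_hasSum_exp (𝔸 := ℝ) ‖x‖
  refine (NormedSpace.exp_series_hasSum_exp' (𝕂 := ℂ) x).norm_le_of_bounded h fun n => ?_
  rw [norm_smul, norm_inv, Complex.norm_natCast, div_eq_inv_mul]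
  refine mul_le_mul_of_nonneg_left ?_ (by positivity)
  rcases n.eq_zero_or_pos with rfl | hn
  · simpa using h1
  · exact norm_pow_le' x hn

end Exp

/-- The bilinear map `(g, h) ↦ 2πi (k · g) h` on `ℂ^d`. -/
noncomputable def pairing {m : ℕ} (k : Fin (m + 1) → ℤ) : CVec m →L[ℂ] CVec m →L[ℂ] CVec m :=
  (ContinuousLinearMap.lsmul ℂ ℂ).comp ((2 * Real.pi * Complex.I : ℂ) • dotL k)

lemma pairing_apply {m : ℕ} (k : Fin (m + 1) → ℤ) (g h : CVec m) :
    pairing k g h = (2 * Real.pi * Complex.I * dotL k g : ℂ) • h := rfl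

lemma norm_two_pi_I : ‖(2 * Real.pi * Complex.I : ℂ)‖ = 2 * Real.pi := by
  simp [abs_of_pos Real.pi_pos]

lemma norm_pairing_le {m : ℕ} (k : Fin (m + 1) → ℤ) :
    ‖pairing (m := m) k‖ ≤ 2 * Real.pi * idxNorm k := by
  have := idxNorm_nonneg k
  refine ContinuousLinearMap.opNorm_le_bound₂ _ (by positivity) fun g h => ?_
  rw [pairing_apply, norm_smul, norm_mul, norm_two_pi_I]
  have := norm_dotL_apply_le k g
  rw [mul_assoc (2 * Real.pi) (idxNorm k)]
  gcongr

variable {m : ℕ} {ρ ν a b : ℝ}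

lemma norm_bilin_pairing_le (k : Fin (m + 1) → ℤ) (g h : Coef m a b) :
    ‖Hol.bilin (pairing k) g h‖ ≤ 2 * Real.pi * idxNorm k * ‖g‖ * ‖h‖ := by
  refine (Hol.norm_bilin_le _ g h).trans ?_
  gcongr
  exact norm_pairing_le k

open TorusVF.Fourier

/-- The operator `v ↦ D_x u v`. -/
noncomputable def advect (hρ : 0 ≤ ρ) : 𝒜' m ρ a b →L[ℂ] 𝒜 m ρ a b →L[ℂ] 𝒜 m ρ a b :=
  conv (fun j => (Hol.bilin (pairing j)).flip) (fun j => 2 * Real.pi * idxNorm j) 1 hρ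
    (fun j => mul_nonneg (by positivity) (idxNorm_nonneg j))
    (fun j h g => by
      rw [ContinuousLinearMap.flip_apply]
      exact (norm_bilin_pairing_le j g h).trans_eq (by ring)) fun j => by
      -- Differentiating mode `j` costs 2π‖j‖, which the extra factor 1 + 2π‖j‖ in the norm of `𝒜'`
      -- absorbs.
      rw [one_mul, weight, pow_one]
      gcongr
      linarith

@[simp] lemma advect_single_single (hρ : 0 ≤ ρ) (j l : Fin (m + 1) → ℤ) (h g : Coef m a b) :
    advect hρ (single j h) (single l g) = single (j + l) (Hol.bilin (pairing j) g h) := by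
  rw [advect, conv_single_single, ContinuousLinearMap.flip_apply]

lemma norm_advect_le (hρ : 0 ≤ ρ) (u : 𝒜' m ρ a b) : ‖advect hρ u‖ ≤ ‖u‖ :=
  norm_conv_le u |>.trans_eq (one_mul _)

/-- The operator `v ↦ 2πi (k · u) v`. -/
noncomputable def phase (hρ : 0 ≤ ρ) (k : Fin (m + 1) → ℤ) :
    𝒜' m ρ a b →L[ℂ] 𝒜 m ρ a b →L[ℂ] 𝒜 m ρ a b :=
  conv (fun _ => Hol.bilin (pairing k)) (fun _ => 2 * Real.pi * idxNorm k)
    (2 * Real.pi * idxNorm k) hρ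
    (fun _ => mul_nonneg (by positivity) (idxNorm_nonneg k))
    (fun _ g h => norm_bilin_pairing_le k g h) fun j => by
      have := idxNorm_nonneg k
      refine mul_le_mul_of_nonneg_left ?_ (by positivity)
      rw [weight, pow_one]
      exact le_mul_of_one_le_left (Real.exp_pos _).le (one_le_base j)

@[simp] lemma phase_single_single (hρ : 0 ≤ ρ) (k j l : Fin (m + 1) → ℤ) (h g : Coef m a b) :
    phase hρ k (single j h) (single l g) = single (j + l) (Hol.bilin (pairing k) h g) := by
  rw [phase, conv_single_single]

lemma norm_phase_le (hρ : 0 ≤ ρ) (k : Fin (m + 1) → ℤ) (u : 𝒜' m ρ a b) :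
    ‖phase hρ k u‖ ≤ 2 * Real.pi * idxNorm k * ‖u‖ :=
  norm_conv_le u

lemma phase_zero (hρ : 0 ≤ ρ) (u : 𝒜' m ρ a b) : phase hρ 0 u = 0 := by
  have h := norm_phase_le hρ 0 u
  have h0 : idxNorm (0 : Fin (m + 1) → ℤ) = 0 := by simp [idxNorm]
  rw [h0] at h
  exact norm_le_zero_iff.1 (by simpa using h)

/-- The operator of multiplication by `exp(2πi k · u)`. -/
noncomputable def expPhase (hρ : 0 ≤ ρ) (k : Fin (m + 1) → ℤ) (u : 𝒜' m ρ a b) :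
    𝒜 m ρ a b →L[ℂ] 𝒜 m ρ a b := NormedSpace.exp (phase hρ k u)

/-- Exponentiating the multiplication operator, rather than a function, lets the bound, the
Lipschitz estimate and the differentiability in `u` all come from the Banach algebra of operators on
`𝒜`. -/
lemma norm_expPhase_le (hρ : 0 ≤ ρ) (k : Fin (m + 1) → ℤ) (u : 𝒜' m ρ a b) :
    ‖expPhase hρ k u‖ ≤ Real.exp (2 * Real.pi * idxNorm k * ‖u‖) :=
  (norm_exp_le_exp_norm ContinuousLinearMap.norm_id_le _).trans
    (Real.exp_le_exp.2 (norm_phase_le hρ k u))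

lemma norm_expPhase_sub_le (hρ : 0 ≤ ρ) (k : Fin (m + 1) → ℤ) {u v : 𝒜' m ρ a b}
    (hu : 2 * Real.pi * ‖u‖ ≤ ν) (hv : 2 * Real.pi * ‖v‖ ≤ ν) :
    ‖expPhase hρ k u - expPhase hρ k v‖ ≤
      Real.exp (ν * idxNorm k) * (2 * Real.pi * idxNorm k * ‖u - v‖) := by
  have hk := idxNorm_nonneg k
  have h : ∀ w : 𝒜' m ρ a b, 2 * Real.pi * ‖w‖ ≤ ν → ‖phase hρ k w‖ ≤ ν * idxNorm k :=
    fun w hw => (norm_phase_le hρ k w).trans (by nlinarith)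
  refine (norm_exp_sub_exp_le (h u hu) (h v hv)).trans ?_
  rw [← map_sub]
  gcongr
  exact norm_phase_le hρ k _

/-- The function `f(x + u(x, y), y)`. -/
noncomputable def comp (hρ : 0 ≤ ρ) (u : 𝒜' m ρ a b) (f : 𝒜' m (ρ + ν) a b) : 𝒜 m ρ a b :=
  ∑' k, expPhase hρ k u (single k (f.coeff k))

lemma weight_eq_exp_mul_exp (k : Fin (m + 1) → ℤ) : weight 1 (ρ + ν) k =
    (1 + 2 * Real.pi * idxNorm k) * (Real.exp (ν * idxNorm k) * Real.exp (ρ * idxNorm k)) := by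
  rw [weight, pow_one, ← Real.exp_add]
  congr 2
  ring

/-- Shifting by `u` enlarges mode `k` by at most e^{2π‖k‖‖u‖}, which is paid for by the loss ν in
the width of the strip. -/
lemma norm_expPhase_single_le (hρ : 0 ≤ ρ) {u : 𝒜' m ρ a b} (hu : 2 * Real.pi * ‖u‖ ≤ ν)
    (k : Fin (m + 1) → ℤ) (h : Coef m a b) :
    ‖((expPhase hρ k u).comp (singleL k)) h‖ ≤ 1 * weight 1 (ρ + ν) k * ‖h‖ := by
  have hk := idxNorm_nonneg k
  rw [ContinuousLinearMap.comp_apply, singleL_apply, one_mul, weight_eq_exp_mul_exp]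
  calc ‖expPhase hρ k u (single k h)‖
      ≤ Real.exp (2 * Real.pi * idxNorm k * ‖u‖) * ‖(single k h : 𝒜 m ρ a b)‖ :=
        (expPhase hρ k u).le_of_opNorm_le (norm_expPhase_le hρ k u) _
    _ = 1 * (Real.exp (2 * Real.pi * ‖u‖ * idxNorm k) * Real.exp (ρ * idxNorm k)) * ‖h‖ := by
        rw [norm_single, weight, pow_zero, one_mul, one_mul, mul_assoc (Real.exp _) (Real.exp _)]
        congr 2
        ring
    _ ≤ _ := by
        gcongr
        exact one_le_base k

/-- Varying `u` brings down a factor 2π‖k‖. Since the whole of ν is already spent on the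
exponential, this factor is absorbed by the primed norm of the composed field. -/
lemma norm_expPhase_sub_single_le (hρ : 0 ≤ ρ) {u v : 𝒜' m ρ a b}
    (hu : 2 * Real.pi * ‖u‖ ≤ ν) (hv : 2 * Real.pi * ‖v‖ ≤ ν)
    (k : Fin (m + 1) → ℤ) (h : Coef m a b) :
    ‖expPhase hρ k u (single k h) - expPhase hρ k v (single k h)‖ ≤
      (weight 1 (ρ + ν) k * ‖h‖) * ‖u - v‖ := by
  have hk := idxNorm_nonneg k
  rw [weight_eq_exp_mul_exp, ← _root_.sub_apply]
  calc _ ≤ (Real.exp (ν * idxNorm k) * (2 * Real.pi * idxNorm k * ‖u - v‖))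
        * ‖(single k h : 𝒜 m ρ a b)‖ :=
        ContinuousLinearMap.le_of_opNorm_le _ (norm_expPhase_sub_le hρ k hu hv) _
    _ = ((2 * Real.pi * idxNorm k) * (Real.exp (ν * idxNorm k) * Real.exp (ρ * idxNorm k)) * ‖h‖)
        * ‖u - v‖ := by
        rw [norm_single, weight, pow_zero, one_mul]; ring
    _ ≤ _ := by
        gcongr
        linarith

/-- `comp hρ u` as a continuous linear map. -/
noncomputable def compL (hρ : 0 ≤ ρ) (u : 𝒜' m ρ a b) (hu : 2 * Real.pi * ‖u‖ ≤ ν) :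
    𝒜' m (ρ + ν) a b →L[ℂ] 𝒜 m ρ a b :=
  lift (fun k => (expPhase hρ k u).comp (singleL k)) 1 (norm_expPhase_single_le hρ hu)

lemma compL_apply (hρ : 0 ≤ ρ) (u : 𝒜' m ρ a b) (hu : 2 * Real.pi * ‖u‖ ≤ ν)
    (f : 𝒜' m (ρ + ν) a b) : compL hρ u hu f = comp hρ u f := rfl

lemma norm_comp_le (hρ : 0 ≤ ρ) {u : 𝒜' m ρ a b} (hu : 2 * Real.pi * ‖u‖ ≤ ν)
    (f : 𝒜' m (ρ + ν) a b) : ‖comp hρ u f‖ ≤ ‖f‖ :=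
  (norm_lift_apply_le (hC := norm_expPhase_single_le hρ hu) f).trans_eq (one_mul _)

lemma hasSum_comp (hρ : 0 ≤ ρ) {u : 𝒜' m ρ a b} (hu : 2 * Real.pi * ‖u‖ ≤ ν)
    (f : 𝒜' m (ρ + ν) a b) :
    HasSum (fun k => expPhase hρ k u (single k (f.coeff k))) (comp hρ u f) :=
  Summable.hasSum (.of_norm_bounded f.summable fun k =>
    (norm_expPhase_single_le hρ hu k _).trans_eq (by rw [one_mul]))

lemma norm_comp_sub_comp_le (hρ : 0 ≤ ρ) {u v : 𝒜' m ρ a b}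
    (hu : 2 * Real.pi * ‖u‖ ≤ ν) (hv : 2 * Real.pi * ‖v‖ ≤ ν) (f : 𝒜' m (ρ + ν) a b) :
    ‖comp hρ u f - comp hρ v f‖ ≤ ‖f‖ * ‖u - v‖ :=
  ((hasSum_comp hρ hu f).sub (hasSum_comp hρ hv f)).norm_le_of_bounded
    (f.summable.hasSum.mul_right _) fun k => norm_expPhase_sub_single_le hρ hu hv k _

lemma comp_const (hρ : 0 ≤ ρ) (u : 𝒜' m ρ a b) (h : Coef m a b) :
    comp hρ u (const h : 𝒜' m (ρ + ν) a b) = const h := by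
  rw [comp, tsum_eq_single 0 fun k hk => by
    rw [const_eq_single, coeff_single, if_neg hk, ← singleL_apply, map_zero, map_zero]]
  rw [const_eq_single, coeff_single, if_pos rfl, expPhase, phase_zero, NormedSpace.exp_zero]
  rfl

lemma comp_zero_left (hρ : 0 ≤ ρ) (hν : 0 ≤ ν) (f : 𝒜' m (ρ + ν) a b) :
    comp hρ 0 f = incl (Nat.zero_le 1) (le_add_of_nonneg_right hν) f := by
  have h : ∀ k, expPhase hρ k (0 : 𝒜' m ρ a b) = 1 := fun k => by
    rw [expPhase, map_zero, NormedSpace.exp_zero]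
  simp only [comp, h]
  exact (hasSum_single (incl (Nat.zero_le 1) (le_add_of_nonneg_right hν) f)).tsum_eq

lemma differentiableAt_comp_left (hρ : 0 ≤ ρ) {u : 𝒜' m ρ a b} (hu : 2 * Real.pi * ‖u‖ < ν)
    (f : 𝒜' m (ρ + ν) a b) : DifferentiableAt ℂ (fun u => comp hρ u f) u := by
  have hmem : ∀ v : 𝒜' m ρ a b, v ∈ Metric.ball 0 (ν / (2 * Real.pi)) ↔
      2 * Real.pi * ‖v‖ < ν := fun v => by
    rw [mem_ball_zero_iff, lt_div_iff₀' (by positivity)]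
  have hd : ∀ k, Differentiable ℂ fun u : 𝒜' m ρ a b => expPhase hρ k u (single k (f.coeff k)) :=
    fun k u => by
      have h1 : DifferentiableAt ℂ (expPhase (a := a) (b := b) hρ k) u :=
        ((NormedSpace.exp_analytic (𝕂 := ℂ) (phase hρ k u)).differentiableAt).comp u
          (phase hρ k).differentiableAt
      exact (ContinuousLinearMap.apply ℂ (𝒜 m ρ a b)
        (single k (f.coeff k) : 𝒜 m ρ a b)).differentiableAt.comp u h1
  refine (hasFDerivAt_tsum_of_isPreconnected (s := Metric.ball 0 (ν / (2 * Real.pi)))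
    f.summable Metric.isOpen_ball (convex_ball _ _).isPreconnected
    (fun k v _ => (hd k v).hasFDerivAt) (fun k v hv => ?_) ((hmem u).2 hu)
    (hasSum_comp hρ hu.le f).summable ((hmem u).2 hu)).differentiableAt
  -- Termwise differentiation needs summable bounds on the derivatives; they are read off from the
  -- Lipschitz constants of the terms.
  refine norm_fderiv_le_of_lip' ℂ (mul_nonneg (weight_pos _ _ _).le (norm_nonneg _)) ?_
  filter_upwards [Metric.isOpen_ball.mem_nhds hv] with w hw
  exact norm_expPhase_sub_single_le hρ ((hmem w).1 hw).le ((hmem v).1 hv).le k _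

/-- Linearity in the second argument splits the value at (u', f') into the value at (u', f), a
bounded linear function of f' - f, and the change of the composition of f' - f as u moves to u'. The
last is at most ‖f' - f‖ ‖u' - u‖, hence of second order. -/
lemma differentiableAt_comp (hρ : 0 ≤ ρ) {u : 𝒜' m ρ a b} (hu : 2 * Real.pi * ‖u‖ < ν)
    (f : 𝒜' m (ρ + ν) a b) :
    DifferentiableAt ℂ (fun p : 𝒜' m ρ a b × 𝒜' m (ρ + ν) a b => comp hρ p.1 p.2) (u, f) := by
  have hnear : ∀ᶠ p : 𝒜' m ρ a b × 𝒜' m (ρ + ν) a b in 𝓝 (u, f), 2 * Real.pi * ‖p.1‖ < ν := by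
    refine ContinuousAt.eventually_lt ?_ continuousAt_const hu
    fun_prop
  have hE : HasFDerivAt (𝕜 := ℂ) (fun p : 𝒜' m ρ a b × 𝒜' m (ρ + ν) a b =>
      comp hρ p.1 (p.2 - f) - comp hρ u (p.2 - f)) 0 (u, f) := by
    refine Asymptotics.IsBigO.hasFDerivAt (n := 2) ?_ one_lt_two
    refine Asymptotics.IsBigO.of_bound 1 ?_
    filter_upwards [hnear] with p hp
    refine (norm_comp_sub_comp_le hρ hp.le hu.le _).trans ?_
    rw [one_mul, norm_pow, norm_norm, sq]
    exact mul_le_mul (norm_snd_le (p - (u, f))) (norm_fst_le (p - (u, f))) (norm_nonneg _)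
      (norm_nonneg _)
  have h1 : DifferentiableAt ℂ (fun p : 𝒜' m ρ a b × 𝒜' m (ρ + ν) a b => comp hρ p.1 f) (u, f) :=
    (differentiableAt_comp_left hρ hu f).comp (u, f) (f := Prod.fst) differentiableAt_fst
  have h2 : DifferentiableAt ℂ (fun p : 𝒜' m ρ a b × 𝒜' m (ρ + ν) a b =>
      compL hρ u hu.le (p.2 - f)) (u, f) := by fun_prop
  refine ((h1.add h2).add hE.differentiableAt).congr_of_eventuallyEq ?_
  filter_upwards [hnear] with p hp
  simp only [Pi.add_apply, compL_apply]
  rw [← compL_apply hρ p.1 hp.le, ← compL_apply hρ p.1 hp.le, ← compL_apply hρ p.1 hp.le, map_sub]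
  abel

end TorusVF

namespace TorusVF

/-! ### The homotopy equation as a fixed point problem -/

open TorusVF.Fourier

lemma one_le_idxNorm {m : ℕ} {k : Fin (m + 1) → ℤ} (hk : k ≠ 0) : 1 ≤ idxNorm k := by
  obtain ⟨i, hi⟩ := Function.ne_iff.1 hk
  have h1 : (1 : ℝ) ≤ |(k i : ℝ)| := by exact_mod_cast Int.one_le_abs hi
  exact h1.trans (Finset.single_le_sum (f := fun i => |(k i : ℝ)|) (fun _ _ => abs_nonneg _)
    (Finset.mem_univ i))

/-- The data entering the homotopy equation `𝕀⁻ U_t^* X = (1 - t) 𝕀⁻ X` near the vector field `N`,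
which depends on `y` only: a set `I` of modes that are far from resonance for `N`. -/
structure HomotopyData (m : ℕ) (ρ ν a b : ℝ) where
  N : Coef m a b
  I : Set (Fin (m + 1) → ℤ)
  σ : ℝ
  w : ℝ
  ρ_nonneg : 0 ≤ ρ
  ν_pos : 0 < ν
  σ_pos : 0 < σ
  -- `w` plays the role of ‖ω‖; this inequality is what makes `δ` at most 1/72.
  σ_lt : σ < w
  norm_N_le : ‖N‖ ≤ 3 / 2 * w
  zero_notMem : (0 : Fin (m + 1) → ℤ) ∉ I
  le_norm_dotL : ∀ k ∈ I, ∀ y ∈ closure (polyball m a b),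
    σ * idxNorm k / 2 ≤ ‖dotL k (N.val y)‖

namespace HomotopyData

variable {m : ℕ} {ρ ν a b : ℝ} (d : HomotopyData m ρ ν a b)

/-- The frequency function `2πi k · N(y)`. -/
noncomputable def freq (k : Fin (m + 1) → ℤ) (y : CVec m) : ℂ :=
  2 * Real.pi * Complex.I * dotL k (d.N.val y)

lemma idxNorm_pos {k : Fin (m + 1) → ℤ} (hk : k ∈ d.I) : 0 < idxNorm k :=
  zero_lt_one.trans_le (one_le_idxNorm fun h => d.zero_notMem (h ▸ hk))

lemma le_norm_freq {k : Fin (m + 1) → ℤ} (hk : k ∈ d.I) {y : CVec m}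
    (hy : y ∈ closure (polyball m a b)) : Real.pi * d.σ * idxNorm k ≤ ‖d.freq k y‖ := by
  have := d.le_norm_dotL k hk y hy
  rw [freq, norm_mul, norm_two_pi_I]
  nlinarith [Real.pi_pos]

lemma freq_ne_zero {k : Fin (m + 1) → ℤ} (hk : k ∈ d.I) {y : CVec m}
    (hy : y ∈ closure (polyball m a b)) : d.freq k y ≠ 0 := by
  have h1 := d.le_norm_freq hk hy
  have h2 : 0 < Real.pi * d.σ * idxNorm k :=
    mul_pos (mul_pos Real.pi_pos d.σ_pos) (d.idxNorm_pos hk)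
  exact norm_pos_iff.1 (h2.trans_le h1)

open Classical in
/-- Division by the frequency function of a mode in `I`. -/
noncomputable def divFreq (k : Fin (m + 1) → ℤ) : Coef m a b →L[ℂ] Coef m a b :=
  if hk : k ∈ d.I then
    Hol.mulBy (fun y => (d.freq k y)⁻¹)
      ((continuousOn_const.mul ((dotL k).continuous.comp_continuousOn d.N.continuousOn_val)).inv₀
        fun _ hy => d.freq_ne_zero hk hy)
      (((differentiableOn_const _).mul
        ((dotL k).differentiable.comp_differentiableOn d.N.differentiableOn_val)).inv
        fun _ hy => d.freq_ne_zero hk (subset_closure hy))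
      (Real.pi * d.σ * idxNorm k)⁻¹
      (fun y hy => by
        rw [norm_inv]
        exact inv_anti₀ (mul_pos (mul_pos Real.pi_pos d.σ_pos) (d.idxNorm_pos hk))
          (d.le_norm_freq hk hy))
      (inv_nonneg.2 (mul_pos (mul_pos Real.pi_pos d.σ_pos) (d.idxNorm_pos hk)).le)
  else 0

lemma divFreq_of_notMem {k : Fin (m + 1) → ℤ} (hk : k ∉ d.I) : d.divFreq k = 0 := dif_neg hk

lemma val_divFreq {k : Fin (m + 1) → ℤ} (hk : k ∈ d.I) (h : Coef m a b) {y : CVec m}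
    (hy : y ∈ closure (polyball m a b)) :
    (d.divFreq k h).val y = (d.freq k y)⁻¹ • h.val y := by
  rw [divFreq, dif_pos hk]
  exact Hol.val_mulBy h hy

/-- The divisor is at least πσ‖k‖, and 1 + 2π‖k‖ ≤ 3π‖k‖ because ‖k‖ ≥ 1 on `I`. So division maps
`𝒜` into `𝒜'` with constant 3/σ. -/
lemma norm_divFreq_le (k : Fin (m + 1) → ℤ) (h : Coef m a b) :
    ‖((singleL k : Coef m a b →L[ℂ] 𝒜' m ρ a b).comp (d.divFreq k)) h‖ ≤
      3 / d.σ * weight 0 ρ k * ‖h‖ := by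
  have hσ := d.σ_pos
  rw [ContinuousLinearMap.comp_apply, singleL_apply, norm_single]
  by_cases hk : k ∈ d.I
  · have h1 := one_le_idxNorm fun h => d.zero_notMem (h ▸ hk)
    have hb : ‖d.divFreq k h‖ ≤ (Real.pi * d.σ * idxNorm k)⁻¹ * ‖h‖ := by
      rw [divFreq, dif_pos hk]
      exact Hol.norm_mulBy_le h
    have hpi := Real.pi_gt_three
    calc weight 1 ρ k * ‖d.divFreq k h‖
        ≤ weight 1 ρ k * ((Real.pi * d.σ * idxNorm k)⁻¹ * ‖h‖) :=
          mul_le_mul_of_nonneg_left hb (weight_pos _ _ _).le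
      _ = ((1 + 2 * Real.pi * idxNorm k) / (Real.pi * idxNorm k)) *
          (Real.exp (ρ * idxNorm k) * ‖h‖ / d.σ) := by
          rw [weight, pow_one]; field_simp
      _ ≤ 3 * (Real.exp (ρ * idxNorm k) * ‖h‖ / d.σ) := by
          refine mul_le_mul_of_nonneg_right ?_ (by positivity)
          rw [div_le_iff₀ (by positivity)]
          nlinarith
      _ = _ := by rw [weight, pow_zero, one_mul]; ring
  · rw [d.divFreq_of_notMem hk, _root_.zero_apply, norm_zero, mul_zero]
    have := weight_pos 0 ρ k
    positivity

/-- The inverse of `u ↦ D_x u N` on the modes in `I`. -/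
noncomputable def linv : 𝒜 m ρ a b →L[ℂ] 𝒜' m ρ a b :=
  lift (fun k => (singleL k).comp (d.divFreq k)) (3 / d.σ) d.norm_divFreq_le

lemma linv_single (k : Fin (m + 1) → ℤ) (h : Coef m a b) :
    d.linv (single k h) = single k (d.divFreq k h) := lift_single (hC := d.norm_divFreq_le) k h

lemma norm_linv_le (g : 𝒜 m ρ a b) : ‖d.linv g‖ ≤ 3 / d.σ * ‖g‖ :=
  norm_lift_apply_le (hC := d.norm_divFreq_le) g

lemma linv_proj (g : 𝒜 m ρ a b) : d.linv (proj d.I g) = d.linv g := by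
  classical
  have : d.linv.comp (projL d.I) = d.linv := clm_ext fun k h => by
    rw [ContinuousLinearMap.comp_apply, projL_apply, proj_single]
    split_ifs with hk
    · rfl
    · rw [map_zero, linv_single, d.divFreq_of_notMem hk, _root_.zero_apply, ← singleL_apply,
        map_zero]
  exact DFunLike.congr_fun this g

lemma linv_const (h : Coef m a b) : d.linv (const h) = 0 := by
  rw [const_eq_single, linv_single, d.divFreq_of_notMem d.zero_notMem, _root_.zero_apply,
    ← singleL_apply, map_zero]

/-- `N` sits in the zero mode, so advection of it does not mix modes: mode k is multiplied by `freq
k`, which `divFreq` undoes on `I`. -/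
lemma advect_linv (g : 𝒜 m ρ a b) :
    advect d.ρ_nonneg (d.linv g) (const d.N) = proj d.I g := by
  classical
  have : ((advect d.ρ_nonneg).flip (const d.N)).comp d.linv = projL d.I := clm_ext fun k h => by
    rw [ContinuousLinearMap.comp_apply, projL_apply, proj_single, linv_single,
      ContinuousLinearMap.flip_apply, const_eq_single, advect_single_single, add_zero]
    split_ifs with hk
    · congr 1
      ext1 y hy
      rw [Hol.val_bilin _ _ _ hy, pairing_apply, d.val_divFreq hk h hy]
      exact smul_inv_smul₀ (d.freq_ne_zero hk hy) _
    · rw [d.divFreq_of_notMem hk, _root_.zero_apply, map_zero, ← singleL_apply, map_zero]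
  exact DFunLike.congr_fun this g

/-- The radius of the ball in which the coordinate changes are found. -/
noncomputable def δ : ℝ := min (ν / (4 * Real.pi)) (d.σ / (72 * d.w))

lemma w_pos : 0 < d.w := d.σ_pos.trans d.σ_lt

lemma δ_pos : 0 < d.δ :=
  lt_min (div_pos d.ν_pos (by positivity)) (div_pos d.σ_pos (by have := d.w_pos; positivity))

lemma w_mul_δ_le : d.w * d.δ ≤ d.σ / 72 := by
  have hw := d.w_pos
  calc d.w * d.δ ≤ d.w * (d.σ / (72 * d.w)) :=
        mul_le_mul_of_nonneg_left (min_le_right _ _) hw.le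
    _ = _ := by field_simp

lemma δ_le : d.δ ≤ 1 / 72 := by
  have := d.w_mul_δ_le
  have hw := d.w_pos
  have := d.σ_lt
  have := d.δ_pos
  by_contra! h
  nlinarith

lemma two_pi_mul_δ_lt : 2 * Real.pi * d.δ < ν := by
  have h : d.δ ≤ ν / (4 * Real.pi) := min_le_left _ _
  have := d.ν_pos
  calc 2 * Real.pi * d.δ ≤ 2 * Real.pi * (ν / (4 * Real.pi)) := by gcongr
    _ = ν / 2 := by field_simp; norm_num
    _ < ν := by linarith

lemma two_pi_mul_norm_lt {u : 𝒜' m ρ a b} (hu : ‖u‖ ≤ d.δ) : 2 * Real.pi * ‖u‖ < ν :=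
  (mul_le_mul_of_nonneg_left hu (by positivity)).trans_lt d.two_pi_mul_δ_lt

/-- The radius of the ball of vector fields. -/
noncomputable def ε : ℝ := d.σ / 42 * d.δ

lemma ε_le : d.ε ≤ d.σ / 3024 := by
  have := d.δ_le
  have := d.σ_pos
  rw [ε]
  nlinarith

/-- Neumann series, since the operator norm of advection by `u` is at most ‖u‖. -/
lemma isUnit_one_add_advect {u : 𝒜' m ρ a b} (hu : ‖u‖ < 1) :
    IsUnit (1 + advect d.ρ_nonneg u) := by
  have h : ‖-advect d.ρ_nonneg u‖ < 1 := by
    rw [norm_neg]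
    exact (norm_advect_le _ u).trans_lt hu
  simpa [sub_neg_eq_add] using (Units.oneSub _ h).isUnit

/-- The pull-back of `X` under `(x, y) ↦ (x + u(x, y), y)`. -/
noncomputable def pull (X : 𝒜' m (ρ + ν) a b) (u : 𝒜' m ρ a b) : 𝒜 m ρ a b :=
  Ring.inverse (1 + advect d.ρ_nonneg u) (comp d.ρ_nonneg u X)

lemma pull_add_advect_pull (X : 𝒜' m (ρ + ν) a b) {u : 𝒜' m ρ a b} (hu : ‖u‖ < 1) :
    d.pull X u + advect d.ρ_nonneg u (d.pull X u) = comp d.ρ_nonneg u X := by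
  have h := Ring.mul_inverse_cancel _ (d.isUnit_one_add_advect hu)
  exact DFunLike.congr_fun h (comp d.ρ_nonneg u X)

/-- The inclusion of vector fields on the larger strip. -/
noncomputable abbrev res : 𝒜' m (ρ + ν) a b →L[ℂ] 𝒜 m ρ a b :=
  inclL (Nat.zero_le 1) (le_add_of_nonneg_right d.ν_pos.le)

lemma pull_zero (X : 𝒜' m (ρ + ν) a b) : d.pull X 0 = d.res X := by
  have := d.pull_add_advect_pull X (u := 0) (by simp)
  rwa [map_zero, _root_.zero_apply, add_zero, comp_zero_left _ d.ν_pos.le] at this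

/-- The map whose fixed point solves the homotopy equation. -/
noncomputable def step (z : ℂ) (X : 𝒜' m (ρ + ν) a b) (u : 𝒜' m ρ a b) : 𝒜' m ρ a b :=
  d.linv (d.pull X u + advect d.ρ_nonneg u (const d.N) - (1 - z) • d.res X)

/-- `N` is independent of x and so unaffected by the shift; composition estimates then cost only the
size of the perturbation. -/
lemma comp_eq_add {u : 𝒜' m ρ a b} (hu : ‖u‖ ≤ d.δ) (X : 𝒜' m (ρ + ν) a b) :
    comp d.ρ_nonneg u X = const d.N + comp d.ρ_nonneg u (X - const d.N) := by
  have hu' := (d.two_pi_mul_norm_lt hu).le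
  rw [← compL_apply _ _ hu', ← compL_apply _ _ hu', map_sub, compL_apply _ _ hu' (const d.N),
    comp_const]
  abel

lemma norm_const (h : Coef m a b) : ‖(const h : 𝒜 m ρ a b)‖ = ‖h‖ := by
  rw [const_eq_single, norm_single]
  simp [weight, idxNorm]

variable {X : 𝒜' m (ρ + ν) a b} {u v : 𝒜' m ρ a b}

lemma norm_advect_apply_le (u : 𝒜' m ρ a b) (g : 𝒜 m ρ a b) :
    ‖advect d.ρ_nonneg u g‖ ≤ ‖u‖ * ‖g‖ :=
  ContinuousLinearMap.le_of_opNorm_le _ (norm_advect_le _ u) g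

lemma norm_lt_one (hu : ‖u‖ ≤ d.δ) : ‖u‖ < 1 := hu.trans_lt (d.δ_le.trans_lt (by norm_num))

lemma norm_pull_le (hu : ‖u‖ ≤ d.δ) :
    (1 - ‖u‖) * ‖d.pull X u‖ ≤ ‖d.N‖ + ‖X - const d.N‖ := by
  have h := d.pull_add_advect_pull X (d.norm_lt_one hu)
  have h1 : d.pull X u = const d.N + comp d.ρ_nonneg u (X - const d.N)
      - advect d.ρ_nonneg u (d.pull X u) := by
    rw [← d.comp_eq_add hu, ← h, add_sub_cancel_right]
  have h2 := norm_comp_le d.ρ_nonneg (d.two_pi_mul_norm_lt hu).le (X - const d.N)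
  have h3 := d.norm_advect_apply_le u (d.pull X u)
  have h4 := norm_sub_le (const d.N + comp d.ρ_nonneg u (X - const d.N))
    (advect d.ρ_nonneg u (d.pull X u))
  have h5 := norm_add_le (const d.N) (comp d.ρ_nonneg u (X - const d.N))
  rw [norm_const] at h5
  rw [← h1] at h4
  linarith

/-- The conjugacy relation solved for Y - N. The term advecting Y - N is moved to the left in the
estimates, which are stated with the factor 1 - ‖u‖. -/
lemma pull_sub_const_eq (hu : ‖u‖ ≤ d.δ) : d.pull X u - const d.N =
    comp d.ρ_nonneg u (X - const d.N) - advect d.ρ_nonneg u (const d.N)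
      - advect d.ρ_nonneg u (d.pull X u - const d.N) := by
  have h := d.pull_add_advect_pull X (d.norm_lt_one hu)
  rw [d.comp_eq_add hu] at h
  rw [map_sub]
  linear_combination (norm := module) h

lemma norm_pull_sub_const_le (hu : ‖u‖ ≤ d.δ) :
    (1 - ‖u‖) * ‖d.pull X u - const d.N‖ ≤ ‖X - const d.N‖ + ‖u‖ * ‖d.N‖ := by
  have h2 := norm_comp_le d.ρ_nonneg (d.two_pi_mul_norm_lt hu).le (X - const d.N)
  have h3 := d.norm_advect_apply_le u (d.pull X u - const d.N)
  have h6 := d.norm_advect_apply_le u (const d.N)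
  rw [norm_const] at h6
  have h4 := norm_sub_le (comp d.ρ_nonneg u (X - const d.N) - advect d.ρ_nonneg u (const d.N))
    (advect d.ρ_nonneg u (d.pull X u - const d.N))
  have h5 := norm_sub_le (comp d.ρ_nonneg u (X - const d.N)) (advect d.ρ_nonneg u (const d.N))
  rw [← d.pull_sub_const_eq hu] at h4
  linarith

lemma pull_sub_pull_eq (hu : ‖u‖ ≤ d.δ) (hv : ‖v‖ ≤ d.δ) : d.pull X u - d.pull X v =
    (comp d.ρ_nonneg u (X - const d.N) - comp d.ρ_nonneg v (X - const d.N))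
      - advect d.ρ_nonneg (u - v) (d.pull X v)
      - advect d.ρ_nonneg u (d.pull X u - d.pull X v) := by
  have h1 := d.pull_add_advect_pull X (d.norm_lt_one hu)
  have h2 := d.pull_add_advect_pull X (d.norm_lt_one hv)
  rw [d.comp_eq_add hu] at h1
  rw [d.comp_eq_add hv] at h2
  simp only [map_sub, _root_.sub_apply]
  linear_combination (norm := module) h1 - h2

lemma norm_pull_sub_pull_le (hu : ‖u‖ ≤ d.δ) (hv : ‖v‖ ≤ d.δ) :
    (1 - ‖u‖) * ‖d.pull X u - d.pull X v‖ ≤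
      (‖X - const d.N‖ + ‖d.pull X v‖) * ‖u - v‖ := by
  have h2 := norm_comp_sub_comp_le d.ρ_nonneg (d.two_pi_mul_norm_lt hu).le
    (d.two_pi_mul_norm_lt hv).le (X - const d.N)
  have h3 := d.norm_advect_apply_le u (d.pull X u - d.pull X v)
  have h6 := d.norm_advect_apply_le (u - v) (d.pull X v)
  have h4 := norm_sub_le ((comp d.ρ_nonneg u (X - const d.N) -
    comp d.ρ_nonneg v (X - const d.N)) - advect d.ρ_nonneg (u - v) (d.pull X v))
    (advect d.ρ_nonneg u (d.pull X u - d.pull X v))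
  have h5 := norm_sub_le (comp d.ρ_nonneg u (X - const d.N) - comp d.ρ_nonneg v (X - const d.N))
    (advect d.ρ_nonneg (u - v) (d.pull X v))
  rw [← d.pull_sub_pull_eq hu hv] at h4
  linarith

/-- After the cancellation in `hsplit` each remaining term is a multiple of ‖u - v‖ with a
coefficient that is a small fraction of σ. They add up to at most σ/12, and the bound 3/σ for `linv`
gives 1/4. -/
lemma norm_step_sub_step_le (z : ℂ) (hX : ‖X - const d.N‖ ≤ d.ε) (hu : ‖u‖ ≤ d.δ)
    (hv : ‖v‖ ≤ d.δ) : ‖d.step z X u - d.step z X v‖ ≤ 1 / 4 * ‖u - v‖ := by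
  have hσ := d.σ_pos
  have hδ := d.δ_pos
  have hδ1 := d.δ_le
  have hN := d.norm_N_le
  have hwδ := d.w_mul_δ_le
  have hε := hX.trans d.ε_le
  -- 3/2 · 1/72 = 1/48.
  have hNδ : ‖d.N‖ * d.δ ≤ d.σ / 48 := by nlinarith
  set s := ‖X - const d.N‖
  have hs : 0 ≤ s := norm_nonneg _
  have e1 := d.norm_pull_le (X := X) hv
  have e2 := d.norm_pull_sub_const_le (X := X) hv
  have e3 := d.norm_pull_sub_pull_le (X := X) hu hv
  have p1 := norm_nonneg (d.pull X v)
  have p2 := norm_nonneg (d.pull X v - const d.N)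
  have p3 := norm_nonneg (d.pull X u - d.pull X v)
  have p4 := norm_nonneg (u - v)
  have p5 := norm_nonneg d.N
  have hY0 : ‖d.pull X v - const d.N‖ ≤ d.σ / 45 := by
    have i1 : ‖v‖ * ‖d.N‖ ≤ d.δ * ‖d.N‖ := mul_le_mul_of_nonneg_right hv p5
    -- 71/72 is the lower bound for 1 - ‖v‖ that follows from ‖v‖ ≤ δ ≤ 1/72.
    have i2 : (71 / 72) * ‖d.pull X v - const d.N‖ ≤ (1 - ‖v‖) * ‖d.pull X v - const d.N‖ :=
      mul_le_mul_of_nonneg_right (by linarith) p2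
    nlinarith
  have hY : d.δ * ‖d.pull X v‖ ≤ d.σ / 45 := by
    have i2 : (71 / 72) * ‖d.pull X v‖ ≤ (1 - ‖v‖) * ‖d.pull X v‖ :=
      mul_le_mul_of_nonneg_right (by linarith) p1
    have i3 : d.δ * ((71 / 72) * ‖d.pull X v‖) ≤ d.δ * (‖d.N‖ + s) :=
      mul_le_mul_of_nonneg_left (i2.trans e1) hδ.le
    have i4 : d.δ * s ≤ 1 / 72 * (d.σ / 3024) := mul_le_mul hδ1 hε hs (by norm_num)
    nlinarith
  have hYY : d.δ * ‖d.pull X u - d.pull X v‖ ≤ d.σ / 40 * ‖u - v‖ := by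
    have i2 : (71 / 72) * ‖d.pull X u - d.pull X v‖ ≤ (1 - ‖u‖) * ‖d.pull X u - d.pull X v‖ :=
      mul_le_mul_of_nonneg_right (by linarith) p3
    have i3 : d.δ * ((71 / 72) * ‖d.pull X u - d.pull X v‖) ≤ d.δ * ((s + ‖d.pull X v‖) * ‖u - v‖) :=
      mul_le_mul_of_nonneg_left (i2.trans e3) hδ.le
    have i4 : d.δ * s ≤ 1 / 72 * (d.σ / 3024) := mul_le_mul hδ1 hε hs (by norm_num)
    have i5 : d.δ * (s + ‖d.pull X v‖) * ‖u - v‖ ≤ (1 / 72 * (d.σ / 3024) + d.σ / 45) * ‖u - v‖ :=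
      mul_le_mul_of_nonneg_right (by linarith) p4
    nlinarith
  rw [step, step, ← map_sub]
  -- The source term does not depend on the unknown and drops out; adding the advection of `N`
  -- replaces `pull X v` by its small deviation from `N`.
  have hsplit : d.pull X u + advect d.ρ_nonneg u (const d.N) - (1 - z) • d.res X -
      (d.pull X v + advect d.ρ_nonneg v (const d.N) - (1 - z) • d.res X) =
      (comp d.ρ_nonneg u (X - const d.N) - comp d.ρ_nonneg v (X - const d.N))
      - advect d.ρ_nonneg (u - v) (d.pull X v - const d.N)
      - advect d.ρ_nonneg u (d.pull X u - d.pull X v) := by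
    have h := d.pull_sub_pull_eq (X := X) hu hv
    simp only [map_sub, _root_.sub_apply] at h ⊢
    linear_combination (norm := module) h
  have h2 := norm_comp_sub_comp_le d.ρ_nonneg (d.two_pi_mul_norm_lt hu).le
    (d.two_pi_mul_norm_lt hv).le (X - const d.N)
  have h3 := d.norm_advect_apply_le u (d.pull X u - d.pull X v)
  have h6 := d.norm_advect_apply_le (u - v) (d.pull X v - const d.N)
  have h7 : ‖u‖ * ‖d.pull X u - d.pull X v‖ ≤ d.δ * ‖d.pull X u - d.pull X v‖ :=
    mul_le_mul_of_nonneg_right hu p3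
  have h8 : s * ‖u - v‖ ≤ d.σ / 3024 * ‖u - v‖ := mul_le_mul_of_nonneg_right hε p4
  have h9 : ‖u - v‖ * ‖d.pull X v - const d.N‖ ≤ ‖u - v‖ * (d.σ / 45) :=
    mul_le_mul_of_nonneg_left hY0 p4
  have hG : ‖d.pull X u + advect d.ρ_nonneg u (const d.N) - (1 - z) • d.res X -
      (d.pull X v + advect d.ρ_nonneg v (const d.N) - (1 - z) • d.res X)‖ ≤
      d.σ / 12 * ‖u - v‖ := by
    rw [hsplit]
    refine (norm_sub_le _ _).trans ?_
    have := norm_sub_le (comp d.ρ_nonneg u (X - const d.N) - comp d.ρ_nonneg v (X - const d.N))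
      (advect d.ρ_nonneg (u - v) (d.pull X v - const d.N))
    have : 0 ≤ d.σ * ‖u - v‖ := by positivity
    linarith
  refine (d.norm_linv_le _).trans ((mul_le_mul_of_nonneg_left hG (by positivity)).trans_eq ?_)
  field_simp
  ring

/-- At u = 0 the pull-back is X itself, and `linv` kills `N` because 0 ∉ I. Hence the factor t and
the far-mode norm of the perturbation in the bound for u_t. -/
lemma step_zero (z : ℂ) (X : 𝒜' m (ρ + ν) a b) :
    d.step z X 0 = z • d.linv (proj d.I (d.res (X - const d.N))) := by
  rw [step, pull_zero, map_zero, _root_.zero_apply, add_zero, linv_proj]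
  have h1 : d.res X - (1 - z) • d.res X = z • d.res X := by
    rw [sub_smul, one_smul, sub_sub_cancel]
  have h2 : d.res X = d.res (X - const d.N) + const d.N := by
    rw [map_sub]
    exact (sub_add_cancel _ _).symm
  rw [h1, h2, map_smul d.linv, map_add d.linv, linv_const, add_zero]

lemma norm_step_zero_le (z : ℂ) (X : 𝒜' m (ρ + ν) a b) :
    ‖d.step z X 0‖ ≤ 3 * ‖z‖ / d.σ * ‖proj d.I (d.res (X - const d.N))‖ := by
  rw [step_zero, norm_smul]
  calc _ ≤ ‖z‖ * (3 / d.σ * ‖proj d.I (d.res (X - const d.N))‖) :=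
        mul_le_mul_of_nonneg_left (d.norm_linv_le _) (norm_nonneg _)
    _ = _ := by ring

lemma norm_proj_res_le (f : 𝒜' m (ρ + ν) a b) : ‖proj d.I (d.res f)‖ ≤ ‖f‖ :=
  (norm_proj_le _ _).trans
    (norm_incl_le (Nat.zero_le 1) (le_add_of_nonneg_right d.ν_pos.le) f)

/-- The choice ε = σδ/42 gives a displacement of 0 of at most (6/σ)ε = δ/7, and the contraction adds
at most δ/4. Allowing |z| up to 2 leaves a complex neighbourhood of [0, 1]. -/
lemma norm_step_le {z : ℂ} (hz : ‖z‖ ≤ 2) (hX : ‖X - const d.N‖ ≤ d.ε) (hu : ‖u‖ ≤ d.δ) :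
    ‖d.step z X u‖ ≤ d.δ := by
  have hσ := d.σ_pos
  have h0 : ‖(0 : 𝒜' m ρ a b)‖ ≤ d.δ := by rw [norm_zero]; exact d.δ_pos.le
  have h1 := d.norm_step_sub_step_le z hX hu h0
  rw [sub_zero] at h1
  have h2 := d.norm_step_zero_le z X
  have h3 : 3 * ‖z‖ / d.σ * ‖proj d.I (d.res (X - const d.N))‖ ≤ 3 * 2 / d.σ * d.ε := by
    gcongr
    exact (d.norm_proj_res_le _).trans hX
  have h4 : 3 * 2 / d.σ * d.ε = d.δ / 7 := by
    rw [ε]; field_simp; ring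
  have h5 := norm_le_norm_sub_add (d.step z X u) (d.step z X 0)
  have := d.δ_pos
  linarith

end HomotopyData

end TorusVF

namespace TorusVF

/-! ### The solution of the homotopy equation -/

open TorusVF.Fourier

lemma Fourier.proj_compl_proj {m s : ℕ} {ρ : ℝ} {H : Type*} [NormedAddCommGroup H]
    [NormedSpace ℂ H] (I : Set (Fin (m + 1) → ℤ)) (f : Fourier H m s ρ) :
    proj Iᶜ (proj I f) = 0 := by
  classical
  ext k
  rw [coeff_proj, coeff_proj, coeff_zero]
  by_cases h : k ∈ I <;> simp [h]

lemma Fourier.proj_const_eq_zero {m s : ℕ} {ρ : ℝ} {H : Type*} [NormedAddCommGroup H]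
    [NormedSpace ℂ H] {I : Set (Fin (m + 1) → ℤ)} (hI : 0 ∉ I) (h : H) :
    proj I (const h : Fourier H m s ρ) = 0 := by
  classical
  rw [const_eq_single, proj_single, if_neg hI]

namespace HomotopyData

variable {m : ℕ} {ρ ν a b : ℝ} (d : HomotopyData m ρ ν a b) {z : ℂ} {X : 𝒜' m (ρ + ν) a b}

/-- Banach's fixed point theorem. The convergence of the iterates from 0 is recorded because reality
is inherited along them. -/
lemma exists_fixedPoint (hz : ‖z‖ ≤ 2) (hX : ‖X - const d.N‖ ≤ d.ε) :
    ∃ u : 𝒜' m ρ a b, (‖u‖ ≤ d.δ ∧ d.step z X u = u) ∧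
      Tendsto (fun n => (d.step z X)^[n] 0) atTop (𝓝 u) := by
  have hmaps : MapsTo (d.step z X) (Metric.closedBall 0 d.δ) (Metric.closedBall 0 d.δ) :=
    fun u hu => by
      rw [mem_closedBall_zero_iff] at hu ⊢
      exact d.norm_step_le hz hX hu
  have hcontr : ContractingWith (1 / 4) (hmaps.restrict _ _ _) := by
    refine ⟨by rw [← NNReal.coe_lt_coe]; norm_num, LipschitzWith.of_dist_le_mul fun u v => ?_⟩
    have h := d.norm_step_sub_step_le z hX (mem_closedBall_zero_iff.1 u.2)
      (mem_closedBall_zero_iff.1 v.2)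
    rw [Subtype.dist_eq, Subtype.dist_eq, dist_eq_norm, dist_eq_norm]
    simpa using h
  obtain ⟨u, hu, hfix, hlim, -⟩ := hcontr.exists_fixedPoint' Metric.isClosed_closedBall.isComplete
    hmaps (Metric.mem_closedBall_self d.δ_pos.le) (edist_ne_top _ _)
  exact ⟨u, ⟨mem_closedBall_zero_iff.1 hu, hfix⟩, hlim⟩

lemma fixedPoint_unique (hX : ‖X - const d.N‖ ≤ d.ε) {u v : 𝒜' m ρ a b} (hu : ‖u‖ ≤ d.δ)
    (hv : ‖v‖ ≤ d.δ) (hu' : d.step z X u = u) (hv' : d.step z X v = v) : u = v := by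
  have h := d.norm_step_sub_step_le z hX hu hv
  rw [hu', hv'] at h
  have := norm_nonneg (u - v)
  exact sub_eq_zero.1 (norm_eq_zero.1 (by linarith))

/-- The solution of the homotopy equation. -/
noncomputable def sol (z : ℂ) (X : 𝒜' m (ρ + ν) a b) : 𝒜' m ρ a b :=
  Classical.epsilon fun u => ‖u‖ ≤ d.δ ∧ d.step z X u = u

section sol

variable (hz : ‖z‖ ≤ 2) (hX : ‖X - const d.N‖ ≤ d.ε)

include hz hX

lemma sol_spec : ‖d.sol z X‖ ≤ d.δ ∧ d.step z X (d.sol z X) = d.sol z X :=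
  Classical.epsilon_spec (p := fun u => ‖u‖ ≤ d.δ ∧ d.step z X u = u)
    ((d.exists_fixedPoint hz hX).imp fun _ h => h.1)

lemma tendsto_iterate_sol :
    Tendsto (fun n => (d.step z X)^[n] 0) atTop (𝓝 (d.sol z X)) := by
  obtain ⟨u, ⟨hu, hfix⟩, hlim⟩ := d.exists_fixedPoint hz hX
  obtain ⟨h1, h2⟩ := d.sol_spec hz hX
  rwa [d.fixedPoint_unique hX h1 hu h2 hfix]

lemma norm_sol_le :
    ‖d.sol z X‖ ≤ 4 * ‖z‖ / d.σ * ‖proj d.I (d.res (X - const d.N))‖ := by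
  obtain ⟨h1, h2⟩ := d.sol_spec hz hX
  have h0 : ‖(0 : 𝒜' m ρ a b)‖ ≤ d.δ := by rw [norm_zero]; exact d.δ_pos.le
  have h3 := d.norm_step_sub_step_le z hX h1 h0
  rw [sub_zero, h2] at h3
  have h4 := d.norm_step_zero_le z X
  have h5 := norm_le_norm_sub_add (d.sol z X) (d.step z X 0)
  -- The factor 4/3 is 1/(1 - 1/4).
  calc ‖d.sol z X‖ ≤ 4 / 3 * (3 * ‖z‖ / d.σ * ‖proj d.I (d.res (X - const d.N))‖) := by linarith
    _ = _ := by ring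

lemma norm_sol_le_mul : ‖d.sol z X‖ ≤ 4 * ‖z‖ / d.σ * ‖X - const d.N‖ := by
  have := d.σ_pos
  exact (d.norm_sol_le hz hX).trans
    (mul_le_mul_of_nonneg_left (d.norm_proj_res_le _) (by positivity))

/-- Strictness puts the solution in the open δ-ball, a neighbourhood of it as
`differentiableAt_fixedPoint` requires. -/
lemma norm_sol_lt : ‖d.sol z X‖ < d.δ := by
  have hσ := d.σ_pos
  have hδ := d.δ_pos
  calc ‖d.sol z X‖ ≤ 4 * 2 / d.σ * d.ε := (d.norm_sol_le_mul hz hX).trans (by gcongr)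
    _ = 8 / 42 * d.δ := by rw [ε]; field_simp; ring
    _ < d.δ := by linarith

lemma advect_sol : advect d.ρ_nonneg (d.sol z X) (const d.N) = proj d.I
    (d.pull X (d.sol z X) + advect d.ρ_nonneg (d.sol z X) (const d.N) - (1 - z) • d.res X) := by
  rw [← advect_linv]
  congr 2
  exact (d.sol_spec hz hX).2.symm

lemma proj_advect_sol : proj d.I (advect d.ρ_nonneg (d.sol z X) (const d.N)) =
    advect d.ρ_nonneg (d.sol z X) (const d.N) := by
  classical
  rw [d.advect_sol hz hX]
  ext k
  rw [coeff_proj, coeff_proj]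
  split_ifs <;> rfl

/-- The solution lies in the range of `linv`, so the advection of `N` by it has modes in `I` only.
It appears on both sides of `advect_sol` and cancels, leaving the homotopy equation. -/
lemma proj_pull_sol : proj d.I (d.pull X (d.sol z X)) = (1 - z) • proj d.I (d.res X) := by
  have h := d.advect_sol hz hX
  rw [← projL_apply, map_sub, map_add, map_smul, projL_apply, projL_apply, projL_apply,
    d.proj_advect_sol hz hX] at h
  linear_combination (norm := module) -h

end sol

lemma sol_zero (hX : ‖X - const d.N‖ ≤ d.ε) : d.sol 0 X = 0 := by
  obtain ⟨h1, h2⟩ := d.sol_spec (z := 0) (by simp) hX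
  refine d.fixedPoint_unique hX h1 (by rw [norm_zero]; exact d.δ_pos.le) h2 ?_
  rw [step_zero, zero_smul]

/-- With s = ‖X - N‖, the modes in `I` contribute (1 - t)s by the homotopy equation. On the other
modes the advection of `N` vanishes, and the composed perturbation and the advection of Y - N
contribute at most s each. -/
lemma norm_pull_sol_sub_le (hX : ‖X - const d.N‖ ≤ d.ε) {t : ℝ} (h0 : 0 ≤ t) (h1 : t ≤ 1) :
    ‖d.pull X (d.sol t X) - const d.N‖ ≤ (3 - t) * ‖X - const d.N‖ := by
  have hz : ‖(t : ℂ)‖ ≤ 1 := by rwa [Complex.norm_real, Real.norm_of_nonneg h0]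
  have hz' : ‖(t : ℂ)‖ ≤ 2 := hz.trans one_le_two
  set u := d.sol t X with hu
  have hsol := (d.sol_spec hz' hX).1
  rw [← hu] at hsol
  have e0 := d.norm_sol_le_mul hz' hX
  rw [← hu] at e0
  have e2 := d.norm_pull_sub_const_le (X := X) hsol
  have hσ := d.σ_pos
  have hδ1 := d.δ_le
  have hwδ := d.w_mul_δ_le
  have hN := d.norm_N_le
  set s := ‖X - const d.N‖ with hs'
  have hs : 0 ≤ s := norm_nonneg _
  have p2 := norm_nonneg (d.pull X u - const d.N)
  have p1 := norm_nonneg u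
  have p5 := norm_nonneg d.N
  have e1 : ‖u‖ * d.σ ≤ 4 * s := by
    have : 4 * ‖(t : ℂ)‖ / d.σ * s ≤ 4 * 1 / d.σ * s := by gcongr
    calc ‖u‖ * d.σ ≤ 4 * 1 / d.σ * s * d.σ := by gcongr; exact e0.trans this
      _ = _ := by field_simp
  -- Since ‖u‖σ ≤ 4s, the advection of Y - N is linear in s: it is at most 72/71 · (1/72 + 4/48)s.
  have hDu : ‖advect d.ρ_nonneg u (d.pull X u - const d.N)‖ ≤ s := by
    refine (d.norm_advect_apply_le u _).trans ?_
    have i1 : ‖u‖ * ‖d.N‖ ≤ d.σ / 48 := by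
      have : ‖u‖ * ‖d.N‖ ≤ d.δ * (3 / 2 * d.w) := mul_le_mul hsol hN p5 d.δ_pos.le
      linarith
    have i2 : (71 / 72) * ‖d.pull X u - const d.N‖ ≤ (1 - ‖u‖) * ‖d.pull X u - const d.N‖ :=
      mul_le_mul_of_nonneg_right (by linarith) p2
    have i3 : ‖u‖ * ((71 / 72) * ‖d.pull X u - const d.N‖) ≤ ‖u‖ * (s + d.σ / 48) :=
      mul_le_mul_of_nonneg_left (by linarith) p1
    have i4 : ‖u‖ * s ≤ 1 / 72 * s := mul_le_mul_of_nonneg_right (hsol.trans hδ1) hs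
    linarith
  have hplus : ‖proj d.Iᶜ (d.pull X u - const d.N)‖ ≤ 2 * s := by
    have h := d.pull_sub_const_eq (X := X) hsol
    have hk : proj d.Iᶜ (advect d.ρ_nonneg u (const d.N)) = 0 := by
      rw [hu, ← d.proj_advect_sol hz' hX, proj_compl_proj]
    rw [h, ← projL_apply, map_sub, map_sub, projL_apply d.Iᶜ (advect d.ρ_nonneg u (const d.N)), hk,
      sub_zero, projL_apply, projL_apply]
    have j1 := norm_proj_le d.Iᶜ (comp d.ρ_nonneg u (X - const d.N))
    have j2 := norm_comp_le d.ρ_nonneg (d.two_pi_mul_norm_lt hsol).le (X - const d.N)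
    have j3 := norm_proj_le d.Iᶜ (advect d.ρ_nonneg u (d.pull X u - const d.N))
    refine (norm_sub_le _ _).trans ?_
    linarith
  have hminus : ‖proj d.I (d.pull X u - const d.N)‖ ≤ (1 - t) * s := by
    have hk : proj d.I (d.pull X u - const d.N) = (1 - (t : ℂ)) • proj d.I (d.res (X - const d.N)) := by
      rw [← projL_apply, map_sub, projL_apply, projL_apply, proj_const_eq_zero d.zero_notMem, sub_zero,
        hu, d.proj_pull_sol hz' hX, map_sub, ← projL_apply, ← projL_apply, map_sub,
        projL_apply d.I (d.res (const d.N)),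
        show d.res (const d.N) = (const d.N : 𝒜 m ρ a b) from rfl,
        proj_const_eq_zero d.zero_notMem, sub_zero]
    rw [hk, norm_smul, show (1 - (t : ℂ)) = ((1 - t : ℝ) : ℂ) by push_cast; rfl, Complex.norm_real,
      Real.norm_of_nonneg (by linarith)]
    exact mul_le_mul_of_nonneg_left (d.norm_proj_res_le _) (by linarith)
  rw [← proj_add_proj_compl d.I (d.pull X u - const d.N)]
  refine (norm_add_le _ _).trans ?_
  linarith

lemma differentiableAt_pull {u : 𝒜' m ρ a b} (hu : ‖u‖ ≤ d.δ) :
    DifferentiableAt ℂ (fun p : 𝒜' m (ρ + ν) a b × 𝒜' m ρ a b => d.pull p.1 p.2) (X, u) := by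
  have h1 : DifferentiableAt ℂ (fun p : 𝒜' m (ρ + ν) a b × 𝒜' m ρ a b =>
      comp d.ρ_nonneg p.2 p.1) (X, u) :=
    DifferentiableAt.comp (X, u)
      (g := fun p : 𝒜' m ρ a b × 𝒜' m (ρ + ν) a b => comp d.ρ_nonneg p.1 p.2)
      (f := fun p : 𝒜' m (ρ + ν) a b × 𝒜' m ρ a b => (p.2, p.1))
      (differentiableAt_comp d.ρ_nonneg (d.two_pi_mul_norm_lt hu) X)
      (differentiableAt_snd.prodMk differentiableAt_fst)
  have h2 : DifferentiableAt ℂ (fun p : 𝒜' m (ρ + ν) a b × 𝒜' m ρ a b =>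
      Ring.inverse (1 + advect d.ρ_nonneg p.2)) (X, u) :=
    DifferentiableAt.comp (X, u) (g := Ring.inverse)
      (f := fun p : 𝒜' m (ρ + ν) a b × 𝒜' m ρ a b => 1 + advect d.ρ_nonneg p.2)
      (differentiableAt_inverse (d.isUnit_one_add_advect (d.norm_lt_one hu))) (by fun_prop)
  exact h2.clm_apply h1

lemma differentiableAt_sol (hz : ‖z‖ < 2) (hX : ‖X - const d.N‖ < d.ε) :
    DifferentiableAt ℂ (fun p : ℂ × 𝒜' m (ρ + ν) a b => d.sol p.1 p.2) (z, X) := by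
  have hev : ∀ᶠ p : ℂ × 𝒜' m (ρ + ν) a b in 𝓝 (z, X), ‖p.1‖ < 2 ∧ ‖p.2 - const d.N‖ < d.ε := by
    have h1 : ContinuousAt (fun p : ℂ × 𝒜' m (ρ + ν) a b => ‖p.1‖) (z, X) := by fun_prop
    have h2 : ContinuousAt (fun p : ℂ × 𝒜' m (ρ + ν) a b => ‖p.2 - const d.N‖) (z, X) := by
      fun_prop
    exact (h1.eventually_lt continuousAt_const hz).and (h2.eventually_lt continuousAt_const hX)
  have hu := (d.sol_spec hz.le hX.le).1
  refine differentiableAt_fixedPoint (K := 1 / 4) (S := Metric.ball 0 d.δ)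
    (T := fun q : (ℂ × 𝒜' m (ρ + ν) a b) × 𝒜' m ρ a b => d.step q.1.1 q.1.2 q.2) (by norm_num) ?_
    (Metric.isOpen_ball.mem_nhds (mem_ball_zero_iff.2 (d.norm_sol_lt hz.le hX.le)))
    (hev.mono fun p hp => mem_ball_zero_iff.2 (d.norm_sol_lt hp.1.le hp.2.le))
    (hev.mono fun p hp => (d.sol_spec hp.1.le hp.2.le).2)
    (hev.mono fun p hp v hv w hw => d.norm_step_sub_step_le p.1 hp.2.le
      (mem_ball_zero_iff.1 hv).le (mem_ball_zero_iff.1 hw).le) (by norm_num)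
  have h1 : DifferentiableAt ℂ (fun q : (ℂ × 𝒜' m (ρ + ν) a b) × 𝒜' m ρ a b =>
      d.pull q.1.2 q.2) ((z, X), d.sol z X) :=
    DifferentiableAt.comp ((z, X), d.sol z X)
      (g := fun p : 𝒜' m (ρ + ν) a b × 𝒜' m ρ a b => d.pull p.1 p.2)
      (f := fun q : (ℂ × 𝒜' m (ρ + ν) a b) × 𝒜' m ρ a b => (q.1.2, q.2))
      (d.differentiableAt_pull hu) (by fun_prop)
  have h2 : DifferentiableAt ℂ (fun q : (ℂ × 𝒜' m (ρ + ν) a b) × 𝒜' m ρ a b =>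
      advect d.ρ_nonneg q.2 (const d.N)) ((z, X), d.sol z X) := by fun_prop
  have h3 : DifferentiableAt ℂ (fun q : (ℂ × 𝒜' m (ρ + ν) a b) × 𝒜' m ρ a b =>
      (1 - q.1.1) • d.res q.1.2) ((z, X), d.sol z X) := by fun_prop
  exact d.linv.differentiableAt.comp _ ((h1.add h2).sub h3)

lemma differentiableAt_sol_right (hz : ‖z‖ < 2) (hX : ‖X - const d.N‖ < d.ε) :
    DifferentiableAt ℂ (d.sol z) X :=
  (d.differentiableAt_sol hz hX).comp X (f := fun X => (z, X)) (by fun_prop)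

lemma differentiableAt_pull_sol (hz : ‖z‖ < 2) (hX : ‖X - const d.N‖ < d.ε) :
    DifferentiableAt ℂ (fun X => d.pull X (d.sol z X)) X :=
  (d.differentiableAt_pull (d.sol_spec hz.le hX.le).1).comp X (f := fun X => (X, d.sol z X))
    (differentiableAt_id.prodMk (d.differentiableAt_sol_right hz hX))

/-- One complex variable: z ↦ `sol z X` is holomorphic on the disc of radius 2, which contains [0,
1]. -/
lemma analyticOn_sol (hX : ‖X - const d.N‖ < d.ε) :
    AnalyticOn ℝ (fun t : ℝ => d.sol (t : ℂ) X) (Icc 0 1) := by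
  intro t ht
  have h : AnalyticOnNhd ℂ (fun z => d.sol z X) (Metric.ball 0 2) :=
    DifferentiableOn.analyticOnNhd (fun z hz => ((d.differentiableAt_sol
      (mem_ball_zero_iff.1 hz) hX).comp z (f := fun z => (z, X))
        (by fun_prop)).differentiableWithinAt) Metric.isOpen_ball
  have ht' : (t : ℂ) ∈ Metric.ball (0 : ℂ) 2 := by
    rw [mem_ball_zero_iff, Complex.norm_real, Real.norm_of_nonneg ht.1]
    linarith [ht.2]
  have h2 : AnalyticAt ℝ (fun t : ℝ => (t : ℂ)) t := Complex.ofRealCLM.analyticAt t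
  exact (((h _ ht').restrictScalars (𝕜 := ℝ)).comp h2).analyticWithinAt

end HomotopyData

end TorusVF

namespace TorusVF

/-! ### Fourier series as functions -/

open TorusVF.Fourier

variable {m s : ℕ} {ρ ν a b : ℝ}

/-- The character `e^{2πi k·x}`. -/
noncomputable def char (k : Fin (m + 1) → ℤ) (x : CVec m) : ℂ :=
  Complex.exp (2 * Real.pi * Complex.I * dotL k x)

lemma char_add (k : Fin (m + 1) → ℤ) (x y : CVec m) : char k (x + y) = char k x * char k y := by
  rw [char, char, char, ← Complex.exp_add, map_add, mul_add]

lemma char_add_index (j l : Fin (m + 1) → ℤ) (x : CVec m) :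
    char (j + l) x = char j x * char l x := by
  rw [char, char, char, ← Complex.exp_add, ← mul_add, dotL_apply, dotL_apply, dotL_apply,
    ← Finset.sum_add_distrib]
  congr 2
  exact Finset.sum_congr rfl fun i _ => by rw [Pi.add_apply]; push_cast; ring

lemma norm_char_le (k : Fin (m + 1) → ℤ) {x : CVec m} (hx : x ∈ strip m ρ) :
    ‖char k x‖ ≤ Real.exp (ρ * idxNorm k) := by
  have hx' : ∑ i, |(x i).im| < ρ / (2 * Real.pi) := hx
  rw [char, Complex.norm_exp]
  refine Real.exp_le_exp.2 ?_
  have h1 : (2 * Real.pi * Complex.I * dotL k x : ℂ).re = 2 * Real.pi * -∑ i, (k i : ℝ) * (x i).im := by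
    have h2 : (dotL k x).im = ∑ i, (k i : ℝ) * (x i).im := by
      rw [dotL_apply, Complex.im_sum]
      exact Finset.sum_congr rfl fun i _ => by simp [Complex.mul_im]
    rw [← h2]
    simp [Complex.mul_re]
  have h3 : -∑ i, (k i : ℝ) * (x i).im ≤ idxNorm k * ∑ i, |(x i).im| := by
    rw [← Finset.sum_neg_distrib, idxNorm, Finset.sum_mul]
    refine Finset.sum_le_sum fun i _ => (neg_le_abs _).trans ?_
    rw [abs_mul]
    exact mul_le_mul_of_nonneg_left
      (Finset.single_le_sum (f := fun i => |(x i).im|) (fun _ _ => abs_nonneg _) (Finset.mem_univ i))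
      (abs_nonneg _)
  have hk := idxNorm_nonneg k
  rw [h1]
  calc _ ≤ 2 * Real.pi * (idxNorm k * (ρ / (2 * Real.pi))) := by
        refine mul_le_mul_of_nonneg_left (h3.trans ?_) (by positivity)
        gcongr
    _ = _ := by field_simp

lemma exp_le_weight (k : Fin (m + 1) → ℤ) : Real.exp (ρ * idxNorm k) ≤ weight s ρ k := by
  rw [weight]
  exact le_mul_of_one_le_left (Real.exp_pos _).le (one_le_pow₀ (one_le_base k))

lemma norm_char_smul_valL_le {x : CVec m} (hx : x ∈ strip m ρ) (y : CVec m) (k : Fin (m + 1) → ℤ)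
    (h : Coef m a b) : ‖(char k x • (Hol.valL y : Coef m a b →L[ℂ] CVec m)) h‖ ≤
      1 * weight s ρ k * ‖h‖ := by
  rw [_root_.smul_apply, norm_smul, one_mul]
  exact mul_le_mul ((norm_char_le k hx).trans (exp_le_weight k)) (Hol.norm_val_le h y)
    (norm_nonneg _) (weight_pos _ _ _).le

/-- Evaluation at a point as a continuous linear map. -/
noncomputable def evalL {x : CVec m} (hx : x ∈ strip m ρ) (y : CVec m) :
    VF m s ρ a b →L[ℂ] CVec m :=
  lift (fun k => char k x • Hol.valL y) 1 (norm_char_smul_valL_le hx y)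

lemma evalL_apply {x : CVec m} (hx : x ∈ strip m ρ) (y : CVec m) (f : VF m s ρ a b) :
    evalL hx y f = f.eval (x, y) := rfl

lemma evalL_single {x : CVec m} (hx : x ∈ strip m ρ) (y : CVec m) (k : Fin (m + 1) → ℤ)
    (h : Coef m a b) : evalL hx y (single k h : VF m s ρ a b) = char k x • h.val y :=
  lift_single (hC := norm_char_smul_valL_le hx y) k h

lemma norm_eval_le {x : CVec m} (hx : x ∈ strip m ρ) (y : CVec m) (f : VF m s ρ a b) :
    ‖f.eval (x, y)‖ ≤ ‖f‖ :=
  (norm_lift_apply_le (hC := norm_char_smul_valL_le hx y) f).trans_eq (one_mul _)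

/-! ### Termwise derivatives in the x directions. -/

section deriv

lemma norm_two_pi_I_mul_dotL_le (k : Fin (m + 1) → ℤ) (v : CVec m) :
    ‖(2 * Real.pi * Complex.I * dotL k v : ℂ)‖ ≤ 2 * Real.pi * idxNorm k * ‖v‖ := by
  rw [norm_mul, norm_two_pi_I, mul_assoc (2 * Real.pi)]
  exact mul_le_mul_of_nonneg_left (norm_dotL_apply_le k v) (by positivity)

lemma norm_evalDeriv_term_le {x : CVec m} (hx : x ∈ strip m ρ) (y v : CVec m)
    (k : Fin (m + 1) → ℤ) (h : Coef m a b) :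
    ‖((2 * Real.pi * Complex.I * dotL k v * char k x) •
      (Hol.valL y : Coef m a b →L[ℂ] CVec m)) h‖ ≤ ‖v‖ * weight 1 ρ k * ‖h‖ := by
  have hk := idxNorm_nonneg k
  rw [_root_.smul_apply, norm_smul, norm_mul]
  calc _ ≤ (2 * Real.pi * idxNorm k * ‖v‖) * Real.exp (ρ * idxNorm k) * ‖h‖ :=
        mul_le_mul (mul_le_mul (norm_two_pi_I_mul_dotL_le k v) (norm_char_le k hx) (norm_nonneg _)
          (by positivity)) (Hol.norm_val_le h y) (norm_nonneg _) (by positivity)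
    _ = ‖v‖ * ((2 * Real.pi * idxNorm k) * Real.exp (ρ * idxNorm k)) * ‖h‖ := by ring
    _ ≤ _ := by
        rw [weight, pow_one]
        gcongr
        linarith

/-- The derivative of `f` at the point `(x, y)` in the direction `(v, 0)`. -/
noncomputable def evalDeriv {x : CVec m} (hx : x ∈ strip m ρ) (y v : CVec m) :
    𝒜' m ρ a b →L[ℂ] CVec m :=
  lift (fun k => (2 * Real.pi * Complex.I * dotL k v * char k x) • Hol.valL y) ‖v‖
    (norm_evalDeriv_term_le hx y v)

lemma evalDeriv_single {x : CVec m} (hx : x ∈ strip m ρ) (y v : CVec m) (k : Fin (m + 1) → ℤ)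
    (h : Coef m a b) : evalDeriv hx y v (single k h) =
      (2 * Real.pi * Complex.I * dotL k v * char k x) • h.val y :=
  lift_single (hC := norm_evalDeriv_term_le hx y v) k h

lemma norm_evalDeriv_le {x : CVec m} (hx : x ∈ strip m ρ) (y v : CVec m) (f : 𝒜' m ρ a b) :
    ‖evalDeriv hx y v f‖ ≤ ‖v‖ * ‖f‖ :=
  norm_lift_apply_le (hC := norm_evalDeriv_term_le hx y v) f

lemma hasDerivAt_eval {x : CVec m} (hx : x ∈ strip m ρ) (y v : CVec m) (f : 𝒜' m ρ a b) :
    HasDerivAt (fun z : ℂ => f.eval (x + z • v, y)) (evalDeriv hx y v f) 0 := by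
  have hc : ContinuousAt (fun z : ℂ => x + z • v) 0 := by fun_prop
  have hnear : ∀ᶠ z : ℂ in 𝓝 0, x + z • v ∈ strip m ρ :=
    hc.eventually ((isOpen_strip m ρ).mem_nhds (by simpa using hx))
  obtain ⟨r, hr, hball⟩ := Metric.eventually_nhds_iff_ball.1 hnear
  have h := hasDerivAt_tsum_of_isPreconnected (𝕜 := ℂ) (t := Metric.ball 0 r) (y₀ := 0) (y := 0)
    (g := fun k z => char k (x + z • v) • (f.coeff k).val y)
    (g' := fun k z => (2 * Real.pi * Complex.I * dotL k v * char k (x + z • v)) •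
      (f.coeff k).val y)
    (f.summable.mul_left ‖v‖) Metric.isOpen_ball (convex_ball (0 : ℂ) r).isPreconnected
    (fun k z _ => ?_)
    (fun k z hz => (norm_evalDeriv_term_le (hball z hz) y v k (f.coeff k)).trans_eq
      (mul_assoc _ _ _))
    (Metric.mem_ball_self hr) ?_ (Metric.mem_ball_self hr)
  · have hD : evalDeriv hx y v f = ∑' k, (2 * Real.pi * Complex.I * dotL k v *
        char k (x + (0 : ℂ) • v)) • (f.coeff k).val y := by
      rw [zero_smul, add_zero]
      rfl
    rw [hD]
    exact h
  · refine HasDerivAt.smul_const ?_ _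
    have h1 : HasDerivAt (fun z : ℂ => 2 * Real.pi * Complex.I * dotL k (x + z • v))
        (2 * Real.pi * Complex.I * dotL k v) z := by
      refine HasDerivAt.const_mul _ ?_
      have := ((hasDerivAt_id z).smul_const v).const_add x
      rw [one_smul] at this
      exact (dotL k).hasFDerivAt.comp_hasDerivAt z this
    exact h1.cexp.congr_deriv (mul_comm _ _)
  · have : x + (0 : ℂ) • v ∈ strip m ρ := by simpa using hx
    exact Summable.of_norm_bounded f.summable fun k =>
      (norm_char_smul_valL_le this y k (f.coeff k)).trans_eq (by rw [one_mul])

end deriv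

/-- The partial sums are holomorphic and converge uniformly on the domain, since the norm majorizes
the series. -/
lemma differentiableOn_eval (f : VF m s ρ a b) :
    DifferentiableOn ℂ f.eval (strip m ρ ×ˢ polyball m a b) := by
  have hΩ := (isOpen_strip m ρ).prod (isOpen_polyball m a b)
  have h := tendstoUniformlyOn_tsum (s := strip m ρ ×ˢ polyball m a b)
    (f := fun k (p : CVec m × CVec m) => char k p.1 • (f.coeff k).val p.2) f.summable
    fun k p hp => (norm_char_smul_valL_le hp.1 p.2 k (f.coeff k)).trans_eq (by rw [one_mul])
  refine differentiableOn_of_tendstoUniformlyOn hΩ h fun S => ?_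
  refine DifferentiableOn.fun_sum fun k _ => DifferentiableOn.fun_smul ?_ ?_
  · have h1 : Differentiable ℂ fun p : CVec m × CVec m =>
        2 * Real.pi * Complex.I * dotL k p.1 := by fun_prop
    exact h1.cexp.differentiableOn
  · exact (f.coeff k).differentiableOn_val.comp differentiableOn_snd fun p hp => hp.2

/-! ### The abstract operators as pointwise operations on functions. -/

section pointwise

variable {x y : CVec m} (hρ : 0 ≤ ρ)

lemma eval_phase (hx : x ∈ strip m ρ) (hy : y ∈ closure (polyball m a b)) (k : Fin (m + 1) → ℤ)
    (u : 𝒜' m ρ a b) (v : 𝒜 m ρ a b) : evalL hx y (phase hρ k u v) =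
      (2 * Real.pi * Complex.I * dotL k (u.eval (x, y))) • evalL hx y v := by
  have h1 : ∀ j (h : Coef m a b), (evalL hx y).comp (phase hρ k (single j h)) =
      (pairing k (evalL hx y (single j h : 𝒜' m ρ a b))).comp (evalL hx y) := fun j h =>
    clm_ext fun l g => by
      rw [ContinuousLinearMap.comp_apply, ContinuousLinearMap.comp_apply, phase_single_single,
        evalL_single, evalL_single, evalL_single, Hol.val_bilin _ _ _ hy, map_smul, map_smul,
        _root_.smul_apply, char_add_index, mul_smul, smul_comm]
  have h2 : (evalL hx y).comp ((phase hρ k).flip v) =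
      ((pairing k).flip (evalL hx y v)).comp (evalL hx y) :=
    clm_ext fun j h => DFunLike.congr_fun (h1 j h) v
  exact DFunLike.congr_fun h2 u

lemma eval_advect (hx : x ∈ strip m ρ) (hy : y ∈ closure (polyball m a b))
    (u : 𝒜' m ρ a b) (v : 𝒜 m ρ a b) : evalL hx y (advect hρ u v) =
      evalDeriv hx y (evalL hx y v) u := by
  have h1 : ∀ j (h : Coef m a b), (evalL hx y).comp (advect hρ (single j h)) =
      ((char j x) • ((pairing j).flip (h.val y))).comp (evalL hx y) := fun j h =>
    clm_ext fun l g => by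
      rw [ContinuousLinearMap.comp_apply, ContinuousLinearMap.comp_apply, advect_single_single,
        evalL_single, evalL_single, Hol.val_bilin _ _ _ hy, map_smul, _root_.smul_apply,
        ContinuousLinearMap.flip_apply, char_add_index, mul_comm, mul_smul]
  have h2 : (evalL hx y).comp ((advect hρ).flip v) = evalDeriv hx y (evalL hx y v) :=
    clm_ext fun j h => by
      refine (DFunLike.congr_fun (h1 j h) v).trans ?_
      rw [evalDeriv_single, ContinuousLinearMap.comp_apply, _root_.smul_apply,
        ContinuousLinearMap.flip_apply, pairing_apply, smul_smul, mul_comm]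
  exact DFunLike.congr_fun h2 u

/-- Evaluation intertwines `phase` with multiplication by a scalar, hence also its powers and the
exponential series. -/
lemma eval_expPhase (hx : x ∈ strip m ρ) (hy : y ∈ closure (polyball m a b))
    (k : Fin (m + 1) → ℤ) (u : 𝒜' m ρ a b) (v : 𝒜 m ρ a b) :
    evalL hx y (expPhase hρ k u v) = char k (u.eval (x, y)) • evalL hx y v := by
  set c : ℂ := 2 * Real.pi * Complex.I * dotL k (u.eval (x, y)) with hc
  have hpow : ∀ n : ℕ, evalL hx y ((phase hρ k u ^ n) v) = c ^ n • evalL hx y v := fun n => by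
    induction n with
    | zero => simp
    | succ n ih =>
      rw [pow_succ' c, mul_smul, ← ih, ← eval_phase hρ hx hy, pow_succ']
      rfl
  have h1 := ((NormedSpace.exp_series_hasSum_exp' (𝕂 := ℂ) (phase hρ k u)).mapL
    ((ContinuousLinearMap.apply ℂ (𝒜 m ρ a b) v))).mapL (evalL hx y)
  have h2 := (NormedSpace.exp_series_hasSum_exp' (𝕂 := ℂ) c).smul_const (evalL hx y v)
  rw [← Complex.exp_eq_exp_ℂ] at h2
  refine h1.unique ?_
  change HasSum _ (Complex.exp c • _)
  convert h2 using 1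
  funext n
  rw [ContinuousLinearMap.apply_apply, _root_.smul_apply, map_smul, hpow, smul_assoc]

lemma eval_comp (hx : x ∈ strip m ρ) (hy : y ∈ closure (polyball m a b)) {u : 𝒜' m ρ a b}
    (hu : 2 * Real.pi * ‖u‖ ≤ ν) (f : 𝒜' m (ρ + ν) a b) :
    evalL hx y (comp hρ u f) = f.eval (shift u (x, y)) := by
  have h := (hasSum_comp hρ hu f).mapL (evalL hx y)
  refine h.tsum_eq.symm.trans (tsum_congr fun k => ?_)
  rw [eval_expPhase hρ hx hy, evalL_single, smul_smul, mul_comm, ← char_add]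
  rfl

end pointwise

/-! ### The shift as a diffeomorphism, and the pull-back under it. -/

section shift

variable {u : 𝒜' m ρ a b}

lemma hasFDerivAt_eval (u : VF m s ρ a b) {p : CVec m × CVec m}
    (hp : p ∈ strip m ρ ×ˢ polyball m a b) : HasFDerivAt u.eval (fderiv ℂ u.eval p) p :=
  ((differentiableOn_eval u p hp).differentiableAt
    (((isOpen_strip m ρ).prod (isOpen_polyball m a b)).mem_nhds hp)).hasFDerivAt

lemma fderiv_eval_fst (u : 𝒜' m ρ a b) {p : CVec m × CVec m}
    (hp : p ∈ strip m ρ ×ˢ polyball m a b) (v : CVec m) :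
    fderiv ℂ u.eval p (v, 0) = evalDeriv hp.1 p.2 v u := by
  have h1 : HasDerivAt (fun z : ℂ => (p.1 + z • v, p.2)) (v, 0) 0 := by
    have := ((hasDerivAt_id (0 : ℂ)).smul_const v).const_add p.1
    rw [one_smul] at this
    exact this.prodMk (hasDerivAt_const _ _)
  have h2 : HasFDerivAt u.eval (fderiv ℂ u.eval p) (p.1 + (0 : ℂ) • v, p.2) := by
    simpa using hasFDerivAt_eval u hp
  have h3 : HasDerivAt (fun z : ℂ => u.eval (p.1 + z • v, p.2)) (fderiv ℂ u.eval p (v, 0)) 0 :=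
    HasFDerivAt.comp_hasDerivAt (l := u.eval) (f := fun z : ℂ => (p.1 + z • v, p.2)) 0 h2 h1
  exact h3.unique (hasDerivAt_eval hp.1 p.2 v u)

lemma hasFDerivAt_shift (u : 𝒜' m ρ a b) {p : CVec m × CVec m}
    (hp : p ∈ strip m ρ ×ˢ polyball m a b) : HasFDerivAt (shift u)
      ((ContinuousLinearMap.fst ℂ (CVec m) (CVec m) + fderiv ℂ u.eval p).prod
        (ContinuousLinearMap.snd ℂ (CVec m) (CVec m))) p :=
  (hasFDerivAt_fst.add (hasFDerivAt_eval u hp)).prodMk hasFDerivAt_snd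

lemma norm_eval_sub_eval_le (u : 𝒜' m ρ a b) {x x' y : CVec m} (hx : x ∈ strip m ρ)
    (hx' : x' ∈ strip m ρ) (hy : y ∈ polyball m a b) :
    ‖u.eval (x, y) - u.eval (x', y)‖ ≤ ‖u‖ * ‖x - x'‖ := by
  have hD : ∀ z ∈ strip m ρ, HasFDerivAt (fun x => u.eval (x, y))
      ((fderiv ℂ u.eval (z, y)).comp (ContinuousLinearMap.inl ℂ (CVec m) (CVec m))) z :=
    fun z hz => (hasFDerivAt_eval u (p := (z, y)) ⟨hz, hy⟩).comp z (f := fun z => (z, y))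
      (hasFDerivAt_prodMk_left z y)
  refine (convex_strip m ρ).norm_image_sub_le_of_norm_hasFDerivWithin_le (𝕜 := ℂ)
    (fun z hz => (hD z hz).hasFDerivWithinAt) (fun z hz => ?_) hx' hx
  refine ContinuousLinearMap.opNorm_le_bound _ (norm_nonneg _) fun v => ?_
  rw [ContinuousLinearMap.comp_apply, ContinuousLinearMap.inl_apply,
    fderiv_eval_fst u (p := (z, y)) ⟨hz, hy⟩, mul_comm]
  exact norm_evalDeriv_le _ _ _ _

/-- The derivative is block triangular. A kernel vector (v, 0) satisfies v = -D_x u v, so ‖v‖ ≤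
‖u‖‖v‖ forces v = 0; in finite dimension injectivity is enough. -/
lemma exists_equiv_fderiv_shift (hu : ‖u‖ < 1) {p : CVec m × CVec m}
    (hp : p ∈ strip m ρ ×ˢ polyball m a b) :
    ∃ A : (CVec m × CVec m) ≃L[ℂ] (CVec m × CVec m), fderiv ℂ (shift u) p = A := by
  rw [(hasFDerivAt_shift u hp).fderiv]
  set L := (ContinuousLinearMap.fst ℂ (CVec m) (CVec m) + fderiv ℂ u.eval p).prod
    (ContinuousLinearMap.snd ℂ (CVec m) (CVec m)) with hL
  have hinj : Function.Injective (L : (CVec m × CVec m) →ₗ[ℂ] (CVec m × CVec m)) := by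
    refine (injective_iff_map_eq_zero _).2 fun q hq => ?_
    obtain ⟨v, w⟩ := q
    have h1 : v + fderiv ℂ u.eval p (v, w) = 0 := congrArg Prod.fst hq
    have h2 : w = 0 := congrArg Prod.snd hq
    subst h2
    rw [fderiv_eval_fst u hp] at h1
    have h3 := norm_evalDeriv_le hp.1 p.2 v u
    rw [← neg_eq_of_add_eq_zero_right h1, norm_neg] at h3
    have h4 : ‖v‖ = 0 := by nlinarith [norm_nonneg v]
    rw [norm_eq_zero.1 h4]
    rfl
  exact ⟨(LinearEquiv.ofInjectiveEndo _ hinj).toContinuousLinearEquiv, by ext <;> rfl⟩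

lemma injOn_shift (hu : ‖u‖ < 1) : InjOn (shift u) (strip m ρ ×ˢ polyball m a b) := by
  rintro ⟨x, y⟩ hp ⟨x', y'⟩ hp' h
  have h2 : y = y' := congrArg Prod.snd h
  subst h2
  have h1 : x + u.eval (x, y) = x' + u.eval (x', y) := congrArg Prod.fst h
  have h3 := norm_eval_sub_eval_le u hp.1 hp'.1 hp.2
  have h4 : u.eval (x, y) - u.eval (x', y) = -(x - x') := by
    linear_combination (norm := module) h1
  rw [h4, norm_neg] at h3
  have h5 : ‖x - x'‖ = 0 := by nlinarith [norm_nonneg (x - x')]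
  rw [sub_eq_zero.1 (norm_eq_zero.1 h5)]

lemma isAnalyticDiffeoOn_shift (hu : ‖u‖ < 1) :
    IsAnalyticDiffeoOn (shift u) (strip m ρ ×ˢ polyball m a b) := by
  have hd : DifferentiableOn ℂ (shift u) (strip m ρ ×ˢ polyball m a b) := fun p hp =>
    (hasFDerivAt_shift u hp).differentiableAt.differentiableWithinAt
  exact ⟨hd, isOpen_image_and_exists_inverse ((isOpen_strip m ρ).prod (isOpen_polyball m a b)) hd
    (injOn_shift hu) fun p hp => exists_equiv_fderiv_shift hu hp⟩

lemma mapsTo_shift (hu : ‖u‖ ≤ ν / (2 * Real.pi)) :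
    MapsTo (shift u) (strip m ρ ×ˢ polyball m a b) (strip m (ρ + ν) ×ˢ polyball m a b) := by
  rintro ⟨x, y⟩ ⟨hx, hy⟩
  refine ⟨?_, hy⟩
  have hx' : ∑ i, |(x i).im| < ρ / (2 * Real.pi) := hx
  have h1 := (norm_eval_le hx y u).trans hu
  rw [PiLp.norm_eq_of_L1] at h1
  change ∑ i, |((x + u.eval (x, y)) i).im| < (ρ + ν) / (2 * Real.pi)
  have h2 : ∑ i, |((x + u.eval (x, y)) i).im| ≤ ∑ i, |(x i).im| + ∑ i, ‖u.eval (x, y) i‖ := by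
    rw [← Finset.sum_add_distrib]
    refine Finset.sum_le_sum fun i _ => ?_
    rw [PiLp.add_apply, Complex.add_im]
    exact (abs_add_le _ _).trans (by gcongr; exact Complex.abs_im_le_norm _)
  rw [add_div]
  linarith

/-- Applying the derivative of the shift to both sides leaves the conjugacy relation in x and 0 = 0
in y. -/
lemma fullField_eq_pullback (hu : ‖u‖ < 1) {X : VF m s (ρ + ν) a b} {Y : 𝒜 m ρ a b}
    {p : CVec m × CVec m} (hp : p ∈ strip m ρ ×ˢ polyball m a b)
    (h : Y.eval p + evalDeriv hp.1 p.2 (Y.eval p) u = X.eval (shift u p)) :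
    fullField Y p = VectorField.pullback ℂ (shift u) (fullField X) p := by
  obtain ⟨A, hA⟩ := exists_equiv_fderiv_shift hu hp
  rw [VectorField.pullback, hA, ContinuousLinearMap.inverse_equiv, ContinuousLinearEquiv.coe_coe,
    ContinuousLinearEquiv.eq_symm_apply, ← ContinuousLinearEquiv.coe_coe, ← hA,
    (hasFDerivAt_shift u hp).fderiv, fullField, fullField, ← h]
  rw [← fderiv_eval_fst u hp]
  rfl

end shift

end TorusVF

namespace TorusVF

/-! ### Reality -/

open TorusVF.Fourier
open scoped ComplexConjugate

variable {m s : ℕ} {ρ ν a b : ℝ}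

lemma mFourier_coe (k : Fin (m + 1) → ℤ) (x : Fin (m + 1) → ℝ) :
    UnitAddTorus.mFourier k (fun i => (x i : UnitAddCircle)) =
      char k (WithLp.toLp 1 fun i => (x i : ℂ)) := by
  rw [char, dotL_apply]
  change ∏ i, fourier (k i) (x i : UnitAddCircle) = _
  simp only [fourier_coe_apply]
  rw [← Complex.exp_sum, Finset.mul_sum]
  congr 1
  refine Finset.sum_congr rfl fun i _ => ?_
  push_cast
  ring

/-- Uniqueness of Fourier coefficients for absolutely convergent series. -/
lemma eq_zero_of_tsum_char_eq_zero {c : (Fin (m + 1) → ℤ) → ℂ} (hc : Summable fun k => ‖c k‖)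
    (h : ∀ x : Fin (m + 1) → ℝ, ∑' k, c k * char k (WithLp.toLp 1 fun i => (x i : ℂ)) = 0) :
    c = 0 := by
  have hs : Summable fun k => c k • (UnitAddTorus.mFourier k : C(UnitAddTorus (Fin (m + 1)), ℂ)) :=
    .of_norm (by simpa [norm_smul, UnitAddTorus.mFourier_norm] using hc)
  have h0 : ∑' k, c k • (UnitAddTorus.mFourier k : C(UnitAddTorus (Fin (m + 1)), ℂ)) = 0 := by
    ext t
    obtain ⟨x, rfl⟩ : ∃ x : Fin (m + 1) → ℝ, (fun i => (x i : UnitAddCircle)) = t := by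
      choose x hx using fun i => QuotientAddGroup.mk_surjective (t i)
      exact ⟨x, funext hx⟩
    rw [← ContinuousMap.tsum_apply hs]
    simpa [mFourier_coe] using h x
  have h1 := hs.hasSum.mapL (ContinuousMap.toLp (E := ℂ) 2
    (MeasureTheory.Measure.pi fun _ : Fin (m + 1) => AddCircle.haarAddCircle (T := 1)) ℂ)
  rw [h0, map_zero] at h1
  funext j
  have h2 := (innerSL ℂ (UnitAddTorus.mFourierLp (d := Fin (m + 1)) 2 j)).hasSum h1
  rw [map_zero] at h2
  have h3 : ∀ k, innerSL ℂ (UnitAddTorus.mFourierLp (d := Fin (m + 1)) 2 j)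
      (ContinuousMap.toLp (E := ℂ) 2
        (MeasureTheory.Measure.pi fun _ : Fin (m + 1) => AddCircle.haarAddCircle (T := 1)) ℂ
        (c k • (UnitAddTorus.mFourier k : C(UnitAddTorus (Fin (m + 1)), ℂ)))) =
        if k = j then c j else 0 := fun k => by
    rw [map_smul, innerSL_apply_apply, inner_smul_right]
    have := orthonormal_iff_ite.1 (UnitAddTorus.orthonormal_mFourier (d := Fin (m + 1))) j k
    rw [UnitAddTorus.mFourierLp, UnitAddTorus.mFourierLp] at this
    refine (congrArg (c k * ·) this).trans ?_
    by_cases hk : k = j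
    · simp [hk]
    · simp [hk, Ne.symm hk]
  simp only [h3] at h2
  exact (hasSum_ite_eq j (c j)).unique h2

lemma char_neg {x : CVec m} (hx : ∀ i, (x i).im = 0) (k : Fin (m + 1) → ℤ) :
    char (-k) x = conj (char k x) := by
  have : conj (dotL k x) = dotL k x := by
    rw [dotL_apply, map_sum]
    exact Finset.sum_congr rfl fun i _ => by
      rw [map_mul, Complex.conj_eq_iff_im.2 (hx i), map_intCast]
  rw [char, char, ← Complex.exp_conj]
  congr 1
  simp only [map_mul, this, Complex.conj_I, Complex.conj_ofReal, map_ofNat]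
  rw [dotL_apply, dotL_apply, Finset.mul_sum, Finset.mul_sum]
  exact Finset.sum_congr rfl fun i _ => by rw [Pi.neg_apply]; push_cast; ring

lemma conj_two_pi_I_mul_dotL {v : CVec m} (hv : ∀ i, (v i).im = 0) (k : Fin (m + 1) → ℤ) :
    2 * Real.pi * Complex.I * dotL (-k) v = conj (2 * Real.pi * Complex.I * dotL k v) := by
  have : conj (dotL k v) = dotL k v := by
    rw [dotL_apply, map_sum]
    exact Finset.sum_congr rfl fun i _ => by
      rw [map_mul, Complex.conj_eq_iff_im.2 (hv i), map_intCast]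
  simp only [map_mul, this, Complex.conj_I, Complex.conj_ofReal, map_ofNat]
  rw [dotL_apply, dotL_apply, Finset.mul_sum, Finset.mul_sum]
  exact Finset.sum_congr rfl fun i _ => by rw [Pi.neg_apply]; push_cast; ring

lemma im_tsum_eq_zero {g : (Fin (m + 1) → ℤ) → CVec m} (hg : Summable g)
    (h : ∀ k i, g (-k) i = conj (g k i)) (i : Fin (m + 1)) : ((∑' k, g k) i).im = 0 := by
  have h1 := hg.hasSum.mapL (PiLp.proj (𝕜 := ℂ) 1 (fun _ : Fin (m + 1) => ℂ) i)
  simp only [PiLp.proj_apply] at h1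
  rw [← Complex.conj_eq_iff_im]
  have h2 : HasSum (fun k => conj (g k i)) (conj ((∑' k, g k) i)) :=
    Complex.hasSum_conj'.2 h1
  have h3 : HasSum (fun k => g (-k) i) ((∑' k, g k) i) :=
    ((Equiv.neg (Fin (m + 1) → ℤ)).hasSum_iff (f := fun k => g k i)).2 h1
  simp only [h] at h3
  exact h2.unique h3

lemma mem_strip_of_im_eq_zero (hρ : 0 < ρ) {x : CVec m} (hx : ∀ i, (x i).im = 0) :
    x ∈ strip m ρ := by
  change ∑ i, |(x i).im| < ρ / (2 * Real.pi)
  simp only [hx, abs_zero, Finset.sum_const_zero]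
  positivity

lemma summable_eval (f : VF m s ρ a b) {x : CVec m} (hx : x ∈ strip m ρ) (y : CVec m) :
    Summable fun k => char k x • (f.coeff k).val y :=
  .of_norm_bounded f.summable fun k =>
    (norm_char_smul_valL_le hx y k (f.coeff k)).trans_eq (by rw [one_mul])

/-- The coefficients of a real absolutely convergent Fourier series are conjugation symmetric. -/
lemma coeff_neg_eq_conj {g : (Fin (m + 1) → ℤ) → ℂ} (hg : Summable fun k => ‖g k‖)
    (h : ∀ x : Fin (m + 1) → ℝ, ∃ r : ℝ,
      HasSum (fun k => char k (WithLp.toLp 1 fun i => (x i : ℂ)) * g k) r)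
    (k : Fin (m + 1) → ℤ) : g (-k) = conj (g k) := by
  have hs2 : Summable fun k => ‖conj (g (-k))‖ := by
    simp only [RCLike.norm_conj]
    exact ((Equiv.neg (Fin (m + 1) → ℤ)).summable_iff (f := fun k => ‖g k‖)).2 hg
  have hs3 : Summable fun k => ‖g k - conj (g (-k))‖ :=
    (hg.add hs2).of_nonneg_of_le (fun _ => norm_nonneg _) fun _ => norm_sub_le _ _
  -- The sum minus its conjugate vanishes; reindexing the conjugate by k ↦ -k writes this as one
  -- absolutely convergent series, to which uniqueness applies.
  have h0 := eq_zero_of_tsum_char_eq_zero hs3 fun x => by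
    obtain ⟨r, h1⟩ := h x
    have h2 := Complex.hasSum_conj'.2 h1
    have h3 := (Equiv.neg (Fin (m + 1) → ℤ)).hasSum_iff.2 h2
    have h4 := h1.sub h3
    refine (tsum_congr fun k => ?_).trans (h4.tsum_eq.trans ?_)
    · change _ = _ - conj (char (-k) _ * g (-k))
      rw [map_mul, char_neg fun i => Complex.ofReal_im _, Complex.conj_conj]
      ring
    · change (r : ℂ) - conj (r : ℂ) = 0
      rw [Complex.conj_ofReal, sub_self]
  have h1 := congrFun h0 (-k)
  rw [neg_neg] at h1
  exact sub_eq_zero.1 h1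

/-- A field is real if and only if its Fourier coefficients are conjugation symmetric. -/
lemma isRealVF_iff (hρ : 0 < ρ) (f : VF m s ρ a b) : IsRealVF f ↔
    ∀ k, ∀ y ∈ polyball m a b, (∀ i, (y i).im = 0) → ∀ i,
      (f.coeff (-k)).val y i = conj ((f.coeff k).val y i) := by
  constructor
  · intro hf k y hy hyr i
    have hw : ∀ k : Fin (m + 1) → ℤ, 1 ≤ weight s ρ k := fun k =>
      (Real.one_le_exp (mul_nonneg hρ.le (idxNorm_nonneg k))).trans (exp_le_weight k)
    have hle : ∀ k, ‖(f.coeff k).val y i‖ ≤ weight s ρ k * ‖f.coeff k‖ := fun k =>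
      ((PiLp.norm_apply_le _ i).trans (Hol.norm_val_le _ y)).trans
        (le_mul_of_one_le_left (norm_nonneg _) (hw k))
    have hs1 : Summable fun k => ‖(f.coeff k).val y i‖ :=
      .of_nonneg_of_le (fun _ => norm_nonneg _) hle f.summable
    refine coeff_neg_eq_conj (g := fun k => (f.coeff k).val y i) hs1 (fun x => ?_) k
    have hxr : ∀ j, ((WithLp.toLp 1 fun i => (x i : ℂ) : CVec m) j).im = 0 :=
      fun _ => Complex.ofReal_im _
    have hx := mem_strip_of_im_eq_zero hρ hxr
    have h1 := (summable_eval f hx y).hasSum.mapL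
      (PiLp.proj (𝕜 := ℂ) 1 (fun _ : Fin (m + 1) => ℂ) i)
    have h2 := hf (WithLp.toLp 1 fun i => (x i : ℂ), y) ⟨hx, hy⟩ (fun i => ⟨hxr i, hyr i⟩) i
    refine ⟨(f.eval (WithLp.toLp 1 fun i => (x i : ℂ), y) i).re, ?_⟩
    rw [Complex.conj_eq_iff_re.1 (Complex.conj_eq_iff_im.2 h2)]
    exact h1
  · intro h p hp hpr i
    refine im_tsum_eq_zero (summable_eval f hp.1 p.2) (fun k i => ?_) i
    change char (-k) p.1 * (f.coeff (-k)).val p.2 i = conj (char k p.1 * (f.coeff k).val p.2 i)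
    rw [map_mul, char_neg fun i => (hpr i).1, h k p.2 hp.2 (fun i => (hpr i).2) i]

lemma IsRealVF.sub {f g : VF m s ρ a b} (hf : IsRealVF f) (hg : IsRealVF g) :
    IsRealVF (f - g) := fun p hp hpr i => by
  have h := map_sub (evalL hp.1 p.2) f g
  simp only [evalL_apply] at h
  rw [h, PiLp.sub_apply, Complex.sub_im, hf p hp hpr i, hg p hp hpr i, sub_zero]

lemma IsRealVF.add {f g : VF m s ρ a b} (hf : IsRealVF f) (hg : IsRealVF g) :
    IsRealVF (f + g) := fun p hp hpr i => by
  have h := map_add (evalL hp.1 p.2) f g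
  simp only [evalL_apply] at h
  rw [h, PiLp.add_apply, Complex.add_im, hf p hp hpr i, hg p hp hpr i, add_zero]

lemma IsRealVF.smul {f : VF m s ρ a b} (hf : IsRealVF f) (t : ℝ) :
    IsRealVF ((t : ℂ) • f) := fun p hp hpr i => by
  have h := map_smul (evalL hp.1 p.2) (t : ℂ) f
  simp only [evalL_apply] at h
  rw [h, PiLp.smul_apply, smul_eq_mul, Complex.im_ofReal_mul, hf p hp hpr i, mul_zero]

lemma IsRealVF.of_tendsto {f : ℕ → VF m s ρ a b} {g : VF m s ρ a b}
    (hfg : Tendsto f atTop (𝓝 g)) (hf : ∀ n, IsRealVF (f n)) : IsRealVF g := fun p hp hpr i => by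
  have h1 : Tendsto (fun n => (f n).eval p) atTop (𝓝 (g.eval p)) := by
    simp only [← evalL_apply hp.1]
    exact ((evalL hp.1 p.2).continuous.tendsto g).comp hfg
  have h2 : Tendsto (fun n => (f n).eval p i) atTop (𝓝 (g.eval p i)) :=
    ((PiLp.continuous_apply 1 (fun _ : Fin (m + 1) => ℂ) i).tendsto _).comp h1
  have h3 : Tendsto (fun n => ((f n).eval p i).im) atTop (𝓝 (g.eval p i).im) :=
    (Complex.continuous_im.tendsto _).comp h2
  simp only [hf _ p hp hpr i] at h3
  exact tendsto_nhds_unique h3 tendsto_const_nhds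

lemma IsRealVF.incl {s' : ℕ} {ρ' : ℝ} (hs : s' ≤ s) (hρ : ρ' ≤ ρ) {f : VF m s ρ a b}
    (hf : IsRealVF f) : IsRealVF (Fourier.incl hs hρ f : VF m s' ρ' a b) := fun p hp hpr i =>
  have h : VF.eval (m := m) (s := s') (ρ := ρ') (Fourier.incl hs hρ f) p = f.eval p := by
    unfold VF.eval
    exact tsum_congr fun k => by rw [coeff_incl]
  (congrArg (fun w : CVec m => (w i).im) h).trans
    (hf p ⟨lt_of_lt_of_le hp.1 (div_le_div_of_nonneg_right hρ (by positivity)), hp.2⟩ hpr i)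

lemma im_evalDeriv (hρ : 0 < ρ) {u : 𝒜' m ρ a b} (hu : IsRealVF u) {x y v : CVec m}
    (hx : x ∈ strip m ρ) (hy : y ∈ polyball m a b) (hxr : ∀ i, (x i).im = 0)
    (hyr : ∀ i, (y i).im = 0) (hv : ∀ i, (v i).im = 0) (i : Fin (m + 1)) :
    (evalDeriv hx y v u i).im = 0 := by
  have hs : Summable fun k => (2 * Real.pi * Complex.I * dotL k v * char k x) •
      (u.coeff k).val y :=
    .of_norm_bounded (u.summable.mul_left ‖v‖) fun k =>
      (norm_evalDeriv_term_le hx y v k (u.coeff k)).trans_eq (mul_assoc _ _ _)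
  refine im_tsum_eq_zero hs (fun k i => ?_) i
  rw [PiLp.smul_apply, PiLp.smul_apply, smul_eq_mul, smul_eq_mul, map_mul,
    (isRealVF_iff hρ u).1 hu k y hy hyr i, map_mul, char_neg hxr, conj_two_pi_I_mul_dotL hv]

lemma shift_mem_realPoints {u : 𝒜' m ρ a b} (hu : IsRealVF u) {p : CVec m × CVec m}
    (hp : p ∈ strip m ρ ×ˢ polyball m a b) (hpr : p ∈ realPoints m) :
    shift u p ∈ realPoints m := fun i =>
  ⟨by
    change ((p.1 + u.eval p) i).im = 0
    rw [PiLp.add_apply, Complex.add_im, (hpr i).1, hu p hp hpr i, add_zero], (hpr i).2⟩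

/-- If `v + D v` is real, where `D` is a real contraction, then `v` is real. -/
lemma im_eq_zero_of_add_fderiv {u : 𝒜' m ρ a b} (hρ : 0 < ρ) (hu : IsRealVF u) (hu1 : ‖u‖ < 1)
    {p : CVec m × CVec m} (hp : p ∈ strip m ρ ×ˢ polyball m a b) (hpr : p ∈ realPoints m)
    {v : CVec m} (h : ∀ i, ((v + evalDeriv hp.1 p.2 v u) i).im = 0) (i : Fin (m + 1)) :
    (v i).im = 0 := by
  set v₁ : CVec m := WithLp.toLp 1 fun i => ((v i).re : ℂ) with hv₁
  set v₂ : CVec m := WithLp.toLp 1 fun i => ((v i).im : ℂ) with hv₂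
  have hv : v = v₁ + Complex.I • v₂ := by
    ext i
    change v i = ((v i).re : ℂ) + Complex.I * ((v i).im : ℂ)
    rw [mul_comm, Complex.re_add_im]
  have hD : evalDeriv hp.1 p.2 v u = evalDeriv hp.1 p.2 v₁ u +
      Complex.I • evalDeriv hp.1 p.2 v₂ u := by
    rw [← fderiv_eval_fst u hp, ← fderiv_eval_fst u hp, ← fderiv_eval_fst u hp, ← map_smul,
      ← map_add]
    congr 1
    ext1
    · exact hv
    · simp
  have r1 := im_evalDeriv hρ hu hp.1 hp.2 (fun i => (hpr i).1) (fun i => (hpr i).2)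
    (v := v₁) fun i => Complex.ofReal_im _
  have r2 := im_evalDeriv hρ hu hp.1 hp.2 (fun i => (hpr i).1) (fun i => (hpr i).2)
    (v := v₂) fun i => Complex.ofReal_im _
  -- Imaginary parts of the hypothesis: `v₂` lies in the kernel of 1 + D, which is trivial as D is a
  -- contraction.
  have h2 : v₂ = -evalDeriv hp.1 p.2 v₂ u := by
    ext i
    have h3 := h i
    rw [hD, PiLp.add_apply, PiLp.add_apply, PiLp.smul_apply, smul_eq_mul, Complex.add_im,
      Complex.add_im, r1 i, Complex.I_mul_im, zero_add] at h3
    rw [PiLp.neg_apply]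
    refine Complex.ext ?_ ?_
    · change (v i).im = _
      rw [Complex.neg_re]
      linarith
    · rw [Complex.neg_im, r2 i]
      simp [hv₂]
  have h3 := norm_evalDeriv_le hp.1 p.2 v₂ u
  rw [← norm_neg, ← h2] at h3
  have h4 : ‖v₂‖ = 0 := by nlinarith [norm_nonneg v₂]
  have h5 : v₂ i = 0 := by rw [norm_eq_zero.1 h4]; rfl
  exact Complex.ofReal_eq_zero.1 h5

/-! ### Reality of the solution of the homotopy equation. -/

namespace HomotopyData

variable (d : HomotopyData m ρ ν a b) {X : 𝒜' m (ρ + ν) a b} {u : 𝒜' m ρ a b}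

lemma coeff_linv (g : 𝒜 m ρ a b) (k : Fin (m + 1) → ℤ) :
    (d.linv g).coeff k = d.divFreq k (g.coeff k) := by
  have : (coeffL k).comp d.linv = (d.divFreq k).comp (coeffL k) := clm_ext fun j h => by
    rw [ContinuousLinearMap.comp_apply, ContinuousLinearMap.comp_apply, linv_single, coeffL_apply,
      coeffL_apply, coeff_single, coeff_single]
    split_ifs with hk
    · rw [hk]
    · rw [map_zero]
  exact DFunLike.congr_fun this g

/-- The modes in `I` come in pairs and `N` is real at real points. -/
structure IsReal : Prop where
  neg_mem : ∀ k ∈ d.I, -k ∈ d.I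
  im_N : ∀ y ∈ polyball m a b, (∀ i, (y i).im = 0) → ∀ i, (d.N.val y i).im = 0

/-- The conjugacy equation `Y + Du Y = X ∘ U` for the pull-back `Y` of `X`. -/
lemma eval_pull_add (X : 𝒜' m (ρ + ν) a b) (hu1 : ‖u‖ ≤ d.δ) {p : CVec m × CVec m}
    (hp : p ∈ strip m ρ ×ˢ polyball m a b) :
    (d.pull X u).eval p + evalDeriv hp.1 p.2 ((d.pull X u).eval p) u = X.eval (shift u p) := by
  have h := congrArg (evalL hp.1 p.2) (d.pull_add_advect_pull X (d.norm_lt_one hu1))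
  rwa [map_add, eval_advect _ hp.1 (subset_closure hp.2),
    eval_comp _ hp.1 (subset_closure hp.2) (d.two_pi_mul_norm_lt hu1).le] at h

lemma isRealVF_pull (hρ : 0 < ρ) (hX : IsRealVF X) (hu : IsRealVF u) (hu1 : ‖u‖ ≤ d.δ) :
    IsRealVF (d.pull X u) := by
  intro p hp hpr i
  refine im_eq_zero_of_add_fderiv hρ hu (d.norm_lt_one hu1) hp hpr (fun i => ?_) i
  have hmem : shift u p ∈ strip m (ρ + ν) ×ˢ polyball m a b :=
    ⟨mem_strip_of_im_eq_zero (by linarith [d.ν_pos]) fun i => (shift_mem_realPoints hu hp hpr i).1,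
      hp.2⟩
  exact (congrArg (fun w : CVec m => (w i).im) (d.eval_pull_add X hu1 hp)).trans
    (hX _ hmem (shift_mem_realPoints hu hp hpr) i)

variable {d} (hd : d.IsReal) (hρ : 0 < ρ)

include hd hρ

/-- `linv` is defined on coefficients, so reality is tested as conjugation symmetry, which survives
division because `freq (-k)` is the conjugate of `freq k` where `N` is real. -/
lemma IsReal.linv {g : 𝒜 m ρ a b} (hg : IsRealVF g) : IsRealVF (d.linv g) := by
  rw [isRealVF_iff hρ] at hg ⊢
  intro k y hy hyr i
  rw [coeff_linv, coeff_linv]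
  by_cases hk : k ∈ d.I
  · rw [d.val_divFreq hk _ (subset_closure hy), d.val_divFreq (hd.neg_mem k hk) _ (subset_closure hy),
      PiLp.smul_apply, PiLp.smul_apply, smul_eq_mul, smul_eq_mul, map_mul, map_inv₀,
      hg k y hy hyr i, freq, freq, conj_two_pi_I_mul_dotL (hd.im_N y hy hyr)]
  · have hk' : -k ∉ d.I := fun h => hk (by simpa using hd.neg_mem _ h)
    rw [d.divFreq_of_notMem hk, d.divFreq_of_notMem hk', _root_.zero_apply, _root_.zero_apply]
    have h0 : (0 : Coef m a b).val y i = 0 := by rw [← Hol.valL_apply, map_zero]; rfl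
    rw [h0, map_zero]

lemma IsReal.advect_const (hu : IsRealVF u) :
    IsRealVF (advect d.ρ_nonneg u (const d.N)) := by
  intro p hp hpr i
  have h := eval_advect d.ρ_nonneg hp.1 (subset_closure hp.2) u (const d.N)
  rw [const_eq_single, evalL_single] at h
  refine (congrArg (fun w : CVec m => (w i).im) h).trans ?_
  refine im_evalDeriv hρ hu hp.1 hp.2 (fun i => (hpr i).1) (fun i => (hpr i).2) (fun i => ?_) i
  have h1 : char (0 : Fin (m + 1) → ℤ) p.1 = 1 := by simp [char, dotL_apply]
  rw [h1, one_smul]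
  exact hd.im_N _ hp.2 (fun i => (hpr i).2) i

lemma IsReal.step (hX : IsRealVF X) (hu : IsRealVF u) (hu1 : ‖u‖ ≤ d.δ) (t : ℝ) :
    IsRealVF (d.step t X u) := by
  have h : (1 - (t : ℂ)) = ((1 - t : ℝ) : ℂ) := by push_cast; rfl
  rw [HomotopyData.step, h]
  exact hd.linv hρ (((d.isRealVF_pull hρ hX hu hu1).add (hd.advect_const hρ hu)).sub
    ((hX.incl (Nat.zero_le 1) (le_add_of_nonneg_right d.ν_pos.le)).smul (1 - t)))

lemma IsReal.sol (hX : IsRealVF X) (hXε : ‖X - const d.N‖ ≤ d.ε) {t : ℝ} (ht : ‖(t : ℂ)‖ ≤ 2) :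
    IsRealVF (d.sol t X) := by
  refine IsRealVF.of_tendsto (d.tendsto_iterate_sol ht hXε) fun n => ?_
  -- The norm bound is carried through the induction because `step` is known to preserve reality
  -- only inside the δ-ball.
  refine And.left (b := ‖(d.step t X)^[n] 0‖ ≤ d.δ) ?_
  induction n with
  | zero =>
    refine ⟨fun p hp hpr i => ?_, ?_⟩
    · rw [Function.iterate_zero_apply, ← evalL_apply hp.1, map_zero]
      rfl
    · rw [Function.iterate_zero_apply, norm_zero]
      exact d.δ_pos.le
  | succ n ih =>
    rw [Function.iterate_succ_apply']
    exact ⟨hd.step hρ hX ih.1 ih.2 t, d.norm_step_le ht hXε ih.2⟩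

end HomotopyData

end TorusVF

namespace TorusVF

/-! ### The homotopy data of the renormalized affine field -/

open TorusVF.Fourier

variable {m : ℕ}

lemma sum_abs_col_le_matNorm (M : Matrix (Fin (m + 1)) (Fin (m + 1)) ℝ)
    (j : Fin (m + 1)) : ∑ i, |M i j| ≤ matNorm M := by
  -- A real supremum bounds its members only if the set is bounded above; the column bound then
  -- comes from testing on a basis vector.
  have hbdd : BddAbove (range fun x : {x : Fin (m + 1) → ℝ // x ≠ 0} =>
      (∑ i, |M.mulVec x.1 i|) / ∑ i, |x.1 i|) := by
    refine ⟨∑ i, ∑ j, |M i j|, ?_⟩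
    rintro _ ⟨x, rfl⟩
    refine div_le_of_le_mul₀ (Finset.sum_nonneg fun _ _ => abs_nonneg _)
      (Finset.sum_nonneg fun _ _ => Finset.sum_nonneg fun _ _ => abs_nonneg _) ?_
    rw [Finset.sum_mul]
    refine Finset.sum_le_sum fun i _ => ?_
    rw [Finset.sum_mul]
    refine (Finset.abs_sum_le_sum_abs (fun j => M i j * x.1 j) Finset.univ).trans
      (Finset.sum_le_sum fun j _ => ?_)
    rw [abs_mul]
    exact mul_le_mul_of_nonneg_left (Finset.single_le_sum (f := fun j => |x.1 j|)
      (fun _ _ => abs_nonneg _) (Finset.mem_univ j)) (abs_nonneg _)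
  have h := le_ciSup hbdd ⟨Pi.single j 1, fun h => one_ne_zero (α := ℝ)
    (by simpa using congrFun h j)⟩
  have h1 : ∑ i, |(Pi.single j 1 : Fin (m + 1) → ℝ) i| = 1 := by
    rw [Finset.sum_eq_single j (fun i _ hi => by simp [hi]) (by simp)]
    simp
  simp only [h1, Matrix.mulVec_single_one, div_one] at h
  exact h

lemma closure_polyball_subset (a b : ℝ) : closure (polyball m a b) ⊆
    {y | ∑ i : Fin m, ‖y i.castSucc‖ ≤ a ∧ ‖y (Fin.last m)‖ ≤ b} := by
  refine closure_minimal (fun y hy => ⟨hy.1.le, hy.2.le⟩) ?_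
  rw [ofPred_and]
  refine IsClosed.inter (isClosed_le ?_ continuous_const) (isClosed_le ?_ continuous_const)
  · exact continuous_finsetSum _ fun i _ =>
      (PiLp.continuous_apply 1 (fun _ : Fin (m + 1) => ℂ) i.castSucc).norm
  · exact (PiLp.continuous_apply 1 (fun _ : Fin (m + 1) => ℂ) (Fin.last m)).norm

variable (c : CFData m) (n : ℕ)

/-- The part of `y ↦ γ⁻¹ M y` that comes from the coordinates other than the last one. -/
noncomputable def transverseField (y : CVec m) : CVec m :=
  WithLp.toLp 1 fun i => (c.γ n : ℂ)⁻¹ *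
    ∑ j : Fin m, (c.Mn n i j.castSucc : ℂ) * y j.castSucc

/-- The frequency vector `ω⁽ⁿ⁾` in `ℂ^d`. -/
noncomputable def complexω : CVec m := WithLp.toLp 1 fun i => (c.ω n i : ℂ)

lemma ω_apply (i : Fin (m + 1)) : c.ω n i = (c.γ n)⁻¹ * c.Mn n i (Fin.last m) := by
  simp [CFData.ω]

/-- The last column of γ⁻¹M is ω itself, so varying y_d only rescales the frequency; the condition
on `a` has to control just the other coordinates. -/
lemma affineField_eq (y : CVec m) :
    affineField c n y = (1 + y (Fin.last m)) • complexω c n + transverseField c n y := by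
  ext i
  change (c.ω n i : ℂ) + (c.γ n : ℂ)⁻¹ * ∑ j, (c.Mn n i j : ℂ) * y j =
    (1 + y (Fin.last m)) * (c.ω n i : ℂ) + (c.γ n : ℂ)⁻¹ *
      ∑ j : Fin m, (c.Mn n i j.castSucc : ℂ) * y j.castSucc
  rw [Fin.sum_univ_castSucc, ω_apply]
  push_cast
  ring

lemma norm_complexω : ‖complexω c n‖ = ‖c.ω n‖ := by
  rw [PiLp.norm_eq_of_L1, PiLp.norm_eq_of_L1]
  exact Finset.sum_congr rfl fun i _ => Complex.norm_real _

lemma norm_transverseField_le (y : CVec m) : ‖transverseField c n y‖ ≤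
    |c.γ n|⁻¹ * (matNorm (c.Mn n) * ∑ j : Fin m, ‖y j.castSucc‖) := by
  rw [PiLp.norm_eq_of_L1]
  have h1 : ∀ i, ‖transverseField c n y i‖ ≤
      |c.γ n|⁻¹ * ∑ j : Fin m, |c.Mn n i j.castSucc| * ‖y j.castSucc‖ := fun i => by
    change ‖(c.γ n : ℂ)⁻¹ * ∑ j : Fin m, (c.Mn n i j.castSucc : ℂ) * y j.castSucc‖ ≤ _
    rw [norm_mul, norm_inv, Complex.norm_real, Real.norm_eq_abs]
    refine mul_le_mul_of_nonneg_left ((norm_sum_le _ _).trans_eq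
      (Finset.sum_congr rfl fun j _ => ?_)) (inv_nonneg.2 (abs_nonneg _))
    rw [norm_mul, Complex.norm_real, Real.norm_eq_abs]
  refine (Finset.sum_le_sum fun i _ => h1 i).trans ?_
  rw [← Finset.mul_sum, Finset.sum_comm]
  conv_rhs => rw [Finset.mul_sum]
  refine mul_le_mul_of_nonneg_left (Finset.sum_le_sum fun j _ => ?_)
    (inv_nonneg.2 (abs_nonneg (c.γ n)))
  rw [← Finset.sum_mul]
  exact mul_le_mul_of_nonneg_right (sum_abs_col_le_matNorm _ _) (norm_nonneg _)

lemma val_affineCoef {a b : ℝ} {y : CVec m} (hy : y ∈ closure (polyball m a b)) :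
    (affineCoef c n a b).val y = affineField c n y := by
  simp [Hol.val, extend, affineCoef, hy]

lemma dotL_complexω (k : Fin (m + 1) → ℤ) :
    dotL k (complexω c n) = ((∑ i, (k i : ℝ) * c.ω n i : ℝ) : ℂ) := by
  rw [dotL_apply]
  push_cast
  rfl

variable {c n} {σ a b : ℝ} (ha : 0 < a)
  (ha' : a ≤ σ * (1 / 2 - b) * |c.γ n| * (matNorm (c.Mn n))⁻¹) (hγ : c.γ n ≠ 0)

include ha ha' hγ

lemma norm_transverseField_le_of_mem {y : CVec m} (hy : y ∈ closure (polyball m a b)) :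
    ‖transverseField c n y‖ ≤ σ * (1 / 2 - b) := by
  have h0 : 0 ≤ matNorm (c.Mn n) := (Finset.sum_nonneg fun _ _ => abs_nonneg _).trans
    (sum_abs_col_le_matNorm (c.Mn n) 0)
  -- A vanishing norm would have inverse 0 by convention, and the bound on `a` would contradict `0 <
  -- a`.
  have h1 : 0 < matNorm (c.Mn n) := h0.lt_of_ne' fun h => by
    rw [h, inv_zero, mul_zero] at ha'
    exact ha.not_ge ha'
  have h2 : 0 < |c.γ n| := abs_pos.2 hγ
  calc _ ≤ |c.γ n|⁻¹ * (matNorm (c.Mn n) * ∑ j : Fin m, ‖y j.castSucc‖) :=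
        norm_transverseField_le c n y
    _ ≤ |c.γ n|⁻¹ * (matNorm (c.Mn n) * (σ * (1 / 2 - b) * |c.γ n| * (matNorm (c.Mn n))⁻¹)) := by
        have := (closure_polyball_subset a b hy).1.trans ha'
        gcongr
    _ = σ * (1 / 2 - b) := by field_simp

/-- (1 + b)‖ω‖ + σ(1/2 - b) ≤ (3/2)‖ω‖, because σ < ‖ω‖. -/
lemma norm_affineCoef_le (hb' : b < 1 / 2) (hσ : 0 < σ) (hσω : σ < ‖c.ω n‖) :
    ‖affineCoef c n a b‖ ≤ 3 / 2 * ‖c.ω n‖ := by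
  refine Hol.norm_le_of_forall (by positivity) fun y hy => ?_
  rw [val_affineCoef c n hy, affineField_eq]
  have h1 := norm_transverseField_le_of_mem ha ha' hγ hy
  have h2 : ‖1 + y (Fin.last m)‖ ≤ 1 + b :=
    (norm_add_le _ _).trans (by rw [norm_one]; linarith [(closure_polyball_subset a b hy).2])
  refine (norm_add_le _ _).trans ?_
  rw [norm_smul, norm_complexω]
  nlinarith [norm_nonneg (c.ω n)]

/-- The rescaled frequency gives at least (1 - b)σ‖k‖, and the transverse term takes away at most
(1/2 - b)σ‖k‖, which leaves σ‖k‖/2. -/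
lemma le_norm_dotL_affineCoef {k : Fin (m + 1) → ℤ} (hk : k ∈ farModes c n σ) (hb' : b < 1 / 2)
    {y : CVec m} (hy : y ∈ closure (polyball m a b)) :
    σ * idxNorm k / 2 ≤ ‖dotL k ((affineCoef c n a b).val y)‖ := by
  have hk : σ * idxNorm k < |∑ i, (k i : ℝ) * c.ω n i| := hk
  have h1 := norm_transverseField_le_of_mem ha ha' hγ hy
  have h2 : 1 - b ≤ ‖1 + y (Fin.last m)‖ := by
    have := norm_sub_le (1 + y (Fin.last m)) (y (Fin.last m))
    rw [add_sub_cancel_right, norm_one] at this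
    linarith [(closure_polyball_subset a b hy).2]
  have h3 : ‖dotL k (transverseField c n y)‖ ≤ idxNorm k * (σ * (1 / 2 - b)) :=
    (norm_dotL_apply_le k _).trans (mul_le_mul_of_nonneg_left h1 (idxNorm_nonneg k))
  have h4 := norm_sub_le (dotL k (affineField c n y)) (dotL k (transverseField c n y))
  have h5 : dotL k (affineField c n y) - dotL k (transverseField c n y) =
      (1 + y (Fin.last m)) * dotL k (complexω c n) := by
    rw [affineField_eq, map_add, map_smul, smul_eq_mul, add_sub_cancel_right]
  rw [h5, norm_mul, dotL_complexω, Complex.norm_real, Real.norm_eq_abs] at h4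
  rw [val_affineCoef c n hy]
  nlinarith [abs_nonneg (∑ i, (k i : ℝ) * c.ω n i)]

omit ha ha' hγ

lemma zero_notMem_farModes : (0 : Fin (m + 1) → ℤ) ∉ farModes c n σ := by
  simp [farModes, idxNorm]

lemma neg_mem_farModes {k : Fin (m + 1) → ℤ} (hk : k ∈ farModes c n σ) : -k ∈ farModes c n σ := by
  have h1 : idxNorm (-k) = idxNorm k := by simp [idxNorm]
  change σ * idxNorm (-k) < |∑ i, (((-k) i : ℤ) : ℝ) * c.ω n i|
  rw [h1]
  simp only [Pi.neg_apply, Int.cast_neg, neg_mul, Finset.sum_neg_distrib, abs_neg]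
  exact hk

lemma im_affineField {y : CVec m} (hy : ∀ i, (y i).im = 0) (i : Fin (m + 1)) :
    (affineField c n y i).im = 0 := by
  change ((c.ω n i : ℂ) + (c.γ n : ℂ)⁻¹ * ∑ j, (c.Mn n i j : ℂ) * y j).im = 0
  rw [Complex.add_im, Complex.ofReal_im, ← Complex.ofReal_inv, Complex.im_ofReal_mul, Complex.im_sum]
  simp [hy]

/-- The homotopy data of the affine field `X_n^0` and the far from resonance modes. -/
noncomputable def homotopyData {ρ ν : ℝ} (hρ : 0 ≤ ρ) (hν : 0 < ν) (hσ : 0 < σ)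
    (hb' : b < 1 / 2) (hσω : σ < ‖c.ω n‖) (ha : 0 < a)
    (ha' : a ≤ σ * (1 / 2 - b) * |c.γ n| * (matNorm (c.Mn n))⁻¹) (hγ : c.γ n ≠ 0) :
    HomotopyData m ρ ν a b where
  N := affineCoef c n a b
  I := farModes c n σ
  σ := σ
  w := ‖c.ω n‖
  ρ_nonneg := hρ
  ν_pos := hν
  σ_pos := hσ
  σ_lt := hσω
  norm_N_le := norm_affineCoef_le ha ha' hγ hb' hσ hσω
  zero_notMem := zero_notMem_farModes
  le_norm_dotL := fun _ hk _ hy => le_norm_dotL_affineCoef ha ha' hγ hk hb' hy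

end TorusVF

/-! ### The theorem. -/

open TorusVF
theorem mainTheorem5 {m : ℕ} (hm : 1 ≤ m) (c : CFData m) (n : ℕ) (hγ : c.γ n ≠ 0)
    (σ ρ ν a b : ℝ) (hσ : 0 < σ) (hρ : 0 < ρ) (hν : 0 < ν) (ha : 0 < a) (hb : 0 < b)
    (ha' : a ≤ σ * (1 / 2 - b) * |c.γ n| * (matNorm (c.Mn n))⁻¹) (hb' : b < 1 / 2)
    (hσω : σ < ‖c.ω n‖) :
    ∃ (u : ℝ → 𝒜' m (ρ + ν) a b → 𝒜' m ρ a b) (𝒰 : ℝ → 𝒜' m (ρ + ν) a b → 𝒜 m ρ a b),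
      (∀ X ∈ ballV c n ρ ν a b (epsRadius c n σ ν),
        -- the isotopy of analytic diffeomorphisms `U_t(x, y) = (x + u_t(x, y), y)`
        u 0 X = 0 ∧
        AnalyticOn ℝ (fun t => u t X) (Icc 0 1) ∧
        ∀ t ∈ Icc (0 : ℝ) 1,
          IsAnalyticDiffeoOn (shift (u t X)) (strip m ρ ×ˢ polyball m a b) ∧
          MapsTo (shift (u t X)) (strip m ρ ×ˢ polyball m a b)
            (strip m (ρ + ν) ×ˢ polyball m a b) ∧
          -- `𝒰 t X` is the pull-back of `X` under `U_t`
          (∀ p ∈ strip m ρ ×ˢ polyball m a b,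
            fullField (𝒰 t X) p = VectorField.pullback ℂ (shift (u t X)) (fullField X) p) ∧
          -- the homotopy equation
          Fourier.proj (farModes c n σ) (𝒰 t X) =
            Fourier.incl (Nat.zero_le 1) (le_add_of_nonneg_right hν.le)
              (((1 - t : ℝ) : ℂ) • Fourier.proj (farModes c n σ) X) ∧
          -- the estimates, with `f = X - X_n^0`
          ‖u t X‖ ≤ 42 * t / σ *
            ‖(Fourier.incl (Nat.zero_le 1) (le_add_of_nonneg_right hν.le)
              (Fourier.proj (farModes c n σ) (X - X0 c n 1 (ρ + ν) a b)) : 𝒜 m ρ a b)‖ ∧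
          ‖𝒰 t X - X0 c n 0 ρ a b‖ ≤ (3 - t) * ‖X - X0 c n 1 (ρ + ν) a b‖ ∧
          (IsRealVF X → ∀ p ∈ strip m ρ ×ˢ polyball m a b, p ∈ realPoints m →
            shift (u t X) p ∈ realPoints m)) ∧
      -- analytic dependence on `X`; the second map takes values in the direct sum of the resonant
      -- part of `𝒜_{ρ,r}` and of the far from resonance part of `𝒜'_{ρ+ν,r}`
      ∀ t ∈ Icc (0 : ℝ) 1,
        IsAnalyticMapOn (u t) (ballV c n ρ ν a b (epsRadius c n σ ν)) ∧
        IsAnalyticMapOn (𝒰 t) (ballV c n ρ ν a b (epsRadius c n σ ν)) ∧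
        IsAnalyticMapOn
          (fun X => (Fourier.proj (farModes c n σ)ᶜ (𝒰 t X),
            ((1 - t : ℝ) : ℂ) • Fourier.proj (farModes c n σ) X))
          (ballV c n ρ ν a b (epsRadius c n σ ν)) := by
  set d : HomotopyData m ρ ν a b := homotopyData hρ.le hν hσ hb' hσω ha ha' hγ with hd
  have hball : ∀ {X}, X ∈ ballV c n ρ ν a b (epsRadius c n σ ν) →
      ‖X - Fourier.const d.N‖ < d.ε := fun {X} hX => by
    rw [← dist_eq_norm]
    -- For these data `d.ε` and `const d.N` unfold to `epsRadius` and `X0`.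
    exact hX
  have hcast : ∀ t : ℝ, ((1 - t : ℝ) : ℂ) = 1 - (t : ℂ) := fun t => by push_cast; rfl
  have hnorm : ∀ {t : ℝ}, t ∈ Icc (0 : ℝ) 1 → ‖(t : ℂ)‖ ≤ 1 := fun {t} ht => by
    rw [Complex.norm_real, Real.norm_eq_abs, abs_of_nonneg ht.1]
    exact ht.2
  have hreal : d.IsReal := ⟨fun _ => neg_mem_farModes, fun y hy hyr i => by
    have h : d.N.val y = affineField c n y := val_affineCoef c n (subset_closure hy)
    rw [h]
    exact im_affineField hyr i⟩
  refine ⟨fun t X => d.sol (t : ℂ) X, fun t X => d.pull X (d.sol (t : ℂ) X), fun X hX => ?_,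
    fun t ht => ?_⟩
  · have hXε := hball hX
    refine ⟨?_, d.analyticOn_sol hXε, fun t ht => ?_⟩
    · have h := d.sol_zero hXε.le
      rwa [← Complex.ofReal_zero] at h
    have ht2 : ‖(t : ℂ)‖ ≤ 2 := (hnorm ht).trans one_le_two
    have hu := (d.sol_spec ht2 hXε.le).1
    have hu1 := d.norm_lt_one hu
    refine ⟨isAnalyticDiffeoOn_shift hu1, mapsTo_shift ?_, fun p hp => ?_, ?_, ?_,
      d.norm_pull_sol_sub_le hXε.le ht.1 ht.2, fun hXr p hp hpr => ?_⟩
    · rw [le_div_iff₀' Real.two_pi_pos]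
      exact (d.two_pi_mul_norm_lt hu).le
    · exact fullField_eq_pullback hu1 hp (d.eval_pull_add X hu hp)
    · refine (d.proj_pull_sol ht2 hXε.le).trans ?_
      rw [hcast, ← Fourier.inclL_apply, map_smul]
      exact congrArg _ (Fourier.incl_proj (Nat.zero_le 1) (le_add_of_nonneg_right hν.le) d.I X).symm
    · rw [Fourier.incl_proj]
      refine (d.norm_sol_le ht2 hXε.le).trans (mul_le_mul_of_nonneg_right ?_ (norm_nonneg _))
      rw [Complex.norm_real, Real.norm_eq_abs, abs_of_nonneg ht.1]
      -- The fixed point bound has the constant 4, so 42 holds with room to spare.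
      exact div_le_div_of_nonneg_right (by linarith [ht.1]) hσ.le
    · exact shift_mem_realPoints (hreal.sol hρ hXr hXε.le ht2) hp hpr
  · have ht2 : ‖(t : ℂ)‖ < 2 := (hnorm ht).trans_lt one_lt_two
    have hpull := fun X hX => d.differentiableAt_pull_sol (X := X) ht2 (hball hX)
    exact ⟨fun X hX => d.differentiableAt_sol_right ht2 (hball hX), hpull, fun X hX =>
      ((Fourier.projL _).differentiableAt.comp X (hpull X hX)).prodMk
        (((1 - t : ℝ) : ℂ) • Fourier.projL (farModes c n σ)).differentiableAt⟩
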